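/- Let $N\ge 2$ and $m\ge 2$. For an integer $k\ge 2$ let $\mathcal{K}^k$ be the space of odd curves $\eta\colon(-1,1)\to\mathbb{R}^N$ with $\int_{-1}^1(1-s^2)^j|\partial_s^j\eta(s)|^2\,ds<\infty$ for $0\le j\le k$ (weak derivatives), let $\mathcal{A}^k=\{\eta\in\mathcal{K}^k:|\eta'|\equiv1\}$, and let $T_\eta\mathcal{A}^k=\{v\in\mathcal{K}^k:\langle v',\eta'\rangle\equiv0\}$, with the Riemannian metric $\langle\!\langle u,v\rangle\!\rangle=\int_{-1}^1\langle u(s),v(s)\rangle\,ds$. Let $\gamma\in\mathcal{A}^{m+2}$ and let $P_\gamma$ be the $L^2$-orthogonal projection onto the $L^2$-closure of $T_\gamma\mathcal{A}^m$. For $u,v\in T_\gamma\mathcal{A}^m$ the second fundamental form of $\mathcal{A}^m$ in the flat space $\mathcal{K}^m$ is $S(u,v)=\dot V(0)-P_\gamma(\dot V(0))$, where $\eta(t)$ is a curve in $\mathcal{A}^m$ with $\eta(0)=\gamma$, $\dot\eta(0)=u$, and $V(t)\in T_{\eta(t)}\mathcal{A}^m$ is a field along it with $V(0)=v$ ($\eta$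 differentiable at $t=0$ in $H^1$, $V$ continuous at $0$ in $H^1$ and differentiable at $0$ in $L^2$). Such $(\eta,V)$ exist and $S(u,v)$ does not depend on the choice. For linearly independent $u,v$ the sectional curvature at $\gamma$ of the plane they span is $$K(u,v)=\frac{\langle\!\langle S(u,u),S(v,v)\rangle\!\rangle-\langle\!\langle S(u,v),S(u,v)\rangle\!\rangle}{\langle\!\langle u,u\rangle\!\rangle\langle\!\langle v,v\rangle\!\rangle-\langle\!\langle u,v\rangle\!\rangle^2}.$$ It is the curvature of the Levi-Civita covariant derivative $D=P\circ\partial$: if $F(a,b)$ is a two-parameter family in $\mathcal{A}^m$, of class $C^3$ into $L^2$ and $C^1$ into $H^1$, whose coordinate fields $X=\partial_aF$, $Y=\partial_bF$ take values in the tangent spaces $T_{F}\mathcal{A}^m$, with $F(0,0)=\gamma$, $X(0,0)=u$, $Y(0,0)=v$, then at $(0,0)$ $$\big(\partial_a\langle\!\langle D_bY,X\rangle\!\rangle-\langle\!\langle D_bY,D_aX\rangle\!\rangle\big)-\big(\partial_b\langle\!\langle D_aY,X\rangle\!\rangle-\langle\!\langle D_aY,D_bX\rangle\!\rangle\big)=K(u,v)\big(\langle\!\langle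 u,u\rangle\!\rangle\langle\!\langle v,v\rangle\!\rangle-\langle\!\langle u,v\rangle\!\rangle^2\big).$$ The Green function $G$ on $[-1,1]^2$, determined by $$\frac{\partial^2G}{\partial s^2}(s,x)-|\gamma''(s)|^2G(s,x)=-\delta(s-x),\qquad G(-1,x)=G(1,x)=0,$$ with $G(\cdot,x)$ continuous on $[-1,1]$, exists, and $\varrho=\int_0^1(1-s)|\gamma''(s)|^2\,ds$ is finite. For all linearly independent $u,v\in T_\gamma\mathcal{A}^m$, $$K(u,v)=\frac{\int_{-1}^1\int_{-1}^1G(s,x)\big(|u'(s)|^2|v'(x)|^2-\langle u'(x),v'(x)\rangle\langle u'(s),v'(s)\rangle\big)\,ds\,dx}{\int_{-1}^1\int_{-1}^1\big(|u(s)|^2|v(x)|^2-\langle u(x),v(x)\rangle\langle u(s),v(s)\rangle\big)\,ds\,dx},$$ where both integrals converge absolutely and the denominator is positive, and $$K(u,v)\ge\frac{e^{-\varrho}}{1+\varrho}.$$ In particular $K(u,v)>0$ for every plane. On the other hand, for every such $\gamma$ the curvature is unbounded above: for every $C$ there are linearly independent $u,v\in T_\gamma\mathcal{A}^m$ with $K(u,v)>C$.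 -/

import Mathlib

open MeasureTheory Set Filter Topology
open scoped ContDiff

noncomputable section

/-- The ambient Euclidean space `ℝ^N`. -/
abbrev Amb (N : ℕ) : Type := EuclideanSpace ℝ (Fin N)

/-- The open parameter interval `(-1, 1)`. -/
abbrev arcI : Set ℝ := Ioo (-1 : ℝ) 1

/-- Lebesgue measure on `(-1, 1)`. -/
abbrev arcMeas : Measure ℝ := volume.restrict arcI

/-- The measure `(1 - s²)^j ds` on `(-1, 1)`. -/
def weightMeas (j : ℕ) : Measure ℝ :=
  arcMeas.withDensity (fun s => ENNReal.ofReal ((1 - s ^ 2) ^ j))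

/-- The weighted Sobolev space `𝒦^m` of odd curves `η : (-1,1) → ℝ^N` with
`‖η‖²_{j,j} = ∫ (1 - s²)^j |∂_s^j η|² ds < ∞` for `0 ≤ j ≤ m`.
Here `D j` is the `j`-th weak derivative of `η`: the derivatives of order `< m` are locally
absolutely continuous in `(-1,1)` and each one is the primitive of the next.
Curves are functions on `ℝ` of which only the values on `(-1,1)` matter. -/
def MemCurveSpace {N : ℕ} (m : ℕ) (η : ℝ → Amb N) : Prop :=
  (∀ s ∈ arcI, η (-s) = -η s) ∧
  ∃ D : ℕ → ℝ → Amb N,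
    (∀ s ∈ arcI, D 0 s = η s) ∧
    (∀ k < m, ∀ s ∈ arcI, ∀ t ∈ arcI,
      IntervalIntegrable (D (k + 1)) volume s t ∧ ∫ x in s..t, D (k + 1) x = D k t - D k s) ∧
    (∀ j ≤ m, MemLp (D j) 2 (weightMeas j))

/-- The arc space `𝒜^m` (used for `m ≥ 2`, where curves in `𝒦^m` are `C¹` in `(-1,1)`):
curves in `𝒦^m` with `|η'| ≡ 1`. -/
def MemArcSpace {N : ℕ} (m : ℕ) (η : ℝ → Amb N) : Prop :=
  MemCurveSpace m η ∧ ∀ s ∈ arcI, ‖deriv η s‖ = 1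

/-- The tangent space `T_η 𝒜^m = {v ∈ 𝒦^m : ⟨v', η'⟩ ≡ 0}`. -/
def MemTangent {N : ℕ} (m : ℕ) (η v : ℝ → Amb N) : Prop :=
  MemCurveSpace m v ∧ ∀ s ∈ arcI, inner ℝ (deriv v s) (deriv η s) = 0

/-- The Hilbert space `L²((-1,1); ℝ^N)`; its inner product is the Riemannian metric
`⟪⟪u, v⟫⟫ = ∫ ⟨u(s), v(s)⟩ ds`. -/
abbrev ArcL2 (N : ℕ) : Type := Lp (Amb N) 2 arcMeas

open Classical in
/-- The class in `L²` of a square integrable function (for `m ≥ 2` every `v ∈ 𝒦^m` and its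
derivative `v'` are square integrable; the value `0` elsewhere is never used). -/
def toL2 {N : ℕ} (f : ℝ → Amb N) : ArcL2 N :=
  if h : MemLp f 2 arcMeas then h.toLp f else 0

/-- The closure in `L²` of the tangent space `T_η 𝒜^m` (which is a linear subspace for `m ≥ 2`,
so that the span only serves to bundle it). -/
def tangentL2 {N : ℕ} (m : ℕ) (η : ℝ → Amb N) : Submodule ℝ (ArcL2 N) :=
  (Submodule.span ℝ {f : ArcL2 N | ∃ v, MemTangent m η v ∧ f = toL2 v}).topologicalClosure

/-- Orthogonal projection, in the `L²` metric, onto (the closure of) `T_η 𝒜^m`. -/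
def tangentProj {N : ℕ} (m : ℕ) (η : ℝ → Amb N) : ArcL2 N →L[ℝ] ArcL2 N :=
  haveI : CompleteSpace (tangentL2 m η) :=
    (Submodule.isClosed_topologicalClosure _).completeSpace_coe
  (tangentL2 m η).starProjection

/-- `η` is a curve in `𝒜^m` with `η(0) = γ` and `η̇(0) = u`, and `V` is a tangent field along it
(`V(t) ∈ T_{η(t)} 𝒜^m`) with `V(0) = v` and ambient derivative `V̇(0) = z`.
The curve is differentiable at `0` in `H¹`; the field is continuous at `0` in `H¹` and
differentiable at `0` in `L²`. -/
structure IsFieldAlong {N : ℕ} (m : ℕ) (γ u v : ℝ → Amb N) (η V : ℝ → ℝ → Amb N)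
    (z : ArcL2 N) : Prop where
  arc : ∀ᶠ t in 𝓝 (0 : ℝ), MemArcSpace m (η t)
  tangent : ∀ᶠ t in 𝓝 (0 : ℝ), MemTangent m (η t) (V t)
  base : η 0 = γ
  init : V 0 = v
  velocity : HasDerivAt (fun t => toL2 (η t)) (toL2 u) 0
  velocity_deriv : HasDerivAt (fun t => toL2 (deriv (η t))) (toL2 (deriv u)) 0
  field_cont : ContinuousAt (fun t => toL2 (deriv (V t))) 0
  field_deriv : HasDerivAt (fun t => toL2 (V t)) z 0

/-- `n = S(u, v)` for the second fundamental form `S` of `𝒜^m` in the flat space `𝒦^m` at `γ`: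
the component orthogonal to `T_γ 𝒜^m` of the ambient derivative `∇_u V = V̇(0)` of a tangent
field `V` extending `v` along a curve with velocity `u`; such extensions exist, and all of
them give the same normal component. -/
def HasSecondFundForm {N : ℕ} (m : ℕ) (γ u v : ℝ → Amb N) (n : ArcL2 N) : Prop :=
  (∃ η V z, IsFieldAlong m γ u v η V z) ∧
  ∀ η V z, IsFieldAlong m γ u v η V z → n = z - tangentProj m γ z

/-- `⟪⟪u,u⟫⟫ ⟪⟪v,v⟫⟫ - ⟪⟪u,v⟫⟫²`, the squared area of the parallelogram spanned by `u` and `v`. -/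
def gramL2 {N : ℕ} (u v : ℝ → Amb N) : ℝ :=
  inner ℝ (toL2 u) (toL2 u) * inner ℝ (toL2 v) (toL2 v) - inner ℝ (toL2 u) (toL2 v) ^ 2

/-- `K` is the sectional curvature at `γ`, in the `L²` metric, of the plane spanned by
`u, v ∈ T_γ 𝒜^m`, where `𝒜^m` is regarded as a Riemannian submanifold of the flat space `𝒦^m`. -/
def HasSectionalCurvature {N : ℕ} (m : ℕ) (γ u v : ℝ → Amb N) (K : ℝ) : Prop :=
  ∃ nuu nvv nuv : ArcL2 N,
    HasSecondFundForm m γ u u nuu ∧ HasSecondFundForm m γ v v nvv ∧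
    HasSecondFundForm m γ u v nuv ∧
    K = (inner ℝ nuu nvv - inner ℝ nuv nuv) / gramL2 u v

/-- The coordinate field `∂_e F` along a two-parameter family `F`. -/
def coordField {N : ℕ} (F : ℝ × ℝ → ℝ → Amb N) (e p : ℝ × ℝ) : ArcL2 N :=
  fderiv ℝ (fun q => toL2 (F q)) p e

/-- The Levi-Civita covariant derivative `D_e W` of a field `W` along a family `F`: the
tangential part of the ambient derivative. -/
def covDeriv {N : ℕ} (m : ℕ) (F : ℝ × ℝ → ℝ → Amb N) (e : ℝ × ℝ) (W : ℝ × ℝ → ArcL2 N)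
    (p : ℝ × ℝ) : ArcL2 N :=
  tangentProj m (F p) (fderiv ℝ W p e)

/-- A two-parameter family `F(a, b)` in `𝒜^m` with `F(0,0) = γ`, `∂_a F(0,0) = u` and
`∂_b F(0,0) = v`, of class `C³` into `L²` and `C¹` into `H¹`, whose coordinate fields take values
in the tangent spaces. -/
structure IsRegularSurface {N : ℕ} (m : ℕ) (γ u v : ℝ → Amb N)
    (F : ℝ × ℝ → ℝ → Amb N) : Prop where
  arc : ∀ᶠ p in 𝓝 (0 : ℝ × ℝ), MemArcSpace m (F p)
  tangent : ∀ e : ℝ × ℝ, ∀ᶠ p in 𝓝 (0 : ℝ × ℝ),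
    ∃ w, MemTangent m (F p) w ∧ coordField F e p = toL2 w
  base : F 0 = γ
  velocity_fst : coordField F (1, 0) 0 = toL2 u
  velocity_snd : coordField F (0, 1) 0 = toL2 v
  smooth : ContDiffAt ℝ 3 (fun p => toL2 (F p)) 0
  smooth_deriv : ContDiffAt ℝ 1 (fun p => toL2 (deriv (F p))) 0

/-- `R = ⟪⟪D_a D_b Y - D_b D_a Y, X⟫⟫` at `(a,b) = (0,0)`, where `X = ∂_a F`, `Y = ∂_b F` and `D` is
the Levi-Civita covariant derivative. Since `D_b Y` need not be differentiable,
`⟪⟪D_a D_b Y, X⟫⟫` is read as `∂_a ⟪⟪D_b Y, X⟫⟫ - ⟪⟪D_b Y, D_a X⟫⟫`, and likewise for the second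
term. -/
def HasRiemannCurvature {N : ℕ} (m : ℕ) (F : ℝ × ℝ → ℝ → Amb N) (R : ℝ) : Prop :=
  let X := coordField F (1, 0)
  let Y := coordField F (0, 1)
  ∃ d₁ d₂ : ℝ,
    HasDerivAt (fun a : ℝ => (inner ℝ (covDeriv m F (0, 1) Y (a, 0)) (X (a, 0)) : ℝ)) d₁ 0 ∧
    HasDerivAt (fun b : ℝ => (inner ℝ (covDeriv m F (1, 0) Y (0, b)) (X (0, b)) : ℝ)) d₂ 0 ∧
    R = (d₁ - inner ℝ (covDeriv m F (0, 1) Y 0) (covDeriv m F (1, 0) X 0))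
      - (d₂ - inner ℝ (covDeriv m F (1, 0) Y 0) (covDeriv m F (0, 1) X 0))

/-- `G` is the Green function of the Dirichlet problem on `[-1,1]` for `σ'' - |γ''|² σ`: for each
`x`, the function `G(·, x)` is continuous on `[-1,1]`, vanishes at `±1`, and satisfies
`∂²G/∂s² - |γ''(s)|² G = -δ(s - x)` in the sense of distributions on `(-1,1)`. -/
def IsGreenFunction {N : ℕ} (γ : ℝ → Amb N) (G : ℝ → ℝ → ℝ) : Prop :=
  ∀ x ∈ Icc (-1 : ℝ) 1,
    ContinuousOn (fun s => G s x) (Icc (-1 : ℝ) 1) ∧ G (-1) x = 0 ∧ G 1 x = 0 ∧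
    ∀ φ : ℝ → ℝ, ContDiff ℝ ∞ φ → HasCompactSupport φ → tsupport φ ⊆ arcI →
      ∫ s in (-1 : ℝ)..1, G s x * (deriv (deriv φ) s - ‖deriv (deriv γ) s‖ ^ 2 * φ s) = -φ x

/-- `u` and `v` are linearly independent as functions on `(-1,1)`, so that they span a plane. -/
def SpanPlane {N : ℕ} (u v : ℝ → Amb N) : Prop :=
  ∀ a b : ℝ, (∀ s ∈ arcI, a • u s + b • v s = 0) → a = 0 ∧ b = 0

/-- `ϱ = ∫₀¹ (1 - s) |γ''(s)|² ds`. -/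
def arcRho {N : ℕ} (γ : ℝ → Amb N) : ℝ :=
  ∫ s in (0 : ℝ)..1, (1 - s) * ‖deriv (deriv γ) s‖ ^ 2

/-- The integrand `G(s,x) (|u'(s)|² |v'(x)|² - ⟨u'(x), v'(x)⟩ ⟨u'(s), v'(s)⟩)`. -/
def curvNumer {N : ℕ} (G : ℝ → ℝ → ℝ) (u v : ℝ → Amb N) (s x : ℝ) : ℝ :=
  G s x * (‖deriv u s‖ ^ 2 * ‖deriv v x‖ ^ 2
    - inner ℝ (deriv u x) (deriv v x) * inner ℝ (deriv u s) (deriv v s))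

/-- The integrand `|u(s)|² |v(x)|² - ⟨u(x), v(x)⟩ ⟨u(s), v(s)⟩`. -/
def curvDenom {N : ℕ} (u v : ℝ → Amb N) (s x : ℝ) : ℝ :=
  ‖u s‖ ^ 2 * ‖v x‖ ^ 2 - inner ℝ (u x) (v x) * inner ℝ (u s) (v s)

end

/-! Write q = |γ''|². Differentiating the constraint ⟨V', η'⟩ = 0 at t = 0 gives ⟨V̇', γ'⟩ = -⟨u',
v'⟩ in the weak sense, while curves (σγ')' with σ(±1) = 0 are orthogonal to T_γ. Since |γ'| = 1
forces ⟨γ', γ'''⟩ = -q, a curve (σγ')' with the required γ'-component of its derivative is obtained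
by solving σ'' - qσ = -⟨u', v'⟩, σ(±1) = 0. Hence S(u,v) = (σγ')' with σ the Green potential of ⟨u',
v'⟩ (`exists_hasSecondFundForm`). One integration by parts turns the inner product of two such
curves with densities f, g into ∬ G(s,x) f(s) g(x) (`inner_normalCurve_normalCurve`), so the
definition of K becomes the stated quotient (`hasSectionalCurvature_greenFn`). Its agreement with
the Levi-Civita curvature is the Gauss equation (`IsRegularSurface.hasRiemannCurvature`).

What makes this rigorous is Hardy's inequality (`lintegral_hardy`): a bound on f' with weight
(1-s²)^(α+2) gives one on f with weight (1-s²)^α. So u', v' and γ'' lie in L², the potential q is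
integrable, and the Dirichlet problem is regular. The third derivative γ''' may blow up at ±1, but
(1-s²)γ''' is in L² and σ = O(1-s²). Two facts make S well defined. Every normal vector acts on odd
curves as g ↦ ∫ τ⟨γ', g'⟩ with τ bounded (`exists_inner_toL2_eq_of_mem_orthogonal`), which
determines the normal part of V̇(0). And admissible curves and fields exist (`exists_isFieldAlong`),
by approximating u' and v' with compactly supported even fields and returning to the unit sphere by
stereographic projection.

G is assembled from one solution z of z'' = qz with z(1) = 0, z'(1) = -1. As q is even, z(-s) is a
second solution, and G(s,x) = z(-min) z(max)/W, where W is their Wronskian. Since u' and v' are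
even, only the even part of G matters. Convexity of z and the Grönwall bound -z'(0) ≤ e^ϱ give
G(s,x) + G(s,-x) ≥ (e^{-ϱ}/2)(1-s²)(1-x²) (`greenFn_add_ge`). The symmetrised integrand is
nonnegative by Cauchy-Schwarz, so the numerator of K is at least e^{-ϱ}/4 times the Gram determinant
of u', v' with weight 1-s². The spectral gap 2 of the Legendre operator on odd functions
(`IsOddArc.two_mul_integral_le`) makes that determinant at least four times the one in the
denominator. The result is K ≥ e^{-ϱ}, stronger than the bound asserted.

For unboundedness, let u' and v' be supported in disjoint symmetric sets of width of order r, inside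
[-1/2, 1/2]. The mixed terms vanish and G is bounded below there, so the numerator is at least a
constant times ∫|u'|² ∫|v'|², whereas the denominator is O(r²) times that product
(`exists_lt_sectionalCurvature`). -/

/-! ### Hardy's inequality and the weights (1-s²)^j -/

theorem lintegral_Ioo_of_hasDerivAt {a b : ℝ} (hab : a ≤ b) {F f : ℝ → ℝ}
    (hF : ContinuousOn F (Icc a b)) (hd : ∀ x ∈ Ioo a b, HasDerivAt F (f x) x)
    (h0 : ∀ x ∈ Ioo a b, 0 ≤ f x) :
    ∫⁻ x in Ioo a b, ENNReal.ofReal (f x) = ENNReal.ofReal (F b - F a) := by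
  have hi : IntegrableOn f (Ioc a b) := intervalIntegral.integrableOn_deriv_of_nonneg hF hd h0
  have hi' : IntegrableOn f (Ioo a b) := hi.mono_set Ioo_subset_Ioc_self
  rw [← ofReal_integral_eq_lintegral_ofReal hi' ((ae_restrict_iff' measurableSet_Ioo).2
    (Eventually.of_forall h0)), ← integral_Ioc_eq_integral_Ioo,
    ← intervalIntegral.integral_of_le hab,
    intervalIntegral.integral_eq_sub_of_hasDerivAt_of_le hab hF hd
      ((intervalIntegrable_iff_integrableOn_Ioc_of_le hab).2 hi)]

/-- Hardy's inequality on `(0, 1)` with weights that are powers of the distance to `1`. -/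
theorem lintegral_hardy (α : ℕ) {g : ℝ → ENNReal} (hg : AEMeasurable g (volume.restrict (Ioo 0 1))) :
    ∫⁻ s in Ioo (0 : ℝ) 1, ENNReal.ofReal ((1 - s) ^ α) * (∫⁻ x in Ioo 0 s, g x) ^ 2 ≤
      4 * ∫⁻ x in Ioo (0 : ℝ) 1, ENNReal.ofReal ((1 - x) ^ (α + 2)) * g x ^ 2 := by
  -- Cauchy-Schwarz is applied to g = (1-x)^{(r+1)/2} g · (1-x)^{-(r+1)/2}, and then the order of
  -- integration is exchanged. The choice 2r = α + 1 makes α - r = r - 1, so each of the two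
  -- elementary integrals costs a factor 1/r ≤ 2, and r + (r+1) = α + 2.
  set r : ℝ := ((α : ℝ) + 1) / 2 with hr
  have hr0 : 0 < r := by positivity
  have hr2 : 1 / r ≤ 2 := by
    rw [div_le_iff₀ hr0]; have : (0 : ℝ) ≤ α := by positivity
    linarith
  set A : ℝ → ENNReal := fun x => ENNReal.ofReal ((1 - x) ^ (r + 1)) with hA
  have hAm : Measurable A := by fun_prop
  have hrp : ∀ (p x : ℝ), x ∈ Ioo (0 : ℝ) 1 →
      HasDerivAt (fun x : ℝ => (1 - x) ^ p) (-(p * (1 - x) ^ (p - 1))) x := by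
    intro p x hx
    have := ((hasDerivAt_id' x).const_sub 1).rpow_const (p := p) (Or.inl (by linarith [hx.2]))
    exact this.congr_deriv (by ring)
  have h1 : ∀ s ∈ Ioo (0 : ℝ) 1, (∫⁻ x in Ioo 0 s, g x) ^ 2 ≤
      ENNReal.ofReal (2 * (1 - s) ^ (-r)) * ∫⁻ x in Ioo 0 s, A x * g x ^ 2 := by
    intro s hs
    have hgs : AEMeasurable g (volume.restrict (Ioo 0 s)) :=
      hg.mono_measure (Measure.restrict_mono (Ioo_subset_Ioo le_rfl hs.2.le) le_rfl)
    have key := ENNReal.lintegral_mul_le_Lp_mul_Lq (volume.restrict (Ioo 0 s))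
      (Real.HolderConjugate.two_two)
      (f := fun x => ENNReal.ofReal ((1 - x) ^ ((r + 1) / 2)) * g x)
      (g := fun x => ENNReal.ofReal ((1 - x) ^ (-((r + 1) / 2))))
      ((by fun_prop : Measurable fun x : ℝ =>
        ENNReal.ofReal ((1 - x) ^ ((r + 1) / 2))).aemeasurable.mul hgs) (by fun_prop)
    have e1 : ∫⁻ x in Ioo 0 s, g x = ∫⁻ x in Ioo 0 s,
        ((fun x => ENNReal.ofReal ((1 - x) ^ ((r + 1) / 2)) * g x) *
          fun x => ENNReal.ofReal ((1 - x) ^ (-((r + 1) / 2)))) x := by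
      refine setLIntegral_congr_fun measurableSet_Ioo fun x hx => ?_
      have hx1 : 0 < 1 - x := by linarith [hx.2, hs.2]
      simp only [Pi.mul_apply]
      rw [mul_right_comm, ← ENNReal.ofReal_mul (by positivity), ← Real.rpow_add hx1]
      simp
    have e2 : ∫⁻ x in Ioo 0 s, (ENNReal.ofReal ((1 - x) ^ ((r + 1) / 2)) * g x) ^ (2 : ℝ) =
        ∫⁻ x in Ioo 0 s, A x * g x ^ 2 := by
      refine setLIntegral_congr_fun measurableSet_Ioo fun x hx => ?_
      have hx1 : 0 < 1 - x := by linarith [hx.2, hs.2]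
      simp only [hA]
      rw [ENNReal.mul_rpow_of_nonneg _ _ (by norm_num), ENNReal.rpow_two, ENNReal.rpow_two,
        ← ENNReal.ofReal_pow (by positivity), ← Real.rpow_natCast, ← Real.rpow_mul hx1.le]
      congr 3
      push_cast; ring
    have e3 : ∫⁻ x in Ioo 0 s, ENNReal.ofReal ((1 - x) ^ (-((r + 1) / 2))) ^ (2 : ℝ) ≤
        ENNReal.ofReal (2 * (1 - s) ^ (-r)) := by
      have : ∫⁻ x in Ioo 0 s, ENNReal.ofReal ((1 - x) ^ (-((r + 1) / 2))) ^ (2 : ℝ) =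
          ∫⁻ x in Ioo 0 s, ENNReal.ofReal ((1 - x) ^ (-r - 1)) := by
        refine setLIntegral_congr_fun measurableSet_Ioo fun x hx => ?_
        have hx1 : 0 < 1 - x := by linarith [hx.2, hs.2]
        rw [ENNReal.rpow_two, ← ENNReal.ofReal_pow (by positivity), ← Real.rpow_natCast,
          ← Real.rpow_mul hx1.le]
        congr 2
        push_cast; ring
      rw [this, lintegral_Ioo_of_hasDerivAt hs.1.le (F := fun x => (1 / r) * (1 - x) ^ (-r))]
      · apply ENNReal.ofReal_le_ofReal
        have h3 : (0 : ℝ) ≤ (1 - s) ^ (-r) := Real.rpow_nonneg (by linarith [hs.2]) _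
        have h4 : (0 : ℝ) ≤ 1 / r := by positivity
        simp only [sub_zero, Real.one_rpow, mul_one]
        nlinarith
      · intro x hx
        have hx1 : 0 < 1 - x := by linarith [hx.2, hs.2]
        refine ContinuousAt.continuousWithinAt ?_
        refine continuousAt_const.mul ?_
        exact (continuousAt_const.sub continuousAt_id).rpow_const (Or.inl (by
          simp; linarith [hx.2, hs.2]))
      · intro x hx
        have := (hrp (-r) x ⟨hx.1, hx.2.trans hs.2⟩).const_mul (1 / r)
        exact this.congr_deriv (by
          rw [neg_mul, neg_neg, ← mul_assoc, one_div_mul_cancel hr0.ne', one_mul])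
      · intro x hx
        exact Real.rpow_nonneg (by linarith [hx.2, hs.2]) _
    rw [← e1, e2] at key
    calc (∫⁻ x in Ioo 0 s, g x) ^ 2 ≤ ((∫⁻ x in Ioo 0 s, A x * g x ^ 2) ^ (1 / (2 : ℝ)) *
          (∫⁻ x in Ioo 0 s, ENNReal.ofReal ((1 - x) ^ (-((r + 1) / 2))) ^ (2 : ℝ)) ^
            (1 / (2 : ℝ))) ^ 2 := by gcongr
      _ = (∫⁻ x in Ioo 0 s, A x * g x ^ 2) *
          ∫⁻ x in Ioo 0 s, ENNReal.ofReal ((1 - x) ^ (-((r + 1) / 2))) ^ (2 : ℝ) := by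
        rw [mul_pow, ← ENNReal.rpow_natCast, ← ENNReal.rpow_natCast, ← ENNReal.rpow_mul,
          ← ENNReal.rpow_mul]
        norm_num
      _ ≤ _ := by rw [mul_comm]; gcongr
  have h2 : ∀ s ∈ Ioo (0 : ℝ) 1, ENNReal.ofReal ((1 - s) ^ α) * (∫⁻ x in Ioo 0 s, g x) ^ 2 ≤
      ∫⁻ x in Ioo (0 : ℝ) 1, (Ioi x).indicator
        (fun s => ENNReal.ofReal (2 * (1 - s) ^ (r - 1))) s * (A x * g x ^ 2) := by
    intro s hs
    have hs1 : 0 < 1 - s := by linarith [hs.2]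
    calc _ ≤ ENNReal.ofReal ((1 - s) ^ α) * (ENNReal.ofReal (2 * (1 - s) ^ (-r)) *
          ∫⁻ x in Ioo 0 s, A x * g x ^ 2) := by gcongr; exact h1 s hs
      _ = ENNReal.ofReal (2 * (1 - s) ^ (r - 1)) * ∫⁻ x in Ioo 0 s, A x * g x ^ 2 := by
        rw [← mul_assoc, ← ENNReal.ofReal_mul (by positivity), ← Real.rpow_natCast,
          mul_left_comm, ← Real.rpow_add hs1]
        congr 4
        rw [hr]; ring
      _ = ∫⁻ x in Ioo 0 s, ENNReal.ofReal (2 * (1 - s) ^ (r - 1)) * (A x * g x ^ 2) := by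
        rw [lintegral_const_mul' _ _ ENNReal.ofReal_ne_top]
      _ = ∫⁻ x in Ioo 0 s, (Ioi x).indicator
        (fun s => ENNReal.ofReal (2 * (1 - s) ^ (r - 1))) s * (A x * g x ^ 2) := by
        refine setLIntegral_congr_fun measurableSet_Ioo fun x hx => ?_
        rw [indicator_of_mem (by exact hx.2)]
      _ ≤ _ := lintegral_mono_set (Ioo_subset_Ioo le_rfl hs.2.le)
  have h3 : ∀ x ∈ Ioo (0 : ℝ) 1, ∫⁻ s in Ioo (0 : ℝ) 1, (Ioi x).indicator
        (fun s => ENNReal.ofReal (2 * (1 - s) ^ (r - 1))) s ≤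
        ENNReal.ofReal (4 * (1 - x) ^ r) := by
    intro x hx
    rw [lintegral_indicator measurableSet_Ioi, Measure.restrict_restrict measurableSet_Ioi]
    have : Ioi x ∩ Ioo 0 1 = Ioo x 1 := by
      ext y; simp only [mem_inter_iff, mem_Ioi, mem_Ioo]
      exact ⟨fun h => ⟨h.1, h.2.2⟩, fun h => ⟨h.1, hx.1.trans h.1, h.2⟩⟩
    rw [this, lintegral_Ioo_of_hasDerivAt hx.2.le (F := fun x => -(2 / r) * (1 - x) ^ r)]
    · apply ENNReal.ofReal_le_ofReal
      have h3 : (0 : ℝ) ≤ (1 - x) ^ r := Real.rpow_nonneg (by linarith [hx.2]) _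
      have h4 : 2 / r ≤ 4 := by rw [← mul_one_div]; linarith
      rw [sub_self, Real.zero_rpow hr0.ne']
      nlinarith
    · intro y hy
      refine ContinuousAt.continuousWithinAt ?_
      refine continuousAt_const.mul ?_
      exact (continuousAt_const.sub continuousAt_id).rpow_const (Or.inr hr0.le)
    · intro y hy
      have := (hrp r y ⟨hx.1.trans hy.1, hy.2⟩).const_mul (-(2 / r))
      exact this.congr_deriv (by rw [neg_mul_neg, ← mul_assoc, div_mul_cancel₀ _ hr0.ne'])
    · intro y hy
      have := Real.rpow_nonneg (by linarith [hy.2] : 0 ≤ 1 - y) (r - 1)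
      positivity
  calc _ ≤ ∫⁻ s in Ioo (0 : ℝ) 1, ∫⁻ x in Ioo (0 : ℝ) 1, (Ioi x).indicator
        (fun s => ENNReal.ofReal (2 * (1 - s) ^ (r - 1))) s * (A x * g x ^ 2) :=
      setLIntegral_mono' measurableSet_Ioo h2
    _ = ∫⁻ x in Ioo (0 : ℝ) 1, ∫⁻ s in Ioo (0 : ℝ) 1, (Ioi x).indicator
        (fun s => ENNReal.ofReal (2 * (1 - s) ^ (r - 1))) s * (A x * g x ^ 2) := by
      apply lintegral_lintegral_swap
      have m1 : Measurable (Function.uncurry fun s x : ℝ => (Ioi x).indicator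
        (fun s => ENNReal.ofReal (2 * (1 - s) ^ (r - 1))) s) := by
        have : (Function.uncurry fun s x : ℝ => (Ioi x).indicator
          (fun s => ENNReal.ofReal (2 * (1 - s) ^ (r - 1))) s) =
          {p : ℝ × ℝ | p.2 < p.1}.indicator
            (fun p => ENNReal.ofReal (2 * (1 - p.1) ^ (r - 1))) := by
          ext p; simp [indicator, Function.uncurry]
        rw [this]
        exact (by fun_prop : Measurable _).indicator (measurableSet_lt measurable_snd measurable_fst)
      exact m1.aemeasurable.mul ((hAm.aemeasurable.mul (hg.pow_const 2)).comp_snd)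
    _ ≤ ∫⁻ x in Ioo (0 : ℝ) 1, 4 * (ENNReal.ofReal ((1 - x) ^ (α + 2)) * g x ^ 2) := by
      refine setLIntegral_mono' measurableSet_Ioo fun x hx => ?_
      have hx1 : 0 < 1 - x := by linarith [hx.2]
      rw [lintegral_mul_const _ (by
        exact (by fun_prop : Measurable _).indicator measurableSet_Ioi)]
      calc _ ≤ ENNReal.ofReal (4 * (1 - x) ^ r) * (A x * g x ^ 2) := by gcongr; exact h3 x hx
        _ = _ := by
          rw [← mul_assoc, ← mul_assoc, hA, ← ENNReal.ofReal_mul (by positivity), mul_assoc,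
            ← Real.rpow_add hx1, ENNReal.ofReal_mul (by norm_num), ← Real.rpow_natCast]
          congr 4
          · norm_num
          · rw [hr]; push_cast; ring
    _ = _ := by rw [lintegral_const_mul' _ _ (by norm_num)]

theorem measurePreserving_neg_arcMeas : MeasurePreserving (fun s : ℝ => -s) arcMeas arcMeas := by
  have h := (Measure.measurePreserving_neg (volume : Measure ℝ)).restrict_preimage
    (s := arcI) measurableSet_Ioo
  have e : Neg.neg ⁻¹' arcI = arcI := by
    ext x; simp only [mem_preimage, mem_Ioo]; constructor <;> intro h <;> constructor <;> linarith [h.1, h.2]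
  rw [e] at h
  exact h

theorem setLIntegral_Ioo_neg (F : ℝ → ENNReal) :
    ∫⁻ s in Ioo (-1 : ℝ) 0, F s = ∫⁻ s in Ioo (0 : ℝ) 1, F (-s) := by
  have h := (Measure.measurePreserving_neg (volume : Measure ℝ)).setLIntegral_comp_preimage_emb
    (MeasurableEquiv.neg ℝ).measurableEmbedding F (Ioo (-1) 0)
  rw [← h]
  congr 2
  ext x; simp

theorem lintegral_arcMeas (F : ℝ → ENNReal) :
    ∫⁻ s, F s ∂arcMeas = (∫⁻ s in Ioo (0 : ℝ) 1, F s) + ∫⁻ s in Ioo (0 : ℝ) 1, F (-s) := by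
  have e : arcI =ᵐ[volume] (Ioo (0 : ℝ) 1 ∪ Ioo (-1 : ℝ) 0 : Set ℝ) := by
    have h0 : ∀ᵐ x : ℝ, x ≠ 0 := by simp [ae_iff]
    filter_upwards [h0] with x hx
    apply propext
    change x ∈ arcI ↔ x ∈ (Ioo (0 : ℝ) 1 ∪ Ioo (-1 : ℝ) 0 : Set ℝ)
    simp only [mem_union, mem_Ioo]
    constructor
    · rintro ⟨h1, h2⟩
      rcases lt_or_gt_of_ne hx with h | h
      · exact Or.inr ⟨h1, h⟩
      · exact Or.inl ⟨h, h2⟩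
    · rintro (h | h) <;> constructor <;> linarith [h.1, h.2]
  rw [← setLIntegral_Ioo_neg, arcMeas, Measure.restrict_congr_set e,
    lintegral_union measurableSet_Ioo]
  rw [Set.disjoint_left]
  intro x h1 h2
  linarith [h1.1, h2.2]

theorem lintegral_weightMeas (j : ℕ) (F : ℝ → ENNReal) :
    ∫⁻ s, F s ∂weightMeas j = ∫⁻ s, ENNReal.ofReal ((1 - s ^ 2) ^ j) * F s ∂arcMeas := by
  rw [weightMeas, lintegral_withDensity_eq_lintegral_mul_non_measurable _ (by fun_prop)]
  · rfl
  · exact Eventually.of_forall fun _ => ENNReal.ofReal_lt_top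

theorem arcMeas_absolutelyContinuous_weightMeas (j : ℕ) : arcMeas ≪ weightMeas j := by
  apply withDensity_absolutelyContinuous' (by fun_prop)
  rw [ae_restrict_iff' measurableSet_Ioo]
  refine Eventually.of_forall fun s hs => ?_
  have : 0 < 1 - s ^ 2 := by nlinarith [hs.1, hs.2]
  simpa using pow_pos this j

theorem memLp_weightMeas_iff {E : Type*} [NormedAddCommGroup E] {j : ℕ} {f : ℝ → E} :
    MemLp f 2 (weightMeas j) ↔ AEStronglyMeasurable f arcMeas ∧
      ∫⁻ s, ENNReal.ofReal ((1 - s ^ 2) ^ j) * ‖f s‖ₑ ^ 2 ∂arcMeas < ⊤ := by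
  have key : eLpNorm f 2 (weightMeas j) < ⊤ ↔
      ∫⁻ s, ENNReal.ofReal ((1 - s ^ 2) ^ j) * ‖f s‖ₑ ^ 2 ∂arcMeas < ⊤ := by
    rw [eLpNorm_lt_top_iff_lintegral_rpow_enorm_lt_top (by norm_num) (by norm_num),
      lintegral_weightMeas]
    simp
  constructor
  · intro h
    exact ⟨h.1.mono_ac (arcMeas_absolutelyContinuous_weightMeas j), key.1 h.2⟩
  · rintro ⟨h1, h2⟩
    exact ⟨h1.mono_ac (withDensity_absolutelyContinuous _ _), key.2 h2⟩

theorem weightMeas_zero : weightMeas 0 = arcMeas := by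
  simp [weightMeas]

/-- On (0,1) the weights (1-s²)^k and (1-s)^k are comparable, so Hardy's inequality applies to the
primitive part of f; the constant part f(0) is harmless on a bounded interval. -/
theorem lintegral_weight_half_lt_top {E : Type*} [NormedAddCommGroup E] (α : ℕ) {f g : ℝ → E}
    (hg : AEStronglyMeasurable g (volume.restrict (Ioo 0 1)))
    (hfg : ∀ s ∈ Ioo (0 : ℝ) 1, ‖f s‖ₑ ≤ ‖f 0‖ₑ + ∫⁻ x in Ioo 0 s, ‖g x‖ₑ)
    (hfin : ∫⁻ s in Ioo (0 : ℝ) 1, ENNReal.ofReal ((1 - s ^ 2) ^ (α + 2)) * ‖g s‖ₑ ^ 2 < ⊤) :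
    ∫⁻ s in Ioo (0 : ℝ) 1, ENNReal.ofReal ((1 - s ^ 2) ^ α) * ‖f s‖ₑ ^ 2 < ⊤ := by
  have h1 : ∫⁻ s in Ioo (0 : ℝ) 1, ENNReal.ofReal ((1 - s ^ 2) ^ α) * ‖f s‖ₑ ^ 2 ≤
      ∫⁻ s in Ioo (0 : ℝ) 1, (2 ^ (α + 1) * ‖f 0‖ₑ ^ 2 +
        2 ^ (α + 1) * (ENNReal.ofReal ((1 - s) ^ α) * (∫⁻ x in Ioo 0 s, ‖g x‖ₑ) ^ 2)) := by
    refine setLIntegral_mono' measurableSet_Ioo fun s hs => ?_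
    have a1 : (1 - s ^ 2) ^ α ≤ 2 ^ α * (1 - s) ^ α := by
      rw [← mul_pow]; apply pow_le_pow_left₀ <;> nlinarith [hs.1, hs.2]
    have a2 : (1 - s) ^ α ≤ 1 := pow_le_one₀ (by linarith [hs.2]) (by linarith [hs.1])
    have a3 : ‖f s‖ₑ ^ 2 ≤ 2 * (‖f 0‖ₑ ^ 2 + (∫⁻ x in Ioo 0 s, ‖g x‖ₑ) ^ 2) := by
      refine (pow_le_pow_left₀ zero_le (hfg s hs) 2).trans ?_
      have := ENNReal.rpow_add_le_mul_rpow_add_rpow ‖f 0‖ₑ (∫⁻ x in Ioo 0 s, ‖g x‖ₑ)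
        (p := 2) (by norm_num)
      norm_num at this
      exact this
    calc _ ≤ ENNReal.ofReal (2 ^ α * (1 - s) ^ α) *
          (2 * (‖f 0‖ₑ ^ 2 + (∫⁻ x in Ioo 0 s, ‖g x‖ₑ) ^ 2)) := by gcongr
      _ = 2 ^ (α + 1) * (ENNReal.ofReal ((1 - s) ^ α) * ‖f 0‖ₑ ^ 2) +
        2 ^ (α + 1) * (ENNReal.ofReal ((1 - s) ^ α) * (∫⁻ x in Ioo 0 s, ‖g x‖ₑ) ^ 2) := by
        rw [ENNReal.ofReal_mul (by positivity), ENNReal.ofReal_pow (by norm_num)]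
        simp only [ENNReal.ofReal_ofNat]
        ring
      _ ≤ _ := by
        gcongr
        calc _ ≤ ENNReal.ofReal 1 * ‖f 0‖ₑ ^ 2 := by gcongr
          _ = _ := by simp
  refine h1.trans_lt ?_
  rw [lintegral_add_left (by fun_prop)]
  refine ENNReal.add_lt_top.2 ⟨by simp; finiteness, ?_⟩
  rw [lintegral_const_mul' _ _ (by finiteness)]
  refine ENNReal.mul_lt_top (by finiteness) ?_
  refine (lintegral_hardy α hg.enorm).trans_lt (ENNReal.mul_lt_top (by norm_num) ?_)
  refine lt_of_le_of_lt ?_ hfin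
  refine setLIntegral_mono' measurableSet_Ioo fun s hs => ?_
  gcongr
  · linarith [hs.2]
  · nlinarith [hs.1, hs.2]

/-- Each half of (-1,1) is handled separately, the left one by reflection, so that only one endpoint
is singular at a time. -/
theorem lintegral_weight_lt_top {E : Type*} [NormedAddCommGroup E] [NormedSpace ℝ E] (α : ℕ)
    {f g : ℝ → E} (hg : AEStronglyMeasurable g arcMeas)
    (hfg : ∀ s ∈ arcI, ∀ t ∈ arcI, ∫ x in s..t, g x = f t - f s)
    (hfin : ∫⁻ s, ENNReal.ofReal ((1 - s ^ 2) ^ (α + 2)) * ‖g s‖ₑ ^ 2 ∂arcMeas < ⊤) :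
    ∫⁻ s, ENNReal.ofReal ((1 - s ^ 2) ^ α) * ‖f s‖ₑ ^ 2 ∂arcMeas < ⊤ := by
  rw [lintegral_arcMeas] at hfin ⊢
  have hle : volume.restrict (Ioo (0 : ℝ) 1) ≤ arcMeas :=
    Measure.restrict_mono (Ioo_subset_Ioo (by norm_num) le_rfl) le_rfl
  have h0 : (0 : ℝ) ∈ arcI := by constructor <;> norm_num
  have step : ∀ s : ℝ, s ∈ Ioo (0 : ℝ) 1 → ∀ k : ℝ → E,
      ‖∫ x in (0 : ℝ)..s, k x‖ₑ ≤ ∫⁻ x in Ioo 0 s, ‖k x‖ₑ := by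
    intro s hs k
    rw [intervalIntegral.integral_of_le hs.1.le, integral_Ioc_eq_integral_Ioo]
    exact enorm_integral_le_lintegral_enorm _
  refine ENNReal.add_lt_top.2 ⟨?_, ?_⟩
  · refine lintegral_weight_half_lt_top α (hg.mono_measure hle) ?_ (ENNReal.add_lt_top.1 hfin).1
    intro s hs
    have h1 := hfg 0 h0 s ⟨by linarith [hs.1], hs.2⟩
    have h2 : f s = f 0 + ∫ x in (0 : ℝ)..s, g x := by rw [h1]; abel
    rw [h2]
    exact (enorm_add_le _ _).trans (by gcongr; exact step s hs g)
  · have e := lintegral_weight_half_lt_top α (f := fun s => f (-s)) (g := fun s => g (-s))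
      ((hg.comp_measurePreserving measurePreserving_neg_arcMeas).mono_measure hle) ?_ ?_
    · simpa using e
    · intro s hs
      have h1 := hfg 0 h0 (-s) ⟨by linarith [hs.2], by linarith [hs.1]⟩
      have h3 : ∫ x in (0 : ℝ)..s, g (-x) = - ∫ x in (0 : ℝ)..(-s), g x := by
        rw [intervalIntegral.integral_comp_neg, neg_zero, intervalIntegral.integral_symm]
      have h2 : f (-s) = f 0 + -∫ x in (0 : ℝ)..s, g (-x) := by rw [h3, h1]; abel
      simp only [neg_zero]
      rw [h2]
      refine (enorm_add_le _ _).trans ?_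
      rw [enorm_neg]
      gcongr
      exact step s hs _
    · simpa using (ENNReal.add_lt_top.1 hfin).2

theorem zero_mem_arcI : (0 : ℝ) ∈ arcI := by constructor <;> norm_num

theorem neg_mem_arcI {s : ℝ} (hs : s ∈ arcI) : -s ∈ arcI :=
  ⟨by linarith [hs.2], by linarith [hs.1]⟩

theorem arcI_mem_nhds {s : ℝ} (hs : s ∈ arcI) : arcI ∈ 𝓝 s := isOpen_Ioo.mem_nhds hs

theorem uIcc_subset_arcI {s t : ℝ} (hs : s ∈ arcI) (ht : t ∈ arcI) : uIcc s t ⊆ arcI :=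
  ordConnected_Ioo.uIcc_subset hs ht

/-! ### Classical regularity of weak derivatives -/

section Primitives

variable {E : Type*} [NormedAddCommGroup E] [NormedSpace ℝ E] {f g : ℝ → E}

theorem continuousOn_of_primitive
    (h : ∀ s ∈ arcI, ∀ t ∈ arcI, IntervalIntegrable g volume s t ∧ ∫ x in s..t, g x = f t - f s) :
    ContinuousOn f arcI := by
  intro s hs
  obtain ⟨a, ha, has⟩ := exists_between hs.1
  obtain ⟨b, hsb, hb⟩ := exists_between hs.2
  have haI : a ∈ arcI := ⟨ha, has.trans hs.2⟩
  have hbI : b ∈ arcI := ⟨hs.1.trans hsb, hb⟩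
  have hc := intervalIntegral.continuousOn_primitive_interval' (h a haI b hbI).1 (left_mem_uIcc)
  have hmem : uIcc a b ∈ 𝓝 s := by
    rw [uIcc_of_le (has.trans hsb).le]; exact Icc_mem_nhds has hsb
  have hc' : ContinuousAt (fun t => f a + ∫ x in a..t, g x) s :=
    continuousAt_const.add (hc.continuousAt hmem)
  refine (hc'.congr ?_).continuousWithinAt
  filter_upwards [hmem] with t ht
  rw [(h a haI t (uIcc_subset_arcI haI hbI ht)).2]; abel

theorem hasDerivAt_of_primitive [CompleteSpace E]
    (h : ∀ s ∈ arcI, ∀ t ∈ arcI, IntervalIntegrable g volume s t ∧ ∫ x in s..t, g x = f t - f s)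
    (hg : ContinuousOn g arcI) {s : ℝ} (hs : s ∈ arcI) : HasDerivAt f (g s) s := by
  have h1 := intervalIntegral.integral_hasDerivAt_right (h 0 zero_mem_arcI s hs).1
    (hg.stronglyMeasurableAtFilter isOpen_Ioo s hs) (hg.continuousAt (arcI_mem_nhds hs))
  have h2 := h1.const_add (f 0)
  refine h2.congr_of_eventuallyEq ?_
  filter_upwards [arcI_mem_nhds hs] with t ht
  rw [(h 0 zero_mem_arcI t ht).2]; abel

end Primitives

/-! ### Regularity and integrability of curves in 𝒦^m -/

section CurveSpace

variable {N : ℕ}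

theorem MemCurveSpace.mono {m k : ℕ} {η : ℝ → Amb N} (h : MemCurveSpace m η) (hk : k ≤ m) :
    MemCurveSpace k η := by
  obtain ⟨h0, D, h1, h2, h3⟩ := h
  exact ⟨h0, D, h1, fun j hj => h2 j (hj.trans_le hk), fun j hj => h3 j (hj.trans hk)⟩

/-- The weak derivatives of order below `m` of a curve in `𝒦^m` are its classical derivatives. -/
theorem MemCurveSpace.exists_derivs {m : ℕ} {η : ℝ → Amb N} (h : MemCurveSpace m η) :
    ∃ D : ℕ → ℝ → Amb N, (∀ s ∈ arcI, D 0 s = η s) ∧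
      (∀ k < m, ∀ s ∈ arcI, ∀ t ∈ arcI,
        IntervalIntegrable (D (k + 1)) volume s t ∧ ∫ x in s..t, D (k + 1) x = D k t - D k s) ∧
      (∀ j ≤ m, MemLp (D j) 2 (weightMeas j)) ∧
      (∀ k < m, ContinuousOn (D k) arcI) ∧
      (∀ k, k + 1 < m → ∀ s ∈ arcI, HasDerivAt (D k) (D (k + 1) s) s) ∧
      (∀ k < m, ∀ s ∈ arcI, deriv^[k] η s = D k s) := by
  obtain ⟨-, D, h1, h2, h3⟩ := h
  have hc : ∀ k < m, ContinuousOn (D k) arcI := fun k hk => continuousOn_of_primitive (h2 k hk)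
  have hd : ∀ k, k + 1 < m → ∀ s ∈ arcI, HasDerivAt (D k) (D (k + 1) s) s := fun k hk s hs =>
    hasDerivAt_of_primitive (h2 k (by omega)) (hc _ hk) hs
  refine ⟨D, h1, h2, h3, hc, hd, ?_⟩
  intro k
  induction k with
  | zero => intro _ s hs; exact (h1 s hs).symm
  | succ k ih =>
    intro hk s hs
    rw [Function.iterate_succ_apply']
    have : deriv^[k] η =ᶠ[𝓝 s] D k := by
      filter_upwards [arcI_mem_nhds hs] with t ht using ih (by omega) t ht
    rw [this.deriv_eq, (hd k hk s hs).deriv]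

theorem contDiffOn_of_derivs {m : ℕ} {D : ℕ → ℝ → Amb N}
    (hc : ∀ k < m, ContinuousOn (D k) arcI)
    (hd : ∀ k, k + 1 < m → ∀ s ∈ arcI, HasDerivAt (D k) (D (k + 1) s) s) (j : ℕ) :
    ∀ k, k + j < m → ContDiffOn ℝ j (D k) arcI := by
  induction j with
  | zero => intro k hk; simpa using hc k hk
  | succ j ih =>
    intro k hk
    push_cast
    rw [contDiffOn_succ_iff_deriv_of_isOpen isOpen_Ioo]
    refine ⟨fun s hs => (hd k (by omega) s hs).differentiableAt.differentiableWithinAt,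
      by simp, ?_⟩
    exact (ih (k + 1) (by omega)).congr fun s hs => (hd k (by omega) s hs).deriv

theorem MemCurveSpace.contDiffOn_deriv {m j : ℕ} {η : ℝ → Amb N} (h : MemCurveSpace m η)
    (hj : j + 2 ≤ m) : ContDiffOn ℝ j (deriv η) arcI := by
  obtain ⟨D, -, -, -, hc, hd, he⟩ := h.exists_derivs
  exact (contDiffOn_of_derivs hc hd j 1 (by omega)).congr fun s hs => he 1 (by omega) s hs

/-- Integrating once gains two powers of the weight, although the scale defining 𝒦^m drops only one
power per derivative. Iterated from the top order, this yields unweighted integrability of the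
derivatives up to half that order. -/
theorem memLp_weightMeas_of_primitive {α : ℕ} {f g : ℝ → Amb N}
    (h : ∀ s ∈ arcI, ∀ t ∈ arcI, IntervalIntegrable g volume s t ∧ ∫ x in s..t, g x = f t - f s)
    (hg : MemLp g 2 (weightMeas (α + 2))) : MemLp f 2 (weightMeas α) := by
  rw [memLp_weightMeas_iff] at hg ⊢
  exact ⟨(continuousOn_of_primitive h).aestronglyMeasurable measurableSet_Ioo,
    lintegral_weight_lt_top α hg.1 (fun s hs t ht => (h s hs t ht).2) hg.2⟩

theorem MemCurveSpace.memLp_deriv {m : ℕ} (hm : 2 ≤ m) {η : ℝ → Amb N} (h : MemCurveSpace m η) :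
    MemLp (deriv η) 2 arcMeas := by
  obtain ⟨D, -, h2, h3, -, -, he⟩ := (h.mono hm).exists_derivs
  have : MemLp (D 1) 2 (weightMeas 0) :=
    memLp_weightMeas_of_primitive (h2 1 (by norm_num)) (h3 2 le_rfl)
  rw [weightMeas_zero] at this
  refine (memLp_congr_ae ?_).1 this
  exact (ae_restrict_iff' measurableSet_Ioo).2
    (Eventually.of_forall fun s hs => (he 1 (by norm_num) s hs).symm)

theorem MemCurveSpace.memLp {m : ℕ} {η : ℝ → Amb N} (h : MemCurveSpace m η) :
    MemLp η 2 arcMeas := by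
  obtain ⟨-, D, h1, -, h3⟩ := h
  have := h3 0 (Nat.zero_le _)
  rw [weightMeas_zero] at this
  exact (memLp_congr_ae ((ae_restrict_iff' measurableSet_Ioo).2
    (Eventually.of_forall fun s hs => h1 s hs))).1 this

theorem MemCurveSpace.contDiffOn {m j : ℕ} {η : ℝ → Amb N} (h : MemCurveSpace m η)
    (hj : j + 1 ≤ m) : ContDiffOn ℝ j η arcI := by
  obtain ⟨D, h1, -, -, hc, hd, -⟩ := h.exists_derivs
  exact (contDiffOn_of_derivs hc hd j 0 (by omega)).congr fun s hs => (h1 s hs).symm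

/-- Integrability of the second and third derivatives of a curve in `𝒦^4`. -/
theorem MemCurveSpace.memLp_deriv_deriv {m : ℕ} (hm : 4 ≤ m) {η : ℝ → Amb N}
    (h : MemCurveSpace m η) :
    MemLp (deriv (deriv η)) 2 arcMeas ∧ MemLp (deriv (deriv (deriv η))) 2 (weightMeas 2) := by
  obtain ⟨D, -, h2, h3, -, -, he⟩ := (h.mono hm).exists_derivs
  have k3 : MemLp (D 3) 2 (weightMeas 2) :=
    memLp_weightMeas_of_primitive (h2 3 (by norm_num)) (h3 4 le_rfl)
  have k2 : MemLp (D 2) 2 (weightMeas 0) :=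
    memLp_weightMeas_of_primitive (h2 2 (by norm_num)) k3
  rw [weightMeas_zero] at k2
  refine ⟨(memLp_congr_ae ?_).1 k2, (memLp_congr_ae ?_).1 k3⟩
  · exact (ae_restrict_iff' measurableSet_Ioo).2
      (Eventually.of_forall fun s hs => (he 2 (by norm_num) s hs).symm)
  · exact (withDensity_absolutelyContinuous arcMeas _).ae_le ((ae_restrict_iff' measurableSet_Ioo).2
      (Eventually.of_forall fun s hs => (he 3 (by norm_num) s hs).symm))

end CurveSpace

/-! ### Odd C¹ curves with integrable derivative, and their L² classes -/

section OddArc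

variable {N : ℕ}

theorem forall_ae_arcMeas {p : ℝ → Prop} (h : ∀ s ∈ arcI, p s) : ∀ᵐ s ∂arcMeas, p s :=
  (ae_restrict_iff' measurableSet_Ioo).2 (Eventually.of_forall h)

/-- Odd curves of class `C¹` on `(-1,1)` with integrable derivative. -/
structure IsOddArc (g : ℝ → Amb N) : Prop where
  odd : ∀ s ∈ arcI, g (-s) = -g s
  contDiffOn : ContDiffOn ℝ 1 g arcI
  integrable : Integrable (deriv g) arcMeas

theorem MemCurveSpace.isOddArc {m : ℕ} (hm : 2 ≤ m) {v : ℝ → Amb N} (h : MemCurveSpace m v) :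
    IsOddArc v :=
  ⟨h.1, h.contDiffOn (j := 1) (by omega), (h.memLp_deriv hm).integrable (by norm_num)⟩

namespace IsOddArc

variable {g : ℝ → Amb N} (h : IsOddArc g)
include h

theorem hasDerivAt {s : ℝ} (hs : s ∈ arcI) : HasDerivAt g (deriv g s) s :=
  ((h.contDiffOn.contDiffAt (arcI_mem_nhds hs)).differentiableAt (by norm_num)).hasDerivAt

theorem continuousOn_deriv : ContinuousOn (deriv g) arcI :=
  h.contDiffOn.continuousOn_deriv_of_isOpen isOpen_Ioo le_rfl

theorem map_zero : g 0 = 0 := by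
  have := h.odd 0 zero_mem_arcI
  simpa [eq_neg_iff_add_eq_zero, ← two_smul ℝ] using this

theorem deriv_neg {s : ℝ} (hs : s ∈ arcI) : deriv g (-s) = deriv g s := by
  have h1 : (fun t => g (-t)) =ᶠ[𝓝 s] fun t => -g t := by
    filter_upwards [arcI_mem_nhds hs] with t ht using h.odd t ht
  have h2 := h1.deriv_eq
  rw [deriv_comp_neg, deriv.fun_neg] at h2
  exact neg_injective h2

theorem eq_integral {s : ℝ} (hs : s ∈ arcI) : g s = ∫ x in (0 : ℝ)..s, deriv g x := by
  rw [intervalIntegral.integral_eq_sub_of_hasDerivAt (f := g), h.map_zero, sub_zero]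
  · intro x hx; exact h.hasDerivAt (uIcc_subset_arcI zero_mem_arcI hs hx)
  · exact (h.continuousOn_deriv.mono (uIcc_subset_arcI zero_mem_arcI hs)).intervalIntegrable

/-- Oddness forces g(0) = 0, so the L¹ norm of the derivative controls the supremum without any
additive constant. -/
theorem norm_le {s : ℝ} (hs : s ∈ arcI) : ‖g s‖ ≤ ∫ x, ‖deriv g x‖ ∂arcMeas := by
  rw [h.eq_integral hs]
  refine intervalIntegral.norm_integral_le_integral_norm_uIoc.trans ?_
  refine setIntegral_mono_set h.integrable.norm (Eventually.of_forall fun _ => norm_nonneg _) ?_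
  exact (uIoc_subset_uIcc.trans (uIcc_subset_arcI zero_mem_arcI hs)).eventuallyLE

theorem memLp : MemLp g 2 arcMeas :=
  MemLp.of_bound (h.contDiffOn.continuousOn.aestronglyMeasurable measurableSet_Ioo) _
    (forall_ae_arcMeas fun _ hs => h.norm_le hs)

end IsOddArc

theorem IsOddArc.add {f g : ℝ → Amb N} (hf : IsOddArc f) (hg : IsOddArc g) :
    IsOddArc (fun s => f s + g s) := by
  refine ⟨fun s hs => by rw [hf.odd s hs, hg.odd s hs]; abel, hf.contDiffOn.add hg.contDiffOn, ?_⟩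
  refine (hf.integrable.add hg.integrable).congr (forall_ae_arcMeas fun s hs => ?_)
  exact ((hf.hasDerivAt hs).add (hg.hasDerivAt hs)).deriv.symm

theorem IsOddArc.const_smul {f : ℝ → Amb N} (hf : IsOddArc f) (c : ℝ) :
    IsOddArc (fun s => c • f s) := by
  refine ⟨fun s hs => by rw [hf.odd s hs]; simp, hf.contDiffOn.const_smul c, ?_⟩
  refine (hf.integrable.smul c).congr (forall_ae_arcMeas fun s hs => ?_)
  exact ((hf.hasDerivAt hs).const_smul c).deriv.symm

theorem toL2_eq {f : ℝ → Amb N} (hf : MemLp f 2 arcMeas) : toL2 f = hf.toLp f := dif_pos hf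

theorem coeFn_toL2 {f : ℝ → Amb N} (hf : MemLp f 2 arcMeas) : toL2 f =ᵐ[arcMeas] f := by
  rw [toL2_eq hf]; exact hf.coeFn_toLp

theorem toL2_congr {f g : ℝ → Amb N} (hf : MemLp f 2 arcMeas) (h : f =ᵐ[arcMeas] g) :
    toL2 f = toL2 g := by
  have hg := (memLp_congr_ae h).1 hf
  rw [toL2_eq hf, toL2_eq hg]; exact (MemLp.toLp_eq_toLp_iff hf hg).2 h

theorem toL2_add {f g : ℝ → Amb N} (hf : MemLp f 2 arcMeas) (hg : MemLp g 2 arcMeas) :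
    toL2 (fun s => f s + g s) = toL2 f + toL2 g := by
  rw [toL2_eq hf, toL2_eq hg, ← MemLp.toLp_add]; exact toL2_eq (hf.add hg)

theorem toL2_sub {f g : ℝ → Amb N} (hf : MemLp f 2 arcMeas) (hg : MemLp g 2 arcMeas) :
    toL2 (fun s => f s - g s) = toL2 f - toL2 g := by
  rw [toL2_eq hf, toL2_eq hg, ← MemLp.toLp_sub]; exact toL2_eq (hf.sub hg)

theorem toL2_const_smul {f : ℝ → Amb N} (hf : MemLp f 2 arcMeas) (c : ℝ) :
    toL2 (fun s => c • f s) = c • toL2 f := by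
  rw [toL2_eq hf, ← MemLp.toLp_const_smul]; exact toL2_eq (hf.const_smul c)

theorem inner_toL2 {f : ℝ → Amb N} (hf : MemLp f 2 arcMeas) (h : ArcL2 N) :
    inner ℝ (toL2 f) h = ∫ s, inner ℝ (f s) (h s) ∂arcMeas := by
  rw [L2.inner_def]
  refine integral_congr_ae ?_
  filter_upwards [coeFn_toL2 hf] with s hs
  rw [hs]

theorem inner_toL2_toL2 {f g : ℝ → Amb N} (hf : MemLp f 2 arcMeas) (hg : MemLp g 2 arcMeas) :
    inner ℝ (toL2 f) (toL2 g) = ∫ s, inner ℝ (f s) (g s) ∂arcMeas := by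
  rw [inner_toL2 hf]
  refine integral_congr_ae ?_
  filter_upwards [coeFn_toL2 hg] with s hs
  rw [hs]

theorem norm_toL2_sq {f : ℝ → Amb N} (hf : MemLp f 2 arcMeas) :
    ‖toL2 f‖ ^ 2 = ∫ s, ‖f s‖ ^ 2 ∂arcMeas := by
  rw [← real_inner_self_eq_norm_sq, inner_toL2_toL2 hf hf]
  simp

theorem volume_arcMeas_univ : arcMeas.real univ = 2 := by
  simp [Measure.real]; norm_num

theorem norm_toL2_le_of_bound {f : ℝ → Amb N} (hf : MemLp f 2 arcMeas) {C : ℝ} (hC : 0 ≤ C)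
    (h : ∀ s ∈ arcI, ‖f s‖ ≤ C) : ‖toL2 f‖ ≤ 2 * C := by
  have : ‖toL2 f‖ ^ 2 ≤ (2 * C) ^ 2 := by
    rw [norm_toL2_sq hf]
    calc ∫ s, ‖f s‖ ^ 2 ∂arcMeas ≤ ∫ s, C ^ 2 ∂arcMeas := by
          refine integral_mono_ae ?_ (integrable_const _) (forall_ae_arcMeas fun s hs => ?_)
          · exact hf.integrable_norm_pow (by norm_num)
          · exact pow_le_pow_left₀ (norm_nonneg _) (h s hs) 2
      _ = 2 * C ^ 2 := by rw [integral_const, volume_arcMeas_univ, smul_eq_mul]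
      _ ≤ _ := by nlinarith [sq_nonneg C]
  exact (pow_le_pow_iff_left₀ (norm_nonneg _) (by positivity) (by norm_num)).1 this

theorem IsOddArc.norm_toL2_le {g : ℝ → Amb N} (h : IsOddArc g) :
    ‖toL2 g‖ ≤ 2 * ∫ x, ‖deriv g x‖ ∂arcMeas :=
  norm_toL2_le_of_bound h.memLp (integral_nonneg fun _ => norm_nonneg _) fun _ hs => h.norm_le hs

theorem integral_norm_mul_norm_le {f g : ℝ → Amb N} (hf : MemLp f 2 arcMeas)
    (hg : MemLp g 2 arcMeas) : ∫ s, ‖f s‖ * ‖g s‖ ∂arcMeas ≤ ‖toL2 f‖ * ‖toL2 g‖ := by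
  have hfn : ∀ {k : ℝ → Amb N}, MemLp k 2 arcMeas →
      (∫ s, ‖k s‖ ^ (2 : ℝ) ∂arcMeas) ^ (1 / (2 : ℝ)) = ‖toL2 k‖ := by
    intro k hk
    simp only [Real.rpow_two]
    rw [← norm_toL2_sq hk, ← Real.sqrt_eq_rpow, Real.sqrt_sq (norm_nonneg _)]
  have := integral_mul_norm_le_Lp_mul_Lq (μ := arcMeas) Real.HolderConjugate.two_two
    (f := f) (g := g) (by simpa using hf) (by simpa using hg)
  rwa [hfn hf, hfn hg] at this

theorem integral_norm_le {f : ℝ → Amb N} (hf : MemLp f 2 arcMeas) :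
    ∫ s, ‖f s‖ ∂arcMeas ≤ 2 * ‖toL2 f‖ := by
  have hi : Integrable f arcMeas := hf.integrable (by norm_num)
  have h2 := hf.integrable_norm_pow (by norm_num : (2 : ℕ) ≠ 0)
  set A := ∫ s, ‖f s‖ ∂arcMeas with hA
  have hA0 : 0 ≤ A := integral_nonneg fun _ => norm_nonneg _
  have h3 : 0 ≤ ∫ s, (‖f s‖ - A / 2) ^ 2 ∂arcMeas := integral_nonneg fun _ => sq_nonneg _
  have h4 : ∫ s, (‖f s‖ - A / 2) ^ 2 ∂arcMeas = ‖toL2 f‖ ^ 2 - A * A + 2 * (A / 2) ^ 2 := by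
    have e : ∀ s, (‖f s‖ - A / 2) ^ 2 = ‖f s‖ ^ 2 - A * ‖f s‖ + (A / 2) ^ 2 := fun s => by ring
    simp only [e]
    rw [integral_add (f := fun s => ‖f s‖ ^ 2 - A * ‖f s‖) (h2.sub (hi.norm.const_mul A))
          (integrable_const _),
      integral_sub h2 (hi.norm.const_mul A), integral_const_mul, integral_const,
      volume_arcMeas_univ, norm_toL2_sq hf, smul_eq_mul]
  nlinarith [norm_nonneg (toL2 f)]

end OddArc

/-! ### Even compactly supported fields and their primitives -/

section BumpFields

variable {N : ℕ}

/-- Even fields of class `C^m` whose support is a compact subset of `(-1,1)`. -/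
structure IsBumpField (m : ℕ∞) (p : ℝ → Amb N) : Prop where
  contDiff : ContDiff ℝ m p
  hasCompactSupport : HasCompactSupport p
  tsupport_subset : tsupport p ⊆ arcI
  even : ∀ s, p (-s) = p s

theorem IsBumpField.of_le {m k : ℕ∞} {p : ℝ → Amb N} (h : IsBumpField m p) (hk : k ≤ m) :
    IsBumpField k p :=
  ⟨h.contDiff.of_le (by exact_mod_cast hk), h.2, h.3, h.4⟩

theorem IsBumpField.eq_zero {m : ℕ∞} {p : ℝ → Amb N} (h : IsBumpField m p) {s : ℝ}
    (hs : s ∉ arcI) : p s = 0 :=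
  image_eq_zero_of_notMem_tsupport fun h' => hs (h.tsupport_subset h')

theorem IsBumpField.exists_bound {m : ℕ∞} {p : ℝ → Amb N} (h : IsBumpField m p) :
    ∃ C, 0 ≤ C ∧ ∀ s, ‖p s‖ ≤ C := by
  obtain ⟨C, hC⟩ := h.hasCompactSupport.exists_bound_of_continuous h.contDiff.continuous
  exact ⟨C, (norm_nonneg _).trans (hC 0), hC⟩

/-- The field r is known to be smooth only inside (-1,1), but it vanishes wherever p does. Its
support therefore stays in that of p, and extension by zero is smooth on the line. This serves for
pointwise constructions from p and γ', such as projection and stereographic lifting. -/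
theorem IsBumpField.of_contDiffOn {m : ℕ∞} {p r : ℝ → Amb N} (hp : IsBumpField m p)
    (hr : ContDiffOn ℝ m r arcI) (h0 : ∀ s, p s = 0 → r s = 0)
    (he : ∀ s ∈ arcI, r (-s) = r s) : IsBumpField m r := by
  have hsub : tsupport r ⊆ tsupport p :=
    closure_mono fun s hs hps => hs (h0 s hps)
  refine ⟨?_, hp.2.mono' fun s hs => hsub (subset_tsupport _ hs), hsub.trans hp.3, fun s => ?_⟩
  · rw [contDiff_iff_contDiffAt]
    intro s
    by_cases hs : s ∈ arcI
    · exact hr.contDiffAt (arcI_mem_nhds hs)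
    · have : s ∉ tsupport r := fun h => hs (hp.3 (hsub h))
      rw [notMem_tsupport_iff_eventuallyEq] at this
      exact contDiffAt_const.congr_of_eventuallyEq this
  · by_cases hs : s ∈ arcI
    · exact he s hs
    · have hs' : -s ∉ arcI := fun h => hs (by simpa using neg_mem_arcI h)
      rw [h0 _ (hp.eq_zero hs), h0 _ (hp.eq_zero hs')]

theorem IsBumpField.memLp {m : ℕ∞} {p : ℝ → Amb N} (h : IsBumpField m p) :
    MemLp p 2 arcMeas := by
  obtain ⟨C, -, hC⟩ := h.exists_bound
  exact MemLp.of_bound h.contDiff.continuous.aestronglyMeasurable C (Eventually.of_forall hC)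

/-- The primitive of `p` that vanishes at `0`. -/
noncomputable def primCurve (p : ℝ → Amb N) (s : ℝ) : Amb N := ∫ x in (0 : ℝ)..s, p x

theorem hasDerivAt_primCurve {p : ℝ → Amb N} (hp : Continuous p) (s : ℝ) :
    HasDerivAt (primCurve p) (p s) s :=
  intervalIntegral.integral_hasDerivAt_right (hp.intervalIntegrable _ _)
    (hp.stronglyMeasurableAtFilter _ _) hp.continuousAt

theorem deriv_primCurve {p : ℝ → Amb N} (hp : Continuous p) : deriv (primCurve p) = p :=
  funext fun s => (hasDerivAt_primCurve hp s).deriv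

theorem primCurve_neg {p : ℝ → Amb N} (hp : ∀ s, p (-s) = p s) (s : ℝ) :
    primCurve p (-s) = -primCurve p s := by
  have h := intervalIntegral.integral_comp_neg (a := 0) (b := s) p
  simp only [hp, neg_zero] at h
  rw [primCurve, primCurve, h, intervalIntegral.integral_symm]

theorem memLp_weightMeas_of_continuous {f : ℝ → Amb N} (hf : Continuous f) (j : ℕ) :
    MemLp f 2 (weightMeas j) := by
  obtain ⟨C, hC⟩ := isCompact_Icc.exists_bound_of_continuousOn
    (s := Icc (-1 : ℝ) 1) hf.continuousOn
  have h : MemLp f 2 arcMeas := MemLp.of_bound hf.aestronglyMeasurable C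
    (forall_ae_arcMeas fun s hs => hC s ⟨hs.1.le, hs.2.le⟩)
  refine h.mono_measure ?_
  refine Measure.le_iff.2 fun s hs => ?_
  rw [weightMeas, withDensity_apply _ hs]
  calc _ ≤ ∫⁻ _ in s, 1 ∂arcMeas := by
        refine lintegral_mono_ae (ae_restrict_of_ae (forall_ae_arcMeas fun s hs => ?_))
        rw [← ENNReal.ofReal_one]
        apply ENNReal.ofReal_le_ofReal
        exact pow_le_one₀ (by nlinarith [hs.1, hs.2]) (by nlinarith [sq_nonneg s])
    _ = _ := by simp

theorem IsBumpField.memCurveSpace {m k : ℕ} {p : ℝ → Amb N} (h : IsBumpField m p)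
    (hk : k ≤ m + 1) : MemCurveSpace k (primCurve p) := by
  have hc : ∀ j ≤ m, Continuous (iteratedDeriv j p) := fun j hj =>
    h.contDiff.continuous_iteratedDeriv j (by exact_mod_cast hj)
  set D : ℕ → ℝ → Amb N := fun j => Nat.casesOn j (primCurve p) fun i => iteratedDeriv i p with hD
  have hd : ∀ j ≤ m, ∀ s, HasDerivAt (D j) (D (j + 1) s) s := by
    intro j hj s
    cases j with
    | zero => simpa [hD] using hasDerivAt_primCurve h.contDiff.continuous s
    | succ i =>
      simp only [hD]
      rw [iteratedDeriv_succ]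
      refine DifferentiableAt.hasDerivAt ?_
      exact (h.contDiff.differentiable_iteratedDeriv i (by exact_mod_cast hj)) s
  have hcD : ∀ j ≤ m + 1, Continuous (D j) := by
    intro j hj
    cases j with
    | zero => exact continuous_iff_continuousAt.2 fun s => (hd 0 (by omega) s).continuousAt
    | succ i => exact hc i (by omega)
  refine ⟨fun s _ => primCurve_neg h.even s, D, fun s _ => rfl, fun j hj s _ t _ => ?_,
    fun j hj => memLp_weightMeas_of_continuous (hcD j (by omega)) j⟩
  have hi := (hcD (j + 1) (by omega)).intervalIntegrable (μ := volume) s t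
  exact ⟨hi, intervalIntegral.integral_eq_sub_of_hasDerivAt (fun x _ => hd j (by omega) x) hi⟩

theorem MemCurveSpace.add {m : ℕ} {f g : ℝ → Amb N} (hf : MemCurveSpace m f)
    (hg : MemCurveSpace m g) : MemCurveSpace m (fun s => f s + g s) := by
  obtain ⟨f0, D, f1, f2, f3⟩ := hf
  obtain ⟨g0, D', g1, g2, g3⟩ := hg
  refine ⟨fun s hs => by simp only [f0 s hs, g0 s hs]; abel, fun k s => D k s + D' k s,
    fun s hs => by simp only [f1 s hs, g1 s hs], fun k hk s hs t ht => ?_, fun j hj => (f3 j hj).add (g3 j hj)⟩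
  have a := f2 k hk s hs t ht
  have b := g2 k hk s hs t ht
  refine ⟨a.1.add b.1, ?_⟩
  rw [intervalIntegral.integral_add a.1 b.1, a.2, b.2]; module

/-- The component of the field `p` orthogonal to a field `ν` of unit vectors. -/
noncomputable def orthField (ν p : ℝ → Amb N) (s : ℝ) : Amb N := p s - (inner ℝ (p s) (ν s) : ℝ) • ν s

theorem inner_orthField {ν p : ℝ → Amb N} {s : ℝ} (hν : ‖ν s‖ = 1) :
    inner ℝ (orthField ν p s) (ν s) = 0 := by
  rw [orthField, inner_sub_left, real_inner_smul_left, real_inner_self_eq_norm_sq, hν]; ring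

theorem norm_orthField_le {ν p : ℝ → Amb N} {s : ℝ} (hν : ‖ν s‖ = 1) :
    ‖orthField ν p s‖ ≤ ‖p s‖ := by
  have h : ‖orthField ν p s‖ ^ 2 ≤ ‖p s‖ ^ 2 := by
    rw [orthField, norm_sub_sq_real, norm_smul, hν, real_inner_smul_right]
    simp only [Real.norm_eq_abs, mul_one, sq_abs]
    nlinarith [sq_nonneg (inner ℝ (p s) (ν s) : ℝ)]
  exact (pow_le_pow_iff_left₀ (norm_nonneg _) (norm_nonneg _) (by norm_num)).1 h

theorem IsBumpField.orthField {m : ℕ∞} {ν p : ℝ → Amb N} (hp : IsBumpField m p)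
    (hν : ContDiffOn ℝ m ν arcI) (hν' : ∀ s ∈ arcI, ν (-s) = ν s) :
    IsBumpField m (orthField ν p) := by
  refine hp.of_contDiffOn ?_ (fun s hs => by simp [_root_.orthField, hs])
    (fun s hs => by simp [_root_.orthField, hp.even, hν' s hs])
  exact hp.contDiff.contDiffOn.sub ((hp.contDiff.contDiffOn.inner ℝ hν).smul hν)

/-- Primitives of fields orthogonal to `η'` are tangent vectors at `η`. -/
theorem IsBumpField.memTangent {m : ℕ} {η p : ℝ → Amb N} (hp : IsBumpField m p)
    (hη : ContDiffOn ℝ m (deriv η) arcI) (he : ∀ s ∈ arcI, deriv η (-s) = deriv η s)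
    (h1 : ∀ s ∈ arcI, ‖deriv η s‖ = 1) :
    MemTangent m η (primCurve (_root_.orthField (deriv η) p)) := by
  have hb := hp.orthField (m := m) (by exact_mod_cast hη) he
  refine ⟨hb.memCurveSpace (by omega), fun s hs => ?_⟩
  rw [deriv_primCurve hb.contDiff.continuous, inner_orthField (h1 s hs)]

theorem IsBumpField.isOddArc {m : ℕ} {p : ℝ → Amb N} (hp : IsBumpField m p) (hm : 1 ≤ m) :
    IsOddArc (primCurve p) :=
  (hp.memCurveSpace (k := 2) (by omega)).isOddArc le_rfl

end BumpFields

/-! ### Density of smooth compactly supported fields in L² -/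

section Density

variable {N : ℕ}

theorem ae_eq_zero_of_forall_test {h : ℝ → Amb N} (hi : LocallyIntegrableOn h arcI)
    (H : ∀ φ : ℝ → ℝ, ContDiff ℝ ∞ φ → HasCompactSupport φ → tsupport φ ⊆ arcI →
      ∫ s, φ s • h s ∂arcMeas = 0) : h =ᵐ[arcMeas] 0 := by
  have := isOpen_Ioo.ae_eq_zero_of_integral_contDiff_smul_eq_zero hi fun φ h1 h2 h3 => ?_
  · exact (ae_restrict_iff' measurableSet_Ioo).2 this
  · rw [← H φ h1 h2 h3, setIntegral_eq_integral_of_forall_compl_eq_zero]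
    intro s hs
    rw [image_eq_zero_of_notMem_tsupport fun h' => hs (h3 h'), zero_smul]

/-- Smooth compactly supported fields are dense in `L²`. -/
theorem exists_contDiff_norm_toL2_sub_le {f : ℝ → Amb N} (hf : MemLp f 2 arcMeas) {ε : ℝ}
    (hε : 0 < ε) : ∃ p : ℝ → Amb N, ContDiff ℝ ∞ p ∧ HasCompactSupport p ∧ tsupport p ⊆ arcI ∧
      MemLp p 2 arcMeas ∧ ‖toL2 (fun s => p s - f s)‖ < ε := by
  let T : Set (ℝ → Amb N) := {p | ContDiff ℝ ∞ p ∧ HasCompactSupport p ∧ tsupport p ⊆ arcI}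
  have hT : ∀ p ∈ T, MemLp p 2 arcMeas := fun p hp =>
    (hp.1.continuous.memLp_of_hasCompactSupport hp.2.1).restrict _
  let S : Submodule ℝ (ArcL2 N) :=
    { carrier := {k | ∃ p ∈ T, k = toL2 p}
      zero_mem' := ⟨fun _ => 0, ⟨contDiff_const, HasCompactSupport.zero, by
          have : tsupport (fun _ : ℝ => (0 : Amb N)) = ∅ := by simp
          simp [this]⟩, by
          rw [toL2_eq MemLp.zero']; exact (MemLp.toLp_zero _).symm⟩
      add_mem' := by
        rintro _ _ ⟨p, hp, rfl⟩ ⟨p', hp', rfl⟩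
        refine ⟨fun s => p s + p' s, ⟨hp.1.add hp'.1, hp.2.1.add hp'.2.1, ?_⟩,
          (toL2_add (hT p hp) (hT p' hp')).symm⟩
        exact (tsupport_add p p').trans (union_subset hp.2.2 hp'.2.2)
      smul_mem' := by
        rintro c _ ⟨p, hp, rfl⟩
        refine ⟨fun s => c • p s, ⟨hp.1.const_smul c, hp.2.1.smul_left (f := fun _ => c), ?_⟩,
          (toL2_const_smul (hT p hp) c).symm⟩
        exact (tsupport_smul_subset_right (fun _ => c) p).trans hp.2.2 }
  have hS : S.topologicalClosure = ⊤ := by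
    rw [Submodule.topologicalClosure_eq_top_iff, Submodule.eq_bot_iff]
    intro h hh
    have hi : Integrable h arcMeas := (Lp.memLp h).integrable (by norm_num)
    have : h =ᵐ[arcMeas] 0 := by
      refine ae_eq_zero_of_forall_test (IntegrableOn.locallyIntegrableOn hi) fun φ h1 h2 h3 => ?_
      have hφ : Integrable (fun s => φ s • (h : ℝ → Amb N) s) arcMeas := by
        obtain ⟨C, hC⟩ := h2.exists_bound_of_continuous h1.continuous
        exact hi.bdd_smul C h1.continuous.aestronglyMeasurable (Eventually.of_forall hC)
      refine ext_inner_left ℝ fun e => ?_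
      rw [inner_zero_right, ← integral_inner hφ]
      have hmem : (fun s => φ s • e) ∈ T :=
        ⟨h1.smul contDiff_const, h2.smul_right, (tsupport_smul_subset_left φ _).trans h3⟩
      have := (Submodule.mem_orthogonal S h).1 hh _ ⟨_, hmem, rfl⟩
      rw [inner_toL2 (hT _ hmem)] at this
      rw [← this]
      refine integral_congr_ae (Eventually.of_forall fun s => ?_)
      simp only [real_inner_smul_left, real_inner_smul_right]
    exact Lp.ext (this.trans (Lp.coeFn_zero _ _ _).symm)
  have hmem : toL2 f ∈ closure (S : Set (ArcL2 N)) := by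
    rw [← Submodule.topologicalClosure_coe, hS]; trivial
  obtain ⟨_, ⟨p, hp, rfl⟩, hd⟩ := Metric.mem_closure_iff.1 hmem ε hε
  refine ⟨p, hp.1, hp.2.1, hp.2.2, hT p hp, ?_⟩
  rw [toL2_sub (hT p hp) hf, ← dist_eq_norm, dist_comm]; exact hd

theorem norm_toL2_comp_neg {f : ℝ → Amb N} (hf : MemLp f 2 arcMeas) :
    MemLp (fun s => f (-s)) 2 arcMeas ∧ ‖toL2 (fun s => f (-s))‖ = ‖toL2 f‖ := by
  have hf' : MemLp (fun s => f (-s)) 2 arcMeas :=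
    hf.comp_measurePreserving measurePreserving_neg_arcMeas
  refine ⟨hf', ?_⟩
  rw [toL2_eq hf', toL2_eq hf, Lp.norm_toLp, Lp.norm_toLp]
  congr 1
  exact eLpNorm_comp_measurePreserving hf.1 measurePreserving_neg_arcMeas

theorem exists_isBumpField_norm_toL2_sub_le {f : ℝ → Amb N} (hf : MemLp f 2 arcMeas)
    (he : ∀ s ∈ arcI, f (-s) = f s) {ε : ℝ} (hε : 0 < ε) :
    ∃ p : ℝ → Amb N, IsBumpField ⊤ p ∧ ‖toL2 (fun s => p s - f s)‖ < ε := by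
  obtain ⟨p, h1, h2, h3, h4, h5⟩ := exists_contDiff_norm_toL2_sub_le hf hε
  have h2' : HasCompactSupport fun s => p (-s) := h2.comp_homeomorph (Homeomorph.neg ℝ)
  have h3' : tsupport (fun s => p (-s)) ⊆ arcI := by
    intro s hs
    have := h3 (tsupport_comp_subset_preimage p continuous_neg hs)
    simpa using neg_mem_arcI this
  -- Averaging with the reflection makes the approximant even, and costs nothing in the L² distance
  -- because f is even.
  refine ⟨fun s => (1 / 2 : ℝ) • (p s + p (-s)), ⟨?_, ?_, ?_, ?_⟩, ?_⟩
  · exact (h1.add (h1.comp contDiff_neg)).const_smul (1 / 2 : ℝ)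
  · exact (h2.add h2').smul_left (f := fun _ => (1 / 2 : ℝ))
  · refine (tsupport_smul_subset_right (fun _ => (1 / 2 : ℝ)) _).trans ?_
    exact (tsupport_add p (fun s => p (-s))).trans (union_subset h3 h3')
  · intro s; simp [add_comm]
  · have hk := h4.sub hf
    have hn := norm_toL2_comp_neg hk
    have e : toL2 (fun s => (1 / 2 : ℝ) • (p s + p (-s)) - f s) =
        (1 / 2 : ℝ) • (toL2 (p - f) + toL2 (fun s => (p - f) (-s))) := by
      rw [← toL2_add hk hn.1, ← toL2_const_smul (f := fun s => (p - f) s + (p - f) (-s))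
        (hk.add hn.1)]
      refine (toL2_congr ((hk.add hn.1).const_smul (1 / 2 : ℝ)) (forall_ae_arcMeas fun s hs => ?_)).symm
      simp only [Pi.smul_apply, Pi.add_apply, Pi.sub_apply, he s hs]
      module
    rw [e, norm_smul]
    refine lt_of_le_of_lt (mul_le_mul_of_nonneg_left (norm_add_le _ _) (norm_nonneg _)) ?_
    rw [hn.2]
    have h6 : ‖toL2 (p - f)‖ < ε := h5
    rw [Real.norm_of_nonneg (by norm_num)]
    linarith

end Density

/-! ### Inverse stereographic projection onto the unit sphere -/

section Stereographic

variable {E : Type*} [NormedAddCommGroup E] [InnerProductSpace ℝ E]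

/-- `n + stereo n q` is the inverse stereographic projection, from `-n`, of the point `q` of the
tangent plane to the unit sphere at `n`. -/
noncomputable def stereo (n q : E) : E := (1 + ‖q‖ ^ 2 / 4)⁻¹ • (q - (‖q‖ ^ 2 / 2) • n)

variable {n q : E}

theorem norm_stereo_sq (hn : ‖n‖ = 1) (hq : inner ℝ q n = 0) :
    ‖stereo n q‖ ^ 2 = ‖q‖ ^ 2 * (1 + ‖q‖ ^ 2 / 4)⁻¹ := by
  have h : (1 + ‖q‖ ^ 2 / 4) ≠ 0 := by positivity
  rw [stereo, norm_smul, mul_pow, norm_sub_sq_real, inner_smul_right, hq, norm_smul, hn,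
    Real.norm_eq_abs, sq_abs, Real.norm_eq_abs, mul_pow, sq_abs]
  field_simp
  ring

theorem norm_stereo_le (hn : ‖n‖ = 1) (hq : inner ℝ q n = 0) : ‖stereo n q‖ ≤ ‖q‖ := by
  refine (pow_le_pow_iff_left₀ (norm_nonneg _) (norm_nonneg _) two_ne_zero).1 ?_
  rw [norm_stereo_sq hn hq]
  exact mul_le_of_le_one_right (by positivity) (inv_le_one_of_one_le₀ (by
    have := sq_nonneg ‖q‖; linarith))

theorem norm_add_stereo (hn : ‖n‖ = 1) (hq : inner ℝ q n = 0) : ‖n + stereo n q‖ = 1 := by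
  have h : (1 + ‖q‖ ^ 2 / 4) ≠ 0 := by positivity
  have h2 : ‖n + stereo n q‖ ^ 2 = 1 := by
    rw [norm_add_sq_real, norm_stereo_sq hn hq, hn, stereo, inner_smul_right, inner_sub_right,
      inner_smul_right, real_inner_comm, hq, real_inner_self_eq_norm_sq, hn]
    field_simp
    ring
  nlinarith [norm_nonneg (n + stereo n q)]

/-- The projection agrees with the identity to first order at q = 0. The quadratic error is what
lets a curve of unit fields have a prescribed initial velocity orthogonal to γ'. -/
theorem norm_stereo_sub_le (hn : ‖n‖ = 1) (hq : inner ℝ q n = 0) :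
    ‖stereo n q - q‖ ≤ ‖q‖ ^ 2 := by
  have h : (0 : ℝ) < 1 + ‖q‖ ^ 2 / 4 := by positivity
  have e : inner ℝ (stereo n q) q = (1 + ‖q‖ ^ 2 / 4)⁻¹ * ‖q‖ ^ 2 := by
    rw [stereo, real_inner_smul_left, inner_sub_left, real_inner_self_eq_norm_sq,
      real_inner_smul_left, real_inner_comm, hq]
    ring
  have h2 : ‖stereo n q - q‖ ^ 2 ≤ (‖q‖ ^ 2) ^ 2 := by
    rw [norm_sub_sq_real, norm_stereo_sq hn hq, e]
    have : ‖q‖ ^ 2 * (1 + ‖q‖ ^ 2 / 4)⁻¹ - 2 * ((1 + ‖q‖ ^ 2 / 4)⁻¹ * ‖q‖ ^ 2) + ‖q‖ ^ 2 =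
        (‖q‖ ^ 2) ^ 2 * ((1 + ‖q‖ ^ 2 / 4)⁻¹ / 4) := by
      field_simp
      ring
    rw [this]
    refine mul_le_of_le_one_right (by positivity) ?_
    have := inv_le_one_of_one_le₀ (by linarith [sq_nonneg ‖q‖] : 1 ≤ 1 + ‖q‖ ^ 2 / 4)
    linarith
  exact (pow_le_pow_iff_left₀ (norm_nonneg _) (by positivity) two_ne_zero).1 h2

end Stereographic

/-! ### A slow choice of approximation index, and a criterion for differentiability -/

section Limits

/-- Diagonal argument: as t → 0 the index may be sent to infinity as slowly as needed to absorb the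
unknown growth of M. It is the largest k below 1/|t| with |t| M k ≤ 1/(k+1). -/
theorem exists_tendsto_mul_zero {M : ℕ → ℝ} (hM : ∀ n, 0 ≤ M n) :
    ∃ n : ℝ → ℕ, Tendsto n (𝓝[≠] 0) atTop ∧
      Tendsto (fun t => |t| * M (n t)) (𝓝[≠] 0) (𝓝 0) := by
  classical
  let P : ℝ → ℕ → Prop := fun t k => |t| * M k ≤ 1 / ((k : ℝ) + 1)
  have hP : ∀ k, ∀ᶠ t in 𝓝[≠] (0 : ℝ), P t k := by
    intro k
    have : Tendsto (fun t : ℝ => |t| * M k) (𝓝 0) (𝓝 (|0| * M k)) :=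
      (continuous_abs.mul continuous_const).tendsto 0
    rw [abs_zero, zero_mul] at this
    exact ((this.eventually_le_const (by positivity)).filter_mono nhdsWithin_le_nhds)
  have hfl : Tendsto (fun t : ℝ => ⌊|t|⁻¹⌋₊) (𝓝[≠] 0) atTop := by
    refine tendsto_nat_floor_atTop.comp ?_
    refine tendsto_inv_nhdsGT_zero.comp ?_
    rw [tendsto_nhdsWithin_iff]
    refine ⟨?_, ?_⟩
    · have := (continuous_abs (G := ℝ)).tendsto 0
      rw [abs_zero] at this
      exact this.mono_left nhdsWithin_le_nhds
    · filter_upwards [self_mem_nhdsWithin] with t ht using abs_pos.2 ht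
  have hn : Tendsto (fun t : ℝ => Nat.findGreatest (P t) ⌊|t|⁻¹⌋₊) (𝓝[≠] 0) atTop := by
    refine tendsto_atTop.2 fun k => ?_
    filter_upwards [hP k, hfl.eventually_ge_atTop k] with t h1 h2
    exact Nat.le_findGreatest h2 h1
  refine ⟨_, hn, ?_⟩
  refine squeeze_zero' (Eventually.of_forall fun t => mul_nonneg (abs_nonneg _) (hM _)) ?_
    (tendsto_one_div_add_atTop_nhds_zero_nat.comp hn)
  -- `Nat.findGreatest` returns 0 when its search fails, so its output satisfies P only because P t
  -- 0 itself holds for small t.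
  filter_upwards [hP 0] with t h0
  exact Nat.findGreatest_spec (P := P t) (Nat.zero_le _) h0

theorem hasDerivAt_zero_of_norm_le {E : Type*} [NormedAddCommGroup E] [NormedSpace ℝ E]
    {f : ℝ → E} {f' : E} {ε : ℝ → ℝ} (hε : Tendsto ε (𝓝[≠] 0) (𝓝 0))
    (h : ∀ t ≠ 0, ‖f t - f 0 - t • f'‖ ≤ |t| * ε t) : HasDerivAt f f' 0 := by
  rw [hasDerivAt_iff_tendsto_slope_zero]
  refine tendsto_iff_norm_sub_tendsto_zero.2 ?_
  refine squeeze_zero' (Eventually.of_forall fun t => norm_nonneg _) ?_ hε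
  filter_upwards [self_mem_nhdsWithin] with t ht
  have ht' : t ≠ 0 := ht
  have e : t⁻¹ • (f (0 + t) - f 0) - f' = t⁻¹ • (f t - f 0 - t • f') := by
    rw [zero_add, smul_sub _ _ (t • f'), smul_smul, inv_mul_cancel₀ ht', one_smul]
  rw [e, norm_smul, norm_inv, Real.norm_eq_abs, inv_mul_le_iff₀ (abs_pos.2 ht')]
  exact h t ht'

end Limits

/-! ### Auxiliary L² estimates -/

section Tools

variable {N : ℕ}

theorem norm_toL2_le_mul {f g : ℝ → Amb N} (hf : MemLp f 2 arcMeas) (hg : MemLp g 2 arcMeas)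
    {c : ℝ} (h : ∀ s ∈ arcI, ‖f s‖ ≤ c * ‖g s‖) : ‖toL2 f‖ ≤ c * ‖toL2 g‖ := by
  refine Lp.norm_le_mul_norm_of_ae_le_mul ?_
  filter_upwards [coeFn_toL2 hf, coeFn_toL2 hg, forall_ae_arcMeas h] with s h1 h2 h3
  rwa [h1, h2]

theorem isOddArc_primCurve {p : ℝ → Amb N} (hc : ContinuousOn p arcI)
    (hi : Integrable p arcMeas) (he : ∀ s ∈ arcI, p (-s) = p s) :
    IsOddArc (primCurve p) ∧ ∀ s ∈ arcI, deriv (primCurve p) s = p s := by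
  have hd : ∀ s ∈ arcI, HasDerivAt (primCurve p) (p s) s := fun s hs =>
    intervalIntegral.integral_hasDerivAt_right
      ((hc.mono (uIcc_subset_arcI zero_mem_arcI hs)).intervalIntegrable)
      (hc.stronglyMeasurableAtFilter isOpen_Ioo s hs) (hc.continuousAt (arcI_mem_nhds hs))
  have hd' : ∀ s ∈ arcI, deriv (primCurve p) s = p s := fun s hs => (hd s hs).deriv
  refine ⟨⟨fun s hs => ?_, ?_, hi.congr (forall_ae_arcMeas fun s hs => (hd' s hs).symm)⟩, hd'⟩
  · have h := intervalIntegral.integral_comp_neg (a := 0) (b := s) p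
    rw [neg_zero] at h
    rw [primCurve, primCurve, intervalIntegral.integral_symm, ← h]
    congr 1
    refine intervalIntegral.integral_congr fun x hx => he x (uIcc_subset_arcI zero_mem_arcI hs ?_)
    simpa using hx
  · rw [show (1 : WithTop ℕ∞) = 0 + 1 by norm_num, contDiffOn_succ_iff_deriv_of_isOpen isOpen_Ioo]
    refine ⟨fun s hs => (hd s hs).differentiableAt.differentiableWithinAt, by simp, ?_⟩
    rw [contDiffOn_zero]
    exact hc.congr hd'

theorem IsOddArc.norm_toL2_le' {g : ℝ → Amb N} (h : IsOddArc g) (h2 : MemLp (deriv g) 2 arcMeas) :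
    ‖toL2 g‖ ≤ 4 * ‖toL2 (deriv g)‖ := by
  have := h.norm_toL2_le
  have := integral_norm_le h2
  linarith

end Tools

/-! ### Existence of curves and tangent fields with given initial data -/

section Existence

variable {N m : ℕ} {γ u v : ℝ → Amb N}

theorem MemTangent.isOddArc {η : ℝ → Amb N} (hm : 2 ≤ m) (h : MemTangent m η v) : IsOddArc v :=
  h.1.isOddArc hm

theorem MemArcSpace.isOddArc (hm : 2 ≤ m) (h : MemArcSpace m γ) : IsOddArc γ :=
  h.1.isOddArc hm

theorem IsBumpField.stereo {k : ℕ∞} {ν q : ℝ → Amb N} (hq : IsBumpField k q)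
    (hν : ContDiffOn ℝ k ν arcI) (he : ∀ s ∈ arcI, ν (-s) = ν s) :
    IsBumpField k (fun s => stereo (ν s) (q s)) := by
  refine hq.of_contDiffOn ?_ (fun s hs => by simp [_root_.stereo, hs])
    (fun s hs => by simp only [hq.even, he s hs])
  have hn : ContDiffOn ℝ k (fun s => ‖q s‖ ^ 2) arcI := (hq.contDiff.norm_sq ℝ).contDiffOn
  have h1 : ContDiffOn ℝ k (fun s => (1 + ‖q s‖ ^ 2 / 4)⁻¹) arcI :=
    (contDiffOn_const.add (hn.div_const 4)).inv fun s _ => by positivity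
  have h2 : ContDiffOn ℝ k (fun s => q s - (‖q s‖ ^ 2 / 2) • ν s) arcI :=
    hq.contDiff.contDiffOn.sub ((hn.div_const 2).smul hν)
  exact h1.smul h2

theorem IsBumpField.const_smul {k : ℕ∞} {q : ℝ → Amb N} (hq : IsBumpField k q) (c : ℝ) :
    IsBumpField k (fun s => c • q s) :=
  hq.of_contDiffOn (r := fun s => c • q s) (hq.contDiff.const_smul c).contDiffOn
    (fun s hs => by simp [hs])
    (fun s _ => by simp only [hq.even])

theorem integrable_inner_of_memLp {f g : ℝ → Amb N} (hf : MemLp f 2 arcMeas)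
    (hg : MemLp g 2 arcMeas) : Integrable (fun s => (inner ℝ (f s) (g s) : ℝ)) arcMeas :=
  (MemLp.integrable_mul (p := 2) (q := 2) hf.norm hg.norm).mono' (hf.1.inner hg.1)
    (Eventually.of_forall fun _ => norm_inner_le_norm _ _)

/-- The curve `γ + ∫ r` stays in the arc space when `r` is a bump field and `|γ' + r| ≡ 1`. -/
theorem MemArcSpace.add_primCurve (hγ : MemArcSpace (m + 2) γ) {r : ℝ → Amb N}
    (hr : IsBumpField m r) (h1 : ∀ s ∈ arcI, ‖deriv γ s + r s‖ = 1) :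
    MemArcSpace m (fun s => γ s + primCurve r s) ∧
      (∀ s ∈ arcI, deriv (fun s => γ s + primCurve r s) s = deriv γ s + r s) ∧
      ContDiffOn ℝ m (deriv (fun s => γ s + primCurve r s)) arcI ∧
      ∀ s ∈ arcI, deriv (fun s => γ s + primCurve r s) (-s) =
        deriv (fun s => γ s + primCurve r s) s := by
  have hd : ∀ s ∈ arcI, deriv (fun s => γ s + primCurve r s) s = deriv γ s + r s := fun s hs =>
    (((hγ.isOddArc (by omega)).hasDerivAt hs).add
      (hasDerivAt_primCurve hr.contDiff.continuous s)).deriv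
  refine ⟨⟨(hγ.1.mono (by omega)).add (hr.memCurveSpace (by omega)), fun s hs => ?_⟩, hd, ?_, ?_⟩
  · rw [hd s hs, h1 s hs]
  · exact ((hγ.1.contDiffOn_deriv le_rfl).add hr.contDiff.contDiffOn).congr hd
  · intro s hs
    rw [hd s hs, hd _ (neg_mem_arcI hs), hr.even, (hγ.isOddArc (by omega)).deriv_neg hs]

/-- Normalising γ' + t u' directly gives no control of the higher derivatives and no uniform error,
as u' is merely in L². Instead u' is replaced by bump fields p_n converging to it in L², with n =
n(t) → ∞ slowly. Their components orthogonal to γ' are lifted to the sphere and integrated to η(t).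
For V(t), bump fields close to v' are projected orthogonally to η(t)' and integrated. The hypothesis
γ ∈ 𝒜^{m+2} makes γ' of class C^m, which keeps these fields in the required class. -/
theorem exists_isFieldAlong (hm : 2 ≤ m) (hγ : MemArcSpace (m + 2) γ) (hu : MemTangent m γ u)
    (hv : MemTangent m γ v) : ∃ η V z, IsFieldAlong m γ u v η V z := by
  classical
  set ν := deriv γ with hνdef
  have hγo := hγ.isOddArc (by omega)
  have huo := hu.isOddArc hm
  have hvo := hv.isOddArc hm
  have hu2 : MemLp (deriv u) 2 arcMeas := hu.1.memLp_deriv hm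
  have hv2 : MemLp (deriv v) 2 arcMeas := hv.1.memLp_deriv hm
  have hν2 : MemLp ν 2 arcMeas := hγ.1.memLp_deriv (by omega)
  have hνm : ContDiffOn ℝ m ν arcI := hγ.1.contDiffOn_deriv le_rfl
  have hνe : ∀ s ∈ arcI, ν (-s) = ν s := fun s hs => hγo.deriv_neg hs
  have hν1 : ∀ s ∈ arcI, ‖ν s‖ = 1 := hγ.2
  choose p hp hpu using fun n : ℕ => exists_isBumpField_norm_toL2_sub_le hu2
    (fun s hs => huo.deriv_neg hs) (Nat.one_div_pos_of_nat (α := ℝ) (n := n))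
  choose B hB0 hB using fun n => (hp n).exists_bound
  -- The stereographic error at time t is at most t² B², which is o(t) exactly when |t| B² → 0.
  -- Using (1+B)² lets the same quantity b dominate |t| B as well.
  obtain ⟨n, hn, hnB⟩ := exists_tendsto_mul_zero (M := fun k => (1 + B k) ^ 2)
    (fun k => sq_nonneg _)
  have hk : ∀ t : ℝ, ∃ k : ℝ → Amb N, IsBumpField ⊤ k ∧
      (t ≠ 0 → ‖toL2 (fun s => k s - deriv v s)‖ < t ^ 2) := by
    intro t
    by_cases ht : t = 0
    · exact ⟨p 0, hp 0, fun h => absurd ht h⟩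
    · obtain ⟨k, h1, h2⟩ := exists_isBumpField_norm_toL2_sub_le hv2
        (fun s hs => hvo.deriv_neg hs) (ε := t ^ 2) (by positivity)
      exact ⟨k, h1, fun _ => h2⟩
  choose k hkb hkv using hk
  set q : ℝ → ℝ → Amb N := fun t s => t • orthField ν (p (n t)) s with hq
  set r : ℝ → ℝ → Amb N := fun t s => stereo (ν s) (q t s) with hr
  set b : ℝ → ℝ := fun t => |t| * (1 + B (n t)) ^ 2 with hb
  set e : ℝ → ℝ := fun t => 2 * b t + 1 / ((n t : ℝ) + 1) with he
  have hb0 : ∀ t, 0 ≤ b t := fun t => by positivity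
  have hlim : Tendsto e (𝓝[≠] 0) (𝓝 0) := by
    have := (hnB.const_mul 2).add ((tendsto_one_div_add_atTop_nhds_zero_nat (𝕜 := ℝ)).comp hn)
    simpa [he] using this
  have hpm : ∀ t, IsBumpField m (p (n t)) := fun t => (hp _).of_le le_top
  have hqb : ∀ t, IsBumpField m (q t) := fun t => ((hpm t).orthField hνm hνe).const_smul t
  have hrb : ∀ t, IsBumpField m (r t) := fun t => (hqb t).stereo hνm hνe
  have hqν : ∀ t, ∀ s ∈ arcI, inner ℝ (q t s) (ν s) = 0 := fun t s hs => by
    rw [hq, real_inner_smul_left, inner_orthField (hν1 s hs), mul_zero]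
  have hqB : ∀ t, ∀ s ∈ arcI, ‖q t s‖ ≤ |t| * B (n t) := fun t s hs => by
    rw [hq, norm_smul, Real.norm_eq_abs]
    gcongr
    exact (norm_orthField_le (hν1 s hs)).trans (hB _ _)
  have hrν : ∀ t, ∀ s ∈ arcI, ‖ν s + r t s‖ = 1 := fun t s hs =>
    norm_add_stereo (hν1 s hs) (hqν t s hs)
  have hrB : ∀ t, ∀ s ∈ arcI, ‖r t s‖ ≤ b t := fun t s hs => by
    refine (norm_stereo_le (hν1 s hs) (hqν t s hs)).trans ((hqB t s hs).trans ?_)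
    have := hB0 (n t)
    exact mul_le_mul_of_nonneg_left (by nlinarith) (abs_nonneg t)
  set η : ℝ → ℝ → Amb N := fun t s => γ s + primCurve (r t) s with hη
  have hηall := fun t => hγ.add_primCurve (hrb t) (hrν t)
  have hη0 : η 0 = γ := by
    have : r 0 = fun _ => 0 := by
      ext1 s; simp [hr, hq, stereo]
    rw [hη]; ext1 s; simp [this, primCurve]
  -- the error in the velocity
  have herr : ∀ t, ‖toL2 (fun s => r t s - t • deriv u s)‖ ≤ |t| * e t := by
    intro t
    have h1 : MemLp (fun s => r t s - q t s) 2 arcMeas := (hrb t).memLp.sub (hqb t).memLp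
    have h2 : MemLp (fun s => q t s - t • deriv u s) 2 arcMeas :=
      (hqb t).memLp.sub (hu2.const_smul t)
    have e1 : (fun s => r t s - t • deriv u s) =
        fun s => (r t s - q t s) + (q t s - t • deriv u s) := by ext1 s; abel
    rw [e1, toL2_add h1 h2]
    refine (norm_add_le _ _).trans ?_
    have b1 : ‖toL2 (fun s => r t s - q t s)‖ ≤ 2 * (|t| * b t) := by
      refine norm_toL2_le_of_bound h1 (mul_nonneg (abs_nonneg _) (hb0 t)) fun s hs => ?_
      refine (norm_stereo_sub_le (hν1 s hs) (hqν t s hs)).trans ?_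
      calc ‖q t s‖ ^ 2 ≤ (|t| * B (n t)) ^ 2 := by gcongr; exact hqB t s hs
        _ = |t| * (|t| * B (n t) ^ 2) := by ring
        _ ≤ _ := by
          have := hB0 (n t)
          rw [hb]
          exact mul_le_mul_of_nonneg_left (mul_le_mul_of_nonneg_left (by nlinarith)
            (abs_nonneg t)) (abs_nonneg t)
    have b2 : ‖toL2 (fun s => q t s - t • deriv u s)‖ ≤ |t| * (1 / ((n t : ℝ) + 1)) := by
      refine (norm_toL2_le_mul h2 ((hp (n t)).memLp.sub hu2) (c := |t|) fun s hs => ?_).trans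
        (by gcongr; exact (hpu _).le)
      -- Because u' is already orthogonal to γ', projecting the approximant does not increase its
      -- distance to u'.
      have : q t s - t • deriv u s = t • orthField ν (fun s => p (n t) s - deriv u s) s := by
        have h0 : inner ℝ (deriv u s) (ν s) = 0 := hu.2 s hs
        simp only [hq, orthField, inner_sub_left, h0, sub_zero]
        module
      rw [this, norm_smul, Real.norm_eq_abs]
      gcongr
      exact norm_orthField_le (hν1 s hs)
    rw [he]
    nlinarith
  have hvel' : ∀ t, toL2 (deriv (η t)) - toL2 (deriv (η 0)) - t • toL2 (deriv u) =
      toL2 (fun s => r t s - t • deriv u s) := by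
    intro t
    rw [hη0, toL2_congr (g := fun s => ν s + r t s) ((hηall t).1.1.memLp_deriv hm)
      (forall_ae_arcMeas (hηall t).2.1), toL2_add hν2 (hrb t).memLp,
      toL2_sub (g := fun s => t • deriv u s) (hrb t).memLp (hu2.const_smul t), toL2_const_smul hu2]
    module
  have hvel : ∀ t, ‖toL2 (η t) - toL2 (η 0) - t • toL2 u‖ ≤ |t| * (4 * e t) := by
    intro t
    have h1 := ((hrb t).isOddArc (by omega)).add (huo.const_smul (-t))
    have h2 : toL2 (η t) - toL2 (η 0) - t • toL2 u =
        toL2 (fun s => primCurve (r t) s + (-t) • u s) := by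
      rw [hη0, hη, toL2_add hγo.memLp ((hrb t).isOddArc (by omega)).memLp,
        toL2_add ((hrb t).isOddArc (by omega)).memLp (huo.const_smul (-t)).memLp,
        toL2_const_smul huo.memLp]
      module
    have h3 : ∀ s ∈ arcI, deriv (fun s => primCurve (r t) s + (-t) • u s) s =
        r t s - t • deriv u s := fun s hs => by
      have h : HasDerivAt (fun s => primCurve (r t) s + (-t) • u s) (r t s + (-t) • deriv u s) s :=
        (hasDerivAt_primCurve (hrb t).contDiff.continuous s).add
          ((huo.hasDerivAt hs).const_smul (-t))
      rw [h.deriv]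
      module
    have h4 : MemLp (fun s => r t s - t • deriv u s) 2 arcMeas :=
      (hrb t).memLp.sub (hu2.const_smul t)
    have h5 := (memLp_congr_ae (forall_ae_arcMeas h3)).2 h4
    rw [h2]
    refine (h1.norm_toL2_le' h5).trans ?_
    rw [toL2_congr h5 (forall_ae_arcMeas h3)]
    linarith [herr t]
  set W : ℝ → ℝ → Amb N := fun t => orthField (deriv (η t)) (k t) with hW
  have hWb : ∀ t, IsBumpField m (W t) := fun t =>
    IsBumpField.orthField ((hkb t).of_le le_top) (hηall t).2.2.1 (hηall t).2.2.2
  set V : ℝ → ℝ → Amb N := fun t => if t = 0 then v else primCurve (W t) with hV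
  have hV0 : V 0 = v := if_pos rfl
  have hVt : ∀ t, t ≠ 0 → V t = primCurve (W t) := fun t ht => if_neg ht
  have hVd : ∀ t, t ≠ 0 → deriv (V t) = W t := fun t ht => by
    rw [hVt t ht, deriv_primCurve (hWb t).contDiff.continuous]
  have hVT : ∀ t, MemTangent m (η t) (V t) := by
    intro t
    by_cases ht : t = 0
    · rw [ht, hV0, hη0]; exact hv
    · rw [hVt t ht]
      exact IsBumpField.memTangent ((hkb t).of_le le_top) (hηall t).2.2.1 (hηall t).2.2.2
        (hηall t).1.2
  set f : ℝ → ℝ := fun s => inner ℝ (deriv u s) (deriv v s) with hf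
  have hfi : Integrable f arcMeas := integrable_inner_of_memLp hu2 hv2
  have hfc0 : ContinuousOn f arcI := fun s hs =>
    (huo.continuousOn_deriv s hs).inner (hvo.continuousOn_deriv s hs)
  -- The candidate for V̇(0): formally the projection v' - ⟨v', η'⟩η' has t-derivative -⟨v', u'⟩γ'
  -- at t = 0.
  have hfν := isOddArc_primCurve (p := fun s => (-f s) • ν s)
    (hfc0.neg.smul hγo.continuousOn_deriv)
    (by
      refine (hfi.norm.mono' ((hfc0.neg.smul
        hγo.continuousOn_deriv).aestronglyMeasurable measurableSet_Ioo)
        (forall_ae_arcMeas fun s hs => ?_))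
      rw [norm_smul, hν1 s hs, norm_neg, mul_one])
    (fun s hs => by simp only [hf, huo.deriv_neg hs, hvo.deriv_neg hs, hνe s hs])
  -- pointwise decomposition of the field
  have hWdec : ∀ t, ∀ s ∈ arcI, W t s = orthField (deriv (η t)) (fun s => k t s - deriv v s) s +
      (deriv v s - (inner ℝ (deriv v s) (r t s) : ℝ) • deriv (η t) s) := by
    intro t s hs
    have h1 : inner ℝ (deriv v s) (deriv (η t) s) = inner ℝ (deriv v s) (r t s) := by
      rw [(hηall t).2.1 s hs, inner_add_right, hv.2 s hs, zero_add]
    simp only [hW, orthField, inner_sub_left, h1]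
    module
  have hη1 : ∀ t, ∀ s ∈ arcI, ‖deriv (η t) s‖ = 1 := fun t => (hηall t).1.2
  have hWv : ∀ t, MemLp (fun s => W t s - deriv v s) 2 arcMeas := fun t => (hWb t).memLp.sub hv2
  have hfc : ∀ t, t ≠ 0 → ‖toL2 (deriv (V t)) - toL2 (deriv v)‖ ≤ t ^ 2 + b t * ‖toL2 (deriv v)‖ := by
    intro t ht
    have hkv2 : MemLp (fun s => k t s - deriv v s) 2 arcMeas := (hkb t).memLp.sub hv2
    have m1 : MemLp (fun s => orthField (deriv (η t)) (fun s => k t s - deriv v s) s) 2 arcMeas := by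
      refine hkv2.of_le ?_ (forall_ae_arcMeas fun s hs => norm_orthField_le (hη1 t s hs))
      have hd : AEStronglyMeasurable (deriv (η t)) arcMeas := ((hηall t).1.1.memLp_deriv hm).1
      have hi : AEStronglyMeasurable
        (fun s => (inner ℝ (k t s - deriv v s) (deriv (η t) s) : ℝ)) arcMeas := hkv2.1.inner hd
      exact hkv2.1.sub (hi.smul hd)
    have m2 : MemLp (fun s => (W t s - deriv v s) -
        orthField (deriv (η t)) (fun s => k t s - deriv v s) s) 2 arcMeas := (hWv t).sub m1
    have e1 : toL2 (deriv (V t)) - toL2 (deriv v) =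
        toL2 (fun s => orthField (deriv (η t)) (fun s => k t s - deriv v s) s) +
        toL2 (fun s => (W t s - deriv v s) -
          orthField (deriv (η t)) (fun s => k t s - deriv v s) s) := by
      rw [toL2_sub (hWv t) m1, toL2_sub (hWb t).memLp hv2, hVd t ht]
      abel
    rw [e1]
    refine (norm_add_le _ _).trans (add_le_add ?_ ?_)
    · have := norm_toL2_le_mul m1 hkv2 (c := 1) fun s hs => by
        rw [one_mul]; exact norm_orthField_le (hη1 t s hs)
      rw [one_mul] at this
      exact this.trans (hkv t ht).le
    · refine norm_toL2_le_mul m2 hv2 fun s hs => ?_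
      have : (W t s - deriv v s) - orthField (deriv (η t)) (fun s => k t s - deriv v s) s =
          -((inner ℝ (deriv v s) (r t s) : ℝ) • deriv (η t) s) := by
        rw [hWdec t s hs]; abel
      rw [this, norm_neg, norm_smul, hη1 t s hs, mul_one, mul_comm]
      exact (norm_inner_le_norm _ _).trans (by gcongr; exact hrB t s hs)
  -- The density ⟨u', v'⟩ is only integrable, so the s-derivative of the error is estimated in L¹.
  -- For odd curves that controls the supremum and hence the L² norm, which is why V is
  -- differentiable in L² and not claimed to be so in H¹.
  have hfd : ∀ t, t ≠ 0 → ‖toL2 (V t) - toL2 (V 0) - t • toL2 (primCurve fun s => (-f s) • ν s)‖ ≤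
      |t| * (2 * (2 * |t| + ‖toL2 (deriv v)‖ * e t + b t * ∫ s, |f s| ∂arcMeas)) := by
    intro t ht
    have hVo : IsOddArc (V t) := (hVT t).isOddArc hm
    have h1 := (hVo.add (hvo.const_smul (-1))).add (hfν.1.const_smul (-t))
    have h2 : toL2 (V t) - toL2 (V 0) - t • toL2 (primCurve fun s => (-f s) • ν s) =
        toL2 (fun s => (V t s + (-1 : ℝ) • v s) + (-t) • primCurve (fun s => (-f s) • ν s) s) := by
      rw [hV0, toL2_add (hVo.add (hvo.const_smul (-1))).memLp (hfν.1.const_smul (-t)).memLp,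
        toL2_add hVo.memLp (hvo.const_smul (-1)).memLp, toL2_const_smul hvo.memLp,
        toL2_const_smul hfν.1.memLp]
      module
    have h3 : ∀ s ∈ arcI, deriv (fun s => (V t s + (-1 : ℝ) • v s) +
        (-t) • primCurve (fun s => (-f s) • ν s) s) s =
        W t s - deriv v s + (t * f s) • ν s := fun s hs => by
      have h : HasDerivAt (fun s => (V t s + (-1 : ℝ) • v s) +
          (-t) • primCurve (fun s => (-f s) • ν s) s) ((deriv (V t) s + (-1 : ℝ) • deriv v s) +
          (-t) • deriv (primCurve fun s => (-f s) • ν s) s) s :=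
        ((hVo.hasDerivAt hs).add ((hvo.hasDerivAt hs).const_smul (-1 : ℝ))).add
          ((hfν.1.hasDerivAt hs).const_smul (-t))
      rw [h.deriv, hfν.2 s hs, hVd t ht]
      module
    rw [h2]
    refine h1.norm_toL2_le.trans ?_
    have hkv2 : MemLp (fun s => k t s - deriv v s) 2 arcMeas := (hkb t).memLp.sub hv2
    have hr2 : MemLp (fun s => r t s - t • deriv u s) 2 arcMeas :=
      (hrb t).memLp.sub (hu2.const_smul t)
    have i1 : Integrable (fun s => ‖k t s - deriv v s‖) arcMeas :=
      (hkv2.integrable (by norm_num)).norm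
    have i2 : Integrable (fun s => ‖deriv v s‖ * ‖r t s - t • deriv u s‖) arcMeas :=
      MemLp.integrable_mul (p := 2) (q := 2) hv2.norm hr2.norm
    have i3 : Integrable (fun s => |t| * b t * |f s|) arcMeas := hfi.abs.const_mul _
    have h4 : ∫ s, ‖deriv (fun s => (V t s + (-1 : ℝ) • v s) +
        (-t) • primCurve (fun s => (-f s) • ν s) s) s‖ ∂arcMeas ≤
        ∫ s, (‖k t s - deriv v s‖ + ‖deriv v s‖ * ‖r t s - t • deriv u s‖ +
          |t| * b t * |f s|) ∂arcMeas := by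
      refine integral_mono_ae h1.integrable.norm ((i1.add i2).add i3)
        (forall_ae_arcMeas fun s hs => ?_)
      simp only
      rw [h3 s hs, hWdec t s hs]
      have h5 : (inner ℝ (deriv v s) (r t s) : ℝ) =
          inner ℝ (deriv v s) (r t s - t • deriv u s) + t * f s := by
        simp only [hf]
        rw [inner_sub_right, inner_smul_right, real_inner_comm (deriv u s)]; ring
      -- The term t⟨u', v'⟩γ' cancels; what remains is the approximation error of v', the velocity
      -- error paired with v', and a term carrying the extra small factor r(t).
      have h6 : orthField (deriv (η t)) (fun s => k t s - deriv v s) s +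
          (deriv v s - (inner ℝ (deriv v s) (r t s) : ℝ) • deriv (η t) s) - deriv v s +
            (t * f s) • ν s =
          orthField (deriv (η t)) (fun s => k t s - deriv v s) s +
          (-((inner ℝ (deriv v s) (r t s - t • deriv u s) : ℝ) • deriv (η t) s) +
            -((t * f s) • r t s)) := by
        rw [h5, (hηall t).2.1 s hs]; module
      rw [h6, add_assoc]
      refine (norm_add_le _ _).trans (add_le_add (norm_orthField_le (hη1 t s hs)) ?_)
      refine (norm_add_le _ _).trans (add_le_add ?_ ?_)
      · rw [norm_neg, norm_smul, hη1 t s hs, mul_one]; exact norm_inner_le_norm _ _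
      · rw [norm_neg, norm_smul, norm_mul, Real.norm_eq_abs, Real.norm_eq_abs]
        calc |t| * |f s| * ‖r t s‖ ≤ |t| * |f s| * b t := by gcongr; exact hrB t s hs
          _ = _ := by ring
    have i12 : Integrable (fun s => ‖k t s - deriv v s‖ + ‖deriv v s‖ *
      ‖r t s - t • deriv u s‖) arcMeas := i1.add i2
    rw [integral_add i12 i3, integral_add i1 i2, integral_const_mul] at h4
    have h7 := integral_norm_le hkv2
    have h8 := integral_norm_mul_norm_le hv2 hr2
    have h9 := hkv t ht
    have h10 := mul_le_mul_of_nonneg_left (herr t) (norm_nonneg (toL2 (deriv v)))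
    rw [← sq_abs] at h9
    nlinarith
  refine ⟨η, V, toL2 (primCurve fun s => (-f s) • ν s), ?_⟩
  exact
    { arc := Eventually.of_forall fun t => (hηall t).1
      tangent := Eventually.of_forall hVT
      base := hη0
      init := hV0
      velocity := by
        refine hasDerivAt_zero_of_norm_le (ε := fun t => 4 * e t) ?_ fun t _ => hvel t
        simpa using hlim.const_mul 4
      velocity_deriv := hasDerivAt_zero_of_norm_le hlim fun t _ => by
        rw [hvel']; exact herr t
      field_cont := by
        rw [continuousAt_iff_punctured_nhds, hV0]
        refine tendsto_iff_norm_sub_tendsto_zero.2 ?_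
        refine squeeze_zero' (Eventually.of_forall fun t => norm_nonneg _)
          (g := fun t => t ^ 2 + b t * ‖toL2 (deriv v)‖) ?_ ?_
        · filter_upwards [self_mem_nhdsWithin] with t ht using hfc t ht
        · have h1 : Tendsto (fun t : ℝ => t ^ 2) (𝓝[≠] 0) (𝓝 (0 ^ 2)) :=
            ((continuous_pow 2).tendsto 0).mono_left nhdsWithin_le_nhds
          simpa using h1.add (hnB.mul_const ‖toL2 (deriv v)‖)
      field_deriv := by
        refine hasDerivAt_zero_of_norm_le ?_ hfd
        have h1 : Tendsto (fun t : ℝ => |t|) (𝓝[≠] 0) (𝓝 |0|) :=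
          ((continuous_abs).tendsto 0).mono_left nhdsWithin_le_nhds
        simpa using (((h1.const_mul 2).add (hlim.const_mul ‖toL2 (deriv v)‖)).add
          (hnB.mul_const (∫ s, |f s| ∂arcMeas))).const_mul 2 }

end Existence

/-! ### Normal vectors as bounded multiples of γ' -/

section Normal

variable {N m : ℕ} {γ u v : ℝ → Amb N}

theorem toL2_mem_tangentL2 {w : ℝ → Amb N} (hw : MemTangent m γ w) : toL2 w ∈ tangentL2 m γ :=
  Submodule.le_topologicalClosure _ (Submodule.subset_span ⟨w, hw, rfl⟩)

/-- Neither the linear span nor the closure in the definition of the tangent space affects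
orthogonality, so testing against tangent curves suffices. -/
theorem mem_orthogonal_tangentL2 {h : ArcL2 N} :
    h ∈ (tangentL2 m γ)ᗮ ↔ ∀ w, MemTangent m γ w → inner ℝ (toL2 w) h = 0 := by
  constructor
  · intro hh w hw
    exact (Submodule.mem_orthogonal _ _).1 hh _ (toL2_mem_tangentL2 hw)
  · intro hh
    rw [Submodule.mem_orthogonal]
    have : tangentL2 m γ ≤ (Submodule.span ℝ {h})ᗮ := by
      refine Submodule.topologicalClosure_minimal _ (Submodule.span_le.2 ?_)
        (Submodule.isClosed_orthogonal _)
      rintro _ ⟨w, hw, rfl⟩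
      rw [SetLike.mem_coe, Submodule.mem_orthogonal_singleton_iff_inner_left]
      exact hh w hw
    intro f hf
    exact Submodule.mem_orthogonal_singleton_iff_inner_left.1 (this hf)

instance instCompleteSpaceTangentL2 (m : ℕ) (γ : ℝ → Amb N) : CompleteSpace (tangentL2 m γ) :=
  (Submodule.isClosed_topologicalClosure _).completeSpace_coe

theorem tangentProj_apply (z : ArcL2 N) :
    tangentProj m γ z = (tangentL2 m γ).starProjection z := rfl

theorem sub_tangentProj_mem (z : ArcL2 N) : z - tangentProj m γ z ∈ (tangentL2 m γ)ᗮ :=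
  Submodule.sub_starProjection_mem_orthogonal z

/-- Integration by parts against a square integrable function. -/
theorem exists_inner_toL2_eq_integral (h : ArcL2 N) :
    ∃ H : ℝ → Amb N, ∃ C, AEStronglyMeasurable H arcMeas ∧ (∀ s, ‖H s‖ ≤ C) ∧
      (∀ s, H (-s) = H s) ∧ ∀ g, IsOddArc g →
        inner ℝ (toL2 g) h = ∫ x, inner ℝ (deriv g x) (H x) ∂arcMeas := by
  -- The kernel of integration from 0: an odd curve satisfies g(s) = ∫ χ(s,x) g'(x) dx, the sign
  -- taking care of s < 0. Fubini then moves χ onto h.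
  set χ : ℝ → ℝ → ℝ := fun s x =>
    (if 0 ≤ s then 1 else -1) * (uIoc 0 s).indicator (fun _ => (1 : ℝ)) x with hχ
  have hχm : Measurable (Function.uncurry χ) := by
    have h1 : Measurable fun p : ℝ × ℝ => (if 0 ≤ p.1 then (1 : ℝ) else -1) :=
      Measurable.ite (measurableSet_le measurable_const measurable_fst) measurable_const
        measurable_const
    have h2 : Measurable fun p : ℝ × ℝ => (uIoc 0 p.1).indicator (fun _ => (1 : ℝ)) p.2 := by
      have : (fun p : ℝ × ℝ => (uIoc 0 p.1).indicator (fun _ => (1 : ℝ)) p.2) =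
          ({p : ℝ × ℝ | min 0 p.1 < p.2} ∩ {p | p.2 ≤ max 0 p.1}).indicator fun _ => 1 := by
        ext p; simp only [indicator, uIoc, mem_Ioc, mem_inter_iff, mem_ofPred_eq]
      rw [this]
      exact measurable_const.indicator ((measurableSet_lt (by fun_prop) (by fun_prop)).inter
        (measurableSet_le (by fun_prop) (by fun_prop)))
    exact h1.mul h2
  have hχ1 : ∀ s x, ‖χ s x‖ ≤ 1 := by
    intro s x
    simp only [hχ, norm_mul]
    refine mul_le_one₀ (by split_ifs <;> simp) (norm_nonneg _) ?_
    by_cases hx : x ∈ uIoc 0 s <;> simp [hx]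
  have hh : Integrable h arcMeas := (Lp.memLp h).integrable (by norm_num)
  set H1 : ℝ → Amb N := fun x => ∫ s, χ s x • h s ∂arcMeas with hH1
  have hm2 : AEStronglyMeasurable (fun p : ℝ × ℝ => χ p.2 p.1 • h p.2) (arcMeas.prod arcMeas) :=
    (hχm.comp measurable_swap).aestronglyMeasurable.smul hh.1.comp_snd
  have hH1m : AEStronglyMeasurable H1 arcMeas := hm2.integral_prod_right'
  have hH1b : ∀ x, ‖H1 x‖ ≤ ∫ s, ‖h s‖ ∂arcMeas := by
    intro x
    refine norm_integral_le_of_norm_le hh.norm (Eventually.of_forall fun s => ?_)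
    rw [norm_smul]
    exact mul_le_of_le_one_left (norm_nonneg _) (hχ1 s x)
  have key : ∀ g, IsOddArc g →
      inner ℝ (toL2 g) h = ∫ x, inner ℝ (deriv g x) (H1 x) ∂arcMeas := by
    intro g hg
    have e1 : ∀ s ∈ arcI, g s = ∫ x, χ s x • deriv g x ∂arcMeas := by
      intro s hs
      rw [hg.eq_integral hs, intervalIntegral.intervalIntegral_eq_integral_uIoc]
      have hsub : arcI ∩ uIoc 0 s = uIoc 0 s := inter_eq_right.2
        (uIoc_subset_uIcc.trans (uIcc_subset_arcI zero_mem_arcI hs))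
      simp only [hχ, mul_smul]
      rw [integral_smul]
      congr 1
      have : ∀ x, (uIoc 0 s).indicator (fun _ => (1 : ℝ)) x • deriv g x =
          (uIoc 0 s).indicator (deriv g) x := fun x => by
        by_cases hx : x ∈ uIoc 0 s <;> simp [hx]
      simp only [this]
      rw [setIntegral_indicator measurableSet_uIoc, hsub]
    have hint : Integrable (Function.uncurry fun s x : ℝ =>
        (inner ℝ (χ s x • deriv g x) (h s) : ℝ)) (arcMeas.prod arcMeas) := by
      have hb : Integrable (fun p : ℝ × ℝ => ‖h p.1‖ * ‖deriv g p.2‖) (arcMeas.prod arcMeas) :=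
        hh.norm.mul_prod hg.integrable.norm
      refine hb.mono' ?_ (Eventually.of_forall fun p => ?_)
      · exact (hχm.aestronglyMeasurable.smul hg.integrable.1.comp_snd).inner hh.1.comp_fst
      · refine (norm_inner_le_norm _ _).trans ?_
        rw [norm_smul, mul_comm]
        exact mul_le_mul_of_nonneg_left
          (mul_le_of_le_one_left (norm_nonneg _) (hχ1 _ _)) (norm_nonneg _)
    have hχg : ∀ s, Integrable (fun x => χ s x • deriv g x) arcMeas := fun s =>
      hg.integrable.bdd_smul 1 (hχm.comp measurable_prodMk_left).aestronglyMeasurable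
        (Eventually.of_forall (hχ1 s))
    have hχh : ∀ x, Integrable (fun s => χ s x • h s) arcMeas := fun x =>
      hh.bdd_smul 1 (hχm.comp measurable_prodMk_right).aestronglyMeasurable
        (Eventually.of_forall fun s => hχ1 s x)
    rw [inner_toL2 hg.memLp]
    calc ∫ s, inner ℝ (g s) (h s) ∂arcMeas
        = ∫ s, ∫ x, inner ℝ (χ s x • deriv g x) (h s) ∂arcMeas ∂arcMeas := by
          refine integral_congr_ae (forall_ae_arcMeas fun s hs => ?_)
          simp only
          rw [e1 s hs, real_inner_comm, ← integral_inner (hχg s)]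
          simp only [real_inner_comm]
      _ = ∫ x, ∫ s, inner ℝ (χ s x • deriv g x) (h s) ∂arcMeas ∂arcMeas :=
          integral_integral_swap hint
      _ = _ := by
          refine integral_congr_ae (Eventually.of_forall fun x => ?_)
          simp only [hH1]
          rw [← integral_inner (hχh x)]
          simp only [real_inner_smul_left, real_inner_smul_right]
  have hH1m' : AEStronglyMeasurable (fun x => H1 (-x)) arcMeas :=
    hH1m.comp_measurePreserving measurePreserving_neg_arcMeas
  -- Only the even part is seen by the even derivative g', so averaging makes H even without
  -- changing the pairing.
  refine ⟨fun x => (1 / 2 : ℝ) • (H1 x + H1 (-x)), ∫ s, ‖h s‖ ∂arcMeas,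
    (hH1m.add hH1m').const_smul (1 / 2 : ℝ), fun s => ?_, fun s => by simp [add_comm], fun g hg => ?_⟩
  · rw [norm_smul, Real.norm_of_nonneg (by norm_num)]
    have := norm_add_le (H1 s) (H1 (-s))
    linarith [hH1b s, hH1b (-s)]
  · have i1 : Integrable (fun x => (inner ℝ (deriv g x) (H1 x) : ℝ)) arcMeas :=
      (hg.integrable.norm.mul_const (∫ s, ‖h s‖ ∂arcMeas)).mono' (hg.integrable.1.inner hH1m)
        (Eventually.of_forall fun x => (norm_inner_le_norm _ _).trans
          (mul_le_mul_of_nonneg_left (hH1b x) (norm_nonneg _)))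
    have i2 : Integrable (fun x => (inner ℝ (deriv g x) (H1 (-x)) : ℝ)) arcMeas :=
      (hg.integrable.norm.mul_const (∫ s, ‖h s‖ ∂arcMeas)).mono' (hg.integrable.1.inner hH1m')
        (Eventually.of_forall fun x => (norm_inner_le_norm _ _).trans
          (mul_le_mul_of_nonneg_left (hH1b _) (norm_nonneg _)))
    have e2 : ∫ x, (inner ℝ (deriv g x) (H1 (-x)) : ℝ) ∂arcMeas =
        ∫ x, inner ℝ (deriv g x) (H1 x) ∂arcMeas := by
      rw [← measurePreserving_neg_arcMeas.integral_comp (MeasurableEquiv.neg ℝ).measurableEmbedding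
        (fun x => (inner ℝ (deriv g x) (H1 x) : ℝ))]
      refine integral_congr_ae (forall_ae_arcMeas fun s hs => ?_)
      simp only [hg.deriv_neg hs]
    simp only [inner_smul_right, inner_add_right]
    rw [integral_const_mul, integral_add i1 i2, e2, key g hg]
    ring

/-- Normal vectors at `γ` act on odd curves through a bounded multiple of `γ'`. -/
theorem exists_inner_toL2_eq_of_mem_orthogonal (hγ : MemArcSpace (m + 2) γ) (hm : 1 ≤ m)
    {h : ArcL2 N} (hh : h ∈ (tangentL2 m γ)ᗮ) :
    ∃ τ : ℝ → ℝ, ∃ C, AEStronglyMeasurable τ arcMeas ∧ (∀ s ∈ arcI, |τ s| ≤ C) ∧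
      ∀ g, IsOddArc g →
        inner ℝ (toL2 g) h = ∫ x, τ x * inner ℝ (deriv γ x) (deriv g x) ∂arcMeas := by
  obtain ⟨H, C, hHm, hHC, hHe, hH⟩ := exists_inner_toL2_eq_integral h
  have hγo := hγ.isOddArc (by omega)
  have hνm : AEStronglyMeasurable (deriv γ) arcMeas := hγo.integrable.1
  have hτm : AEStronglyMeasurable (fun s => (inner ℝ (H s) (deriv γ s) : ℝ)) arcMeas :=
    hHm.inner hνm
  have hKb : ∀ s ∈ arcI, ‖orthField (deriv γ) H s‖ ≤ C := fun s hs =>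
    (norm_orthField_le (hγ.2 s hs)).trans (hHC s)
  have hKi : Integrable (orthField (deriv γ) H) arcMeas :=
    (MemLp.of_bound (p := 1) (hHm.sub (hτm.smul hνm)) C (forall_ae_arcMeas hKb)).integrable le_rfl
  -- Normality tests H against the fields orthogonal to γ' that come from even bump fields. Since H
  -- and γ' are even, this is enough to make the component of H orthogonal to γ' vanish, leaving τ =
  -- ⟨H, γ'⟩.
  have hK : orthField (deriv γ) H =ᵐ[arcMeas] 0 := by
    refine ae_eq_zero_of_forall_test (IntegrableOn.locallyIntegrableOn hKi) fun φ h1 h2 h3 => ?_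
    obtain ⟨B, hB⟩ := h2.exists_bound_of_continuous h1.continuous
    have hφK : Integrable (fun s => φ s • orthField (deriv γ) H s) arcMeas :=
      hKi.bdd_smul B h1.continuous.aestronglyMeasurable (Eventually.of_forall hB)
    have hφK' : Integrable (fun s => φ (-s) • orthField (deriv γ) H s) arcMeas :=
      hKi.bdd_smul B (h1.continuous.comp continuous_neg).aestronglyMeasurable
        (Eventually.of_forall fun s => hB (-s))
    refine ext_inner_left ℝ fun e => ?_
    rw [inner_zero_right, ← integral_inner hφK]
    set p : ℝ → Amb N := fun s => (φ s + φ (-s)) • e with hp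
    have hpb : IsBumpField ⊤ p := by
      refine ⟨(h1.add (h1.comp contDiff_neg)).smul contDiff_const, ?_, ?_, fun s => by
        simp [hp, add_comm]⟩
      · exact (h2.add (h2.comp_homeomorph (Homeomorph.neg ℝ))).smul_right
      · refine (tsupport_smul_subset_left (fun s => φ s + φ (-s)) _).trans
          ((tsupport_add φ fun s => φ (-s)).trans (union_subset h3 fun s hs => ?_))
        have := h3 (tsupport_comp_subset_preimage φ continuous_neg hs)
        simpa using neg_mem_arcI this
    have hpm : IsBumpField m p := hpb.of_le le_top
    have hb := hpm.orthField (hγ.1.contDiffOn_deriv le_rfl) (fun s hs => hγo.deriv_neg hs)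
    have ht := hpm.memTangent (hγ.1.contDiffOn_deriv le_rfl) (fun s hs => hγo.deriv_neg hs) hγ.2
    have h0 := mem_orthogonal_tangentL2.1 hh _ ht
    rw [hH _ (hb.isOddArc hm), deriv_primCurve hb.contDiff.continuous] at h0
    have e1 : ∀ s, (inner ℝ (orthField (deriv γ) p s) (H s) : ℝ) =
        inner ℝ e (φ s • orthField (deriv γ) H s) +
          inner ℝ e (φ (-s) • orthField (deriv γ) H s) := fun s => by
      simp only [orthField, hp, inner_sub_left, inner_sub_right, real_inner_smul_left,
        real_inner_smul_right, real_inner_comm (H s) (deriv γ s)]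
      ring
    simp only [e1] at h0
    rw [integral_add (hφK.const_inner e) (hφK'.const_inner e)] at h0
    have e2 : ∫ s, inner ℝ e (φ (-s) • orthField (deriv γ) H s) ∂arcMeas =
        ∫ s, inner ℝ e (φ s • orthField (deriv γ) H s) ∂arcMeas := by
      rw [← measurePreserving_neg_arcMeas.integral_comp (MeasurableEquiv.neg ℝ).measurableEmbedding
        (fun s => (inner ℝ e (φ s • orthField (deriv γ) H s) : ℝ))]
      refine integral_congr_ae (forall_ae_arcMeas fun s hs => ?_)
      simp only [orthField, hHe, hγo.deriv_neg hs]
    rw [e2] at h0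
    linarith
  refine ⟨fun s => inner ℝ (H s) (deriv γ s), C, hτm, fun s hs => ?_, fun g hg => ?_⟩
  · refine (abs_real_inner_le_norm _ _).trans ?_
    rw [hγ.2 s hs, mul_one]; exact hHC s
  · rw [hH g hg]
    refine integral_congr_ae ?_
    filter_upwards [hK] with s hs
    have : H s = (inner ℝ (H s) (deriv γ s) : ℝ) • deriv γ s := sub_eq_zero.1 hs
    conv_lhs => rw [this]
    rw [inner_smul_right, real_inner_comm (deriv g s)]

end Normal

/-! ### The weak equation characterising the second fundamental form -/

section SecondFundamentalForm

variable {N m : ℕ} {γ u v : ℝ → Amb N}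

/-- The bilinear form `∫ τ ⟨f, g⟩` on `L²` for bounded `τ`. -/
theorem exists_weightedInner {τ : ℝ → ℝ} {C : ℝ} (hτ : AEStronglyMeasurable τ arcMeas)
    (hC : ∀ s ∈ arcI, |τ s| ≤ C) :
    ∃ B : ArcL2 N →L[ℝ] ArcL2 N →L[ℝ] ℝ, ∀ f g : ℝ → Amb N, MemLp f 2 arcMeas →
      MemLp g 2 arcMeas → B (toL2 f) (toL2 g) = ∫ s, τ s * inner ℝ (f s) (g s) ∂arcMeas := by
  have hi : ∀ f g : ArcL2 N, Integrable (fun s => τ s * inner ℝ (f s) (g s)) arcMeas :=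
    fun f g => (L2.integrable_inner f g).bdd_mul hτ (forall_ae_arcMeas hC)
  let b : ArcL2 N →ₗ[ℝ] ArcL2 N →ₗ[ℝ] ℝ := LinearMap.mk₂ ℝ
    (fun f g => ∫ s, τ s * inner ℝ (f s) (g s) ∂arcMeas)
    (fun f f' g => by
      rw [← integral_add (hi f g) (hi f' g)]
      refine integral_congr_ae ?_
      filter_upwards [Lp.coeFn_add f f'] with s hs
      rw [hs, Pi.add_apply, inner_add_left]; ring)
    (fun c f g => by
      rw [smul_eq_mul, ← integral_const_mul]
      refine integral_congr_ae ?_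
      filter_upwards [Lp.coeFn_smul c f] with s hs
      rw [hs, Pi.smul_apply, real_inner_smul_left]; ring)
    (fun f g g' => by
      rw [← integral_add (hi f g) (hi f g')]
      refine integral_congr_ae ?_
      filter_upwards [Lp.coeFn_add g g'] with s hs
      rw [hs, Pi.add_apply, inner_add_right]; ring)
    (fun c f g => by
      rw [smul_eq_mul, ← integral_const_mul]
      refine integral_congr_ae ?_
      filter_upwards [Lp.coeFn_smul c g] with s hs
      rw [hs, Pi.smul_apply, real_inner_smul_right]; ring)
  have hCn : 0 ≤ C := (abs_nonneg _).trans (hC 0 zero_mem_arcI)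
  refine ⟨b.mkContinuous₂ C fun f g => ?_, fun f g hf hg => ?_⟩
  · have hf := Lp.memLp f
    have hg := Lp.memLp g
    have h1 : ‖b f g‖ ≤ ∫ s, C * (‖f s‖ * ‖g s‖) ∂arcMeas := by
      refine norm_integral_le_of_norm_le
        ((MemLp.integrable_mul (p := 2) (q := 2) hf.norm hg.norm).const_mul C)
        (forall_ae_arcMeas fun s hs => ?_)
      rw [norm_mul]
      exact mul_le_mul (hC s hs) (norm_inner_le_norm _ _) (norm_nonneg _) hCn
    rw [integral_const_mul] at h1
    have h2 := integral_norm_mul_norm_le hf hg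
    rw [toL2_eq hf, toL2_eq hg, Lp.toLp_coeFn, Lp.toLp_coeFn] at h2
    rw [mul_assoc]
    exact h1.trans (mul_le_mul_of_nonneg_left h2 hCn)
  · rw [LinearMap.mkContinuous₂_apply]
    refine integral_congr_ae ?_
    filter_upwards [coeFn_toL2 hf, coeFn_toL2 hg] with s h1 h2
    rw [h1, h2]

/-- In the product rule the term containing b' is multiplied by a(0) = 0, so b need only be
continuous. This is why V' is required to be continuous, and not differentiable, in L². -/
theorem hasDerivAt_bilin_zero {E F : Type*} [NormedAddCommGroup E] [NormedSpace ℝ E]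
    [NormedAddCommGroup F] [NormedSpace ℝ F] (B : E →L[ℝ] F →L[ℝ] ℝ) {a : ℝ → E} {a' : E}
    {b : ℝ → F} (ha : HasDerivAt a a' 0) (h0 : a 0 = 0) (hb : ContinuousAt b 0) :
    HasDerivAt (fun t => B (a t) (b t)) (B a' (b 0)) 0 := by
  rw [hasDerivAt_iff_tendsto_slope_zero] at ha ⊢
  have h1 : Tendsto (fun t => (t⁻¹ • (a (0 + t) - a 0), b t)) (𝓝[≠] 0) (𝓝 (a', b 0)) :=
    ha.prodMk_nhds (hb.tendsto.mono_left nhdsWithin_le_nhds)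
  refine ((B.continuous₂.tendsto (a', b 0)).comp h1).congr fun t => ?_
  simp [h0]

/-- The pairing of normal vectors with the ambient derivative of a tangent field. -/
theorem IsFieldAlong.inner_eq (hm : 2 ≤ m) (hγ : MemArcSpace (m + 2) γ) (hu : MemTangent m γ u)
    (hv : MemTangent m γ v) {η V : ℝ → ℝ → Amb N} {z : ArcL2 N} (hf : IsFieldAlong m γ u v η V z)
    {h : ArcL2 N} {τ : ℝ → ℝ} {C : ℝ} (hτ : AEStronglyMeasurable τ arcMeas)
    (hC : ∀ s ∈ arcI, |τ s| ≤ C) (hh : ∀ g, IsOddArc g →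
        inner ℝ (toL2 g) h = ∫ x, τ x * inner ℝ (deriv γ x) (deriv g x) ∂arcMeas) :
    inner ℝ z h = -∫ x, τ x * inner ℝ (deriv u x) (deriv v x) ∂arcMeas := by
  obtain ⟨B, hB⟩ := exists_weightedInner (N := N) hτ hC
  have hν2 : MemLp (deriv γ) 2 arcMeas := hγ.1.memLp_deriv (by omega)
  have h1 : HasDerivAt (fun t => (inner ℝ (toL2 (V t)) h : ℝ)) (inner ℝ z h) 0 := by
    simpa using hf.field_deriv.inner ℝ (hasDerivAt_const (0 : ℝ) h)
  -- Tangency gives ⟨γ', V'⟩ = -⟨η' - γ', V'⟩, and the first factor on the right vanishes at t = 0.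
  have h2 : HasDerivAt (fun t => -B (toL2 (deriv (η t)) - toL2 (deriv γ)) (toL2 (deriv (V t))))
      (-B (toL2 (deriv u)) (toL2 (deriv v))) 0 := by
    have := (hasDerivAt_bilin_zero B (hf.velocity_deriv.sub_const (toL2 (deriv γ)))
      (by rw [hf.base, sub_self]) hf.field_cont).neg
    rwa [hf.init] at this
  have h3 : (fun t => (inner ℝ (toL2 (V t)) h : ℝ)) =ᶠ[𝓝 0]
      fun t => -B (toL2 (deriv (η t)) - toL2 (deriv γ)) (toL2 (deriv (V t))) := by
    filter_upwards [hf.arc, hf.tangent] with t ht1 ht2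
    have hη2 : MemLp (deriv (η t)) 2 arcMeas := ht1.1.memLp_deriv hm
    have hV2 : MemLp (deriv (V t)) 2 arcMeas := ht2.1.memLp_deriv hm
    rw [hh _ (ht2.isOddArc hm), ← toL2_sub hη2 hν2, hB (fun s => deriv (η t) s - deriv γ s) _
      (hη2.sub hν2) hV2, ← integral_neg]
    refine integral_congr_ae (forall_ae_arcMeas fun s hs => ?_)
    have := ht2.2 s hs
    rw [real_inner_comm] at this
    simp only [inner_sub_left, this]
    ring
  have h4 := h1.unique (h2.congr_of_eventuallyEq h3)
  rw [h4, hB _ _ (hu.1.memLp_deriv hm) (hv.1.memLp_deriv hm)]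

/-- An odd normal curve `n` with `⟨γ', n'⟩ = -⟨u', v'⟩` is the second fundamental form `S(u,v)`. -/
theorem hasSecondFundForm_of_isOddArc (hm : 2 ≤ m) (hγ : MemArcSpace (m + 2) γ)
    (hu : MemTangent m γ u) (hv : MemTangent m γ v) {n : ℝ → Amb N} (hn : IsOddArc n)
    (hn' : ∀ s ∈ arcI, inner ℝ (deriv γ s) (deriv n s) = -inner ℝ (deriv u s) (deriv v s))
    (hperp : toL2 n ∈ (tangentL2 m γ)ᗮ) : HasSecondFundForm m γ u v (toL2 n) := by
  refine ⟨exists_isFieldAlong hm hγ hu hv, fun η V z hf => ?_⟩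
  -- Every normal vector pairs with z and with n to the same value -∫ τ⟨u', v'⟩, so z - n lies in
  -- the double orthogonal complement, which is the closed tangent space itself. With n normal, n is
  -- then the normal part of z.
  have hmem : z - toL2 n ∈ tangentL2 m γ := by
    rw [← Submodule.orthogonal_orthogonal (tangentL2 m γ), Submodule.mem_orthogonal']
    intro h hh
    obtain ⟨τ, C, h1, h2, h3⟩ := exists_inner_toL2_eq_of_mem_orthogonal hγ (by omega) hh
    rw [inner_sub_left, hf.inner_eq hm hγ hu hv h1 h2 h3, h3 n hn, sub_eq_zero, ← integral_neg]
    refine integral_congr_ae (forall_ae_arcMeas fun s hs => ?_)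
    simp only [hn' s hs]; ring
  rw [tangentProj_apply, Submodule.eq_starProjection_of_mem_orthogonal hmem (by simpa using hperp)]
  abel

end SecondFundamentalForm

/-! ### The solution of z'' = qz vanishing at 1 -/

section DirichletSolution

/-- Even nonnegative integrable potentials that are continuous in `(-1,1)` and vanish elsewhere. -/
structure IsPotential (q : ℝ → ℝ) : Prop where
  continuousOn : ContinuousOn q arcI
  nonneg : ∀ s, 0 ≤ q s
  even : ∀ s, q (-s) = q s
  eq_zero : ∀ s, s ∉ arcI → q s = 0
  integrable : Integrable q

/-- `z'' = q z`, `z(1) = 0`, `z'(1) = -1`, where `R = -z'`. -/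
structure IsDirichletSol (q z R : ℝ → ℝ) : Prop where
  continuous_R : Continuous R
  hasDerivAt_z : ∀ s, HasDerivAt z (-R s) s
  hasDerivAt_R : ∀ s ∈ arcI, HasDerivAt R (-(q s * z s)) s
  z_one : z 1 = 0
  R_one : R 1 = 1
  nonneg : ∀ s ∈ Icc (-1 : ℝ) 1, 0 ≤ z s
  R_eq : ∀ s, R s = 1 + ∫ x in s..1, q x * z x

theorem IsPotential.integrable_mul {q : ℝ → ℝ} (hq : IsPotential q) {f : ℝ → ℝ}
    (hf : Continuous f) : Integrable fun s => q s * f s := by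
  obtain ⟨C, hC⟩ := isCompact_Icc.exists_bound_of_continuousOn
    (s := Icc (-1 : ℝ) 1) hf.continuousOn
  refine (hq.integrable.mul_const C).mono' (hq.integrable.1.mul hf.aestronglyMeasurable)
    (Eventually.of_forall fun s => ?_)
  rw [norm_mul, Real.norm_of_nonneg (hq.nonneg s)]
  by_cases hs : s ∈ arcI
  · exact mul_le_mul_of_nonneg_left (hC s ⟨hs.1.le, hs.2.le⟩) (hq.nonneg s)
  · simp [hq.eq_zero s hs]

theorem continuous_integral_to_one {f : ℝ → ℝ} (hf : Integrable f) :
    Continuous fun s => ∫ x in s..1, f x := by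
  have := (hf.continuous_primitive 1).neg
  refine this.congr fun s => ?_
  rw [intervalIntegral.integral_symm 1 s]; rfl

theorem hasDerivAt_integral_to_one {f : ℝ → ℝ} (hf : Integrable f) {s : ℝ}
    (hm : StronglyMeasurableAtFilter f (𝓝 s)) (hc : ContinuousAt f s) :
    HasDerivAt (fun s => ∫ x in s..1, f x) (-f s) s :=
  intervalIntegral.integral_hasDerivAt_left hf.intervalIntegrable hm hc

/-- Contraction principle for z(s) = ∫_s^1 (1 + ∫_y^1 q z) dy, with unknown ζ = z/w in C([-1,1]).
The weight w makes the map contracting on the whole interval, however large q may be. -/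
theorem IsPotential.exists_isDirichletSol {q : ℝ → ℝ} (hq : IsPotential q) :
    ∃ z R, IsDirichletSol q z R := by
  set Φ : ℝ → ℝ := fun s => ∫ x in s..1, q x with hΦ
  have hΦc : Continuous Φ := continuous_integral_to_one hq.integrable
  have hΦd : ∀ s ∈ arcI, HasDerivAt Φ (-q s) s := fun s hs =>
    hasDerivAt_integral_to_one hq.integrable
      (hq.continuousOn.stronglyMeasurableAtFilter isOpen_Ioo s hs)
      (hq.continuousOn.continuousAt (arcI_mem_nhds hs))
  have hΦa : Antitone Φ := by
    intro a b hab
    have h := intervalIntegral.integral_add_adjacent_intervals (a := a) (b := b) (c := 1)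
      hq.integrable.intervalIntegrable (hq.integrable.intervalIntegrable (μ := volume))
    have h2 := intervalIntegral.integral_nonneg_of_forall (μ := volume) hab hq.nonneg
    simp only [hΦ]
    linarith
  -- As w' = -4qw, the inner integral of qw is at most w/4. The outer one is over length at most 2,
  -- so the contraction constant is 1/2.
  set w : ℝ → ℝ := fun s => Real.exp (4 * Φ s) with hw
  have hwc : Continuous w := by fun_prop
  have hw0 : ∀ s, 0 < w s := fun s => Real.exp_pos _
  have hwa : Antitone w := fun a b hab => Real.exp_le_exp.2 (by linarith [hΦa hab])
  have hwi : ∀ y ∈ Icc (-1 : ℝ) 1, ∫ x in y..1, q x * w x ≤ w y / 4 := by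
    intro y hy
    have h := intervalIntegral.integral_eq_sub_of_hasDerivAt_of_le hy.2
      (f := fun s => -(w s / 4)) (f' := fun s => q s * w s) (by fun_prop) (fun x hx => by
        have h1 := (((hΦd x ⟨hy.1.trans_lt hx.1, hx.2⟩).const_mul 4).exp.div_const 4).neg
        refine h1.congr_deriv ?_
        simp only [hw]; ring) (hq.integrable_mul hwc).intervalIntegrable
    rw [h]
    have := hw0 1
    linarith
  let X := C(Icc (-1 : ℝ) 1, ℝ)
  let ext : X → ℝ → ℝ := fun ζ => IccExtend (by norm_num : (-1 : ℝ) ≤ 1) ζ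
  have hext : ∀ ζ, Continuous (ext ζ) := fun ζ => ζ.continuous.Icc_extend'
  have hextm : ∀ (ζ : X) (s : Icc (-1 : ℝ) 1), ext ζ s = ζ s := fun ζ s => IccExtend_val _ _ s
  let Rf : X → ℝ → ℝ := fun ζ y => 1 + ∫ x in y..1, q x * (w x * ext ζ x)
  have hRi : ∀ ζ, Integrable fun x => q x * (w x * ext ζ x) := fun ζ =>
    hq.integrable_mul (hwc.mul (hext ζ))
  have hRc : ∀ ζ, Continuous (Rf ζ) := fun ζ =>
    continuous_const.add (continuous_integral_to_one (hRi ζ))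
  let zf : X → ℝ → ℝ := fun ζ s => ∫ y in s..1, Rf ζ y
  have hzd : ∀ ζ s, HasDerivAt (zf ζ) (-Rf ζ s) s := fun ζ s =>
    intervalIntegral.integral_hasDerivAt_left ((hRc ζ).intervalIntegrable _ _)
      ((hRc ζ).stronglyMeasurableAtFilter _ _) (hRc ζ).continuousAt
  have hzc : ∀ ζ, Continuous (zf ζ) := fun ζ =>
    continuous_iff_continuousAt.2 fun s => (hzd ζ s).continuousAt
  let T : X → X := fun ζ => ⟨fun s => (w s)⁻¹ * zf ζ s,
    ((hwc.inv₀ fun s => (hw0 s).ne').mul (hzc ζ)).comp continuous_subtype_val⟩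
  have hT : ContractingWith (1 / 2) T := by
    refine ⟨by rw [← NNReal.coe_lt_coe]; norm_num, LipschitzWith.of_dist_le_mul fun ζ ξ => ?_⟩
    rw [ContinuousMap.dist_le (by positivity)]
    intro s
    have h1 : ∀ y ∈ Icc (s : ℝ) 1, |Rf ζ y - Rf ξ y| ≤ dist ζ ξ * (w s / 4) := by
      intro y hy
      have hy' : y ∈ Icc (-1 : ℝ) 1 := ⟨s.2.1.trans hy.1, hy.2⟩
      have e : Rf ζ y - Rf ξ y = ∫ x in y..1, q x * (w x * (ext ζ x - ext ξ x)) := by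
        simp only [Rf]
        rw [add_sub_add_left_eq_sub, ← intervalIntegral.integral_sub
          (hRi ζ).intervalIntegrable (hRi ξ).intervalIntegrable]
        congr 1; ext x; ring
      rw [e, ← Real.norm_eq_abs]
      calc _ ≤ ∫ x in y..1, dist ζ ξ * (q x * w x) := by
            refine intervalIntegral.norm_integral_le_of_norm_le hy.2
              (Eventually.of_forall fun x hx => ?_)
              ((hq.integrable_mul hwc).intervalIntegrable.const_mul _)
            have hx' : x ∈ Icc (-1 : ℝ) 1 := ⟨hy'.1.trans hx.1.le, hx.2⟩
            have h2 : |ext ζ x - ext ξ x| ≤ dist ζ ξ := by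
              rw [hextm ζ ⟨x, hx'⟩, hextm ξ ⟨x, hx'⟩, ← Real.dist_eq]
              exact ContinuousMap.dist_apply_le_dist _
            rw [norm_mul, norm_mul, Real.norm_of_nonneg (hq.nonneg x),
              Real.norm_of_nonneg (hw0 x).le, Real.norm_eq_abs]
            have := mul_le_mul_of_nonneg_left h2 (mul_nonneg (hq.nonneg x) (hw0 x).le)
            linarith
        _ = dist ζ ξ * ∫ x in y..1, q x * w x := by rw [intervalIntegral.integral_const_mul]
        _ ≤ dist ζ ξ * (w y / 4) := mul_le_mul_of_nonneg_left (hwi y hy') dist_nonneg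
        _ ≤ _ := mul_le_mul_of_nonneg_left (by linarith [hwa hy.1]) dist_nonneg
    have h3 : |zf ζ s - zf ξ s| ≤ dist ζ ξ * (w s / 4) * 2 := by
      simp only [zf]
      rw [← intervalIntegral.integral_sub ((hRc ζ).intervalIntegrable _ _)
        ((hRc ξ).intervalIntegrable _ _), ← Real.norm_eq_abs]
      refine (intervalIntegral.norm_integral_le_of_norm_le_const
        (C := dist ζ ξ * (w s / 4)) fun y hy => ?_).trans ?_
      · rw [uIoc_of_le s.2.2] at hy
        exact h1 y ⟨hy.1.le, hy.2⟩
      · refine mul_le_mul_of_nonneg_left ?_ (mul_nonneg dist_nonneg (by linarith [hw0 s]))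
        rw [abs_of_nonneg (by linarith [s.2.2])]; linarith [s.2.1]
    have h4 : dist (T ζ s) (T ξ s) = (w s)⁻¹ * |zf ζ s - zf ξ s| := by
      rw [Real.dist_eq]
      change |(w s)⁻¹ * zf ζ s - (w s)⁻¹ * zf ξ s| = _
      rw [← mul_sub, abs_mul, abs_of_pos (inv_pos.2 (hw0 s))]
    rw [h4, inv_mul_le_iff₀ (hw0 s)]
    refine h3.trans (le_of_eq ?_)
    push_cast; ring
  set ζ : X := hT.fixedPoint T with hζ
  have hfix : T ζ = ζ := hT.fixedPoint_isFixedPt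
  have hzζ : ∀ s ∈ Icc (-1 : ℝ) 1, zf ζ s = w s * ext ζ s := by
    intro s hs
    have h1 : (T ζ) ⟨s, hs⟩ = ζ ⟨s, hs⟩ := by rw [hfix]
    have h2 : (w s)⁻¹ * zf ζ s = ζ ⟨s, hs⟩ := h1
    rw [hextm ζ ⟨s, hs⟩, ← h2, mul_inv_cancel_left₀ (hw0 s).ne']
  -- The map preserves nonnegative functions, and the fixed point is the limit of its iterates
  -- started at 0.
  have hpos : ∀ s, 0 ≤ ζ s := by
    have hstep : ∀ ξ : X, (∀ s, 0 ≤ ξ s) → ∀ s, 0 ≤ T ξ s := by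
      intro ξ hξ s
      have h1 : ∀ x, 0 ≤ q x * (w x * ext ξ x) := fun x =>
        mul_nonneg (hq.nonneg x) (mul_nonneg (hw0 x).le (hξ _))
      have h2 : ∀ y ∈ Icc (s : ℝ) 1, 0 ≤ Rf ξ y := fun y hy =>
        add_nonneg zero_le_one (intervalIntegral.integral_nonneg_of_forall hy.2 h1)
      exact mul_nonneg (inv_nonneg.2 (hw0 s).le) (intervalIntegral.integral_nonneg s.2.2 h2)
    have hit : ∀ n : ℕ, ∀ s, 0 ≤ (T^[n] 0) s := by
      intro n
      induction n with
      | zero => intro s; exact le_rfl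
      | succ n ih => rw [Function.iterate_succ_apply']; exact hstep _ ih
    intro s
    have hlim := hT.tendsto_iterate_fixedPoint (0 : X)
    exact ge_of_tendsto' (((continuous_eval_const s).tendsto _).comp hlim)
      fun n => hit n s
  have hqz : ∀ x, q x * (w x * ext ζ x) = q x * zf ζ x := by
    intro x
    by_cases hx : x ∈ arcI
    · rw [hzζ x ⟨hx.1.le, hx.2.le⟩]
    · simp [hq.eq_zero x hx]
  refine ⟨zf ζ, Rf ζ, hRc ζ, hzd ζ, fun s hs => ?_, by simp [zf], by simp [Rf], fun s hs => ?_,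
    fun s => by simp only [Rf, hqz]⟩
  · have h1 : ContinuousOn (fun x => q x * (w x * ext ζ x)) arcI :=
      hq.continuousOn.mul (hwc.mul (hext ζ)).continuousOn
    have h2 := (hasDerivAt_integral_to_one (hRi ζ)
      (h1.stronglyMeasurableAtFilter isOpen_Ioo s hs)
      (h1.continuousAt (arcI_mem_nhds hs))).const_add 1
    rwa [hqz] at h2
  · rw [hzζ s hs]
    exact mul_nonneg (hw0 s).le (hpos _)

namespace IsDirichletSol

variable {q z R : ℝ → ℝ}

theorem continuous_z (h : IsDirichletSol q z R) : Continuous z :=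
  continuous_iff_continuousAt.2 fun s => (h.hasDerivAt_z s).continuousAt

theorem z_eq (h : IsDirichletSol q z R) (s : ℝ) : z s = ∫ y in s..1, R y := by
  have := intervalIntegral.integral_eq_sub_of_hasDerivAt (a := s) (b := 1)
    (fun x _ => (h.hasDerivAt_z x).neg) (by simpa using h.continuous_R.intervalIntegrable _ _)
  simp only [neg_neg, Pi.neg_apply, h.z_one] at this
  linarith

variable (hq : IsPotential q) (h : IsDirichletSol q z R)
include hq h

theorem q_mul_z_nonneg (s : ℝ) : 0 ≤ q s * z s := by
  by_cases hs : s ∈ arcI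
  · exact mul_nonneg (hq.nonneg s) (h.nonneg s ⟨hs.1.le, hs.2.le⟩)
  · simp [hq.eq_zero s hs]

theorem antitone_R : Antitone R := by
  intro a b hab
  have hi : Integrable fun x => q x * z x := hq.integrable_mul (h.continuous_z)
  have h1 := intervalIntegral.integral_add_adjacent_intervals (a := a) (b := b) (c := 1)
    hi.intervalIntegrable (hi.intervalIntegrable (μ := volume))
  have h2 := intervalIntegral.integral_nonneg_of_forall (μ := volume) hab (h.q_mul_z_nonneg hq)
  rw [h.R_eq, h.R_eq]
  linarith

theorem one_le_R {s : ℝ} (hs : s ≤ 1) : 1 ≤ R s := h.R_one ▸ h.antitone_R hq hs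

theorem one_sub_le_z {s : ℝ} (hs : s ≤ 1) : 1 - s ≤ z s := by
  rw [h.z_eq]
  have := intervalIntegral.integral_mono_on hs (f := fun _ => (1 : ℝ)) (g := R) (μ := volume)
    (by simp) (h.continuous_R.intervalIntegrable _ _) fun x hx => h.one_le_R hq hx.2
  simpa using this

theorem z_le {s : ℝ} (hs : s ≤ 1) : z s ≤ (1 - s) * R s := by
  rw [h.z_eq]
  have := intervalIntegral.integral_mono_on hs (g := fun _ => R s) (f := R) (μ := volume)
    (h.continuous_R.intervalIntegrable _ _) (by simp) fun x hx => h.antitone_R hq hx.1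
  simpa using this

theorem z_pos {s : ℝ} (hs : s < 1) : 0 < z s :=
  (sub_pos.2 hs).trans_le (h.one_sub_le_z hq hs.le)

/-- Evenness of q makes z(-s) a second solution of the same equation; the Wronskian of the two is
constant and is evaluated at 0. -/
theorem wronskian {s : ℝ} (hs : s ∈ arcI) : R (-s) * z s + z (-s) * R s = 2 * z 0 * R 0 := by
  have hd : ∀ s ∈ arcI, HasDerivAt (fun s => R (-s) * z s + z (-s) * R s) 0 s := by
    intro s hs
    have h1 := (h.hasDerivAt_R (-s) (neg_mem_arcI hs)).comp s (hasDerivAt_neg s)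
    have h2 := (h.hasDerivAt_z (-s)).comp s (hasDerivAt_neg s)
    refine ((h1.mul (h.hasDerivAt_z s)).add (h2.mul (h.hasDerivAt_R s hs))).congr_deriv ?_
    simp only [Function.comp, hq.even]
    ring
  have := isOpen_Ioo.is_const_of_deriv_eq_zero isPreconnected_Ioo
    (fun s hs => (hd s hs).differentiableAt.differentiableWithinAt)
    (fun s hs => (hd s hs).deriv) hs zero_mem_arcI
  simp only [neg_zero] at this
  rw [this]; ring

/-- `-z'(0) ≤ e^ϱ`. -/
theorem R_zero_le : R 0 ≤ Real.exp (∫ s in (0 : ℝ)..1, (1 - s) * q s) := by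
  have hi : Integrable fun s => (1 - s) * q s := by
    simpa [mul_comm] using hq.integrable_mul (f := fun s => 1 - s) (by fun_prop)
  set Ψ : ℝ → ℝ := fun s => ∫ x in s..1, (1 - x) * q x with hΨ
  have hΨc : Continuous Ψ := continuous_integral_to_one hi
  have hc : ContinuousOn (fun s => (1 - s) * q s) arcI :=
    (by fun_prop : ContinuousOn (fun s : ℝ => 1 - s) arcI).mul hq.continuousOn
  -- Grönwall: R is decreasing, so z(s) = ∫_s^1 R ≤ (1-s)R(s) and R' = -qz ≥ -(1-s)qR. Comparison
  -- with R(1) = 1 gives the bound.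
  have hm : MonotoneOn (fun s => R s * Real.exp (-Ψ s)) (Icc 0 1) := by
    have hd : ∀ s ∈ Ioo (0 : ℝ) 1, HasDerivAt (fun s => R s * Real.exp (-Ψ s))
        (Real.exp (-Ψ s) * (q s * ((1 - s) * R s - z s))) s := by
      intro s hs
      have hs' : s ∈ arcI := ⟨by linarith [hs.1], hs.2⟩
      have h1 := hasDerivAt_integral_to_one hi (hc.stronglyMeasurableAtFilter isOpen_Ioo s hs')
        (hc.continuousAt (arcI_mem_nhds hs'))
      refine ((h.hasDerivAt_R s hs').mul h1.neg.exp).congr_deriv ?_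
      simp only [hΨ, Pi.neg_apply]
      ring
    refine monotoneOn_of_deriv_nonneg (convex_Icc 0 1)
      (h.continuous_R.mul (Real.continuous_exp.comp hΨc.neg)).continuousOn ?_ ?_
    · rw [interior_Icc]
      exact fun s hs => (hd s hs).differentiableAt.differentiableWithinAt
    · rw [interior_Icc]
      intro s hs
      rw [(hd s hs).deriv]
      exact mul_nonneg (Real.exp_pos _).le (mul_nonneg (hq.nonneg s)
        (sub_nonneg.2 (h.z_le hq hs.2.le)))
  have h2 := hm (left_mem_Icc.2 zero_le_one) (right_mem_Icc.2 zero_le_one) zero_le_one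
  simp only [hΨ, intervalIntegral.integral_same, neg_zero, Real.exp_zero, h.R_one, mul_one] at h2
  rw [Real.exp_neg, ← div_eq_mul_inv, div_le_one (Real.exp_pos _)] at h2
  exact h2

/-- The even function z(x) + z(-x) is increasing on [0,1], because R = -z' is antitone, that is, z
is convex. -/
theorem two_mul_z_zero_le {x : ℝ} (hx : x ∈ Icc (0 : ℝ) 1) : 2 * z 0 ≤ z x + z (-x) := by
  have hd : ∀ s, HasDerivAt (fun s => z s + z (-s)) (R (-s) - R s) s := by
    intro s
    refine ((h.hasDerivAt_z s).add ((h.hasDerivAt_z (-s)).comp s (hasDerivAt_neg s))).congr_deriv ?_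
    ring
  have hm : MonotoneOn (fun s => z s + z (-s)) (Icc 0 1) := by
    refine monotoneOn_of_deriv_nonneg (convex_Icc 0 1)
      (fun s _ => (hd s).continuousAt.continuousWithinAt)
      (fun s _ => (hd s).differentiableAt.differentiableWithinAt) ?_
    rw [interior_Icc]
    intro s hs
    rw [(hd s).deriv]
    exact sub_nonneg.2 (h.antitone_R hq (by linarith [hs.1]))
  have := hm (left_mem_Icc.2 zero_le_one) hx hx.1
  simp only [neg_zero] at this
  linarith

end IsDirichletSol

end DirichletSolution

/-! ### Construction of the Green function and its lower bounds -/

section GreenFunction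

variable {q z R : ℝ → ℝ}

/-- The Green function built from the solution `z` of the Dirichlet problem at `1`. -/
noncomputable def greenFn (z R : ℝ → ℝ) (s x : ℝ) : ℝ :=
  z (-min s x) * z (max s x) / (2 * z 0 * R 0)

theorem greenFn_comm (s x : ℝ) : greenFn z R s x = greenFn z R x s := by
  simp only [greenFn, min_comm, max_comm]

theorem greenFn_neg_neg (s x : ℝ) : greenFn z R (-s) (-x) = greenFn z R s x := by
  simp only [greenFn, min_neg_neg, max_neg_neg, neg_neg]
  ring

theorem greenFn_of_le {s x : ℝ} (h : s ≤ x) :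
    greenFn z R s x = z (-s) * z x / (2 * z 0 * R 0) := by
  simp only [greenFn, min_eq_left h, max_eq_right h]

theorem continuous_greenFn (h : IsDirichletSol q z R) :
    Continuous (Function.uncurry (greenFn z R)) := by
  have := h.continuous_z
  unfold greenFn Function.uncurry
  fun_prop

theorem IsDirichletSol.wronskian_pos (hq : IsPotential q) (h : IsDirichletSol q z R) :
    0 < 2 * z 0 * R 0 := by
  have h1 := h.z_pos hq zero_lt_one
  have h2 := h.one_le_R hq zero_le_one
  positivity

/-- Since z(y) ≥ 1 - y, both factors dominate those for q = 0. Unlike the bound on the even part,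
this one keeps the constant W; it is used only for the unboundedness of K. -/
theorem greenFn_ge (hq : IsPotential q) (h : IsDirichletSol q z R) {s x : ℝ}
    (hs : s ∈ Icc (-1 : ℝ) 1) (hx : x ∈ Icc (-1 : ℝ) 1) :
    (1 + min s x) * (1 - max s x) / (2 * z 0 * R 0) ≤ greenFn z R s x := by
  have h1 := le_min hs.1 hx.1
  have h2 := max_le hs.2 hx.2
  have h3 := h.one_sub_le_z hq (s := -min s x) (by linarith)
  have h4 := h.one_sub_le_z hq h2
  refine div_le_div_of_nonneg_right ?_ (h.wronskian_pos hq).le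
  refine mul_le_mul (by linarith) h4 (by linarith) ?_
  linarith

/-- The even part of the Green function is bounded below. -/
theorem greenFn_add_ge (hq : IsPotential q) (h : IsDirichletSol q z R) {s x : ℝ}
    (hs : s ∈ Icc (-1 : ℝ) 1) (hx : x ∈ Icc (-1 : ℝ) 1) :
    Real.exp (-∫ s in (0 : ℝ)..1, (1 - s) * q s) / 2 * ((1 - s ^ 2) * (1 - x ^ 2)) ≤
      greenFn z R s x + greenFn z R s (-x) := by
  -- For 0 ≤ s ≤ x the sum is (z(s) + z(-s)) z(x)/W ≥ 2z(0)(1-x)/W = (1-x)/R(0) ≥ e^{-ϱ}(1-x), while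
  -- (1-s²)(1-x²) ≤ 2(1-x). The remaining positions of s and x reduce to this one by the symmetries
  -- of G.
  have key : ∀ s x, 0 ≤ s → s ≤ x → x ≤ 1 →
      Real.exp (-∫ s in (0 : ℝ)..1, (1 - s) * q s) / 2 * ((1 - s ^ 2) * (1 - x ^ 2)) ≤
      greenFn z R s x + greenFn z R s (-x) := by
    intro s x h0 hsx hx1
    have hW := h.wronskian_pos hq
    have hz0 := h.z_pos hq zero_lt_one
    have hR0 : 0 < R 0 := zero_lt_one.trans_le (h.one_le_R hq zero_le_one)
    have e : greenFn z R s x + greenFn z R s (-x) = (z s + z (-s)) * z x / (2 * z 0 * R 0) := by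
      rw [greenFn_of_le hsx, greenFn_comm s (-x), greenFn_of_le (by linarith : -x ≤ s)]
      rw [neg_neg]; ring
    have h1 := h.two_mul_z_zero_le hq ⟨h0, hsx.trans hx1⟩
    have h2 := h.one_sub_le_z hq hx1
    have h3 : (1 - x) / R 0 ≤ (z s + z (-s)) * z x / (2 * z 0 * R 0) := by
      rw [div_le_div_iff₀ hR0 hW]
      have : 2 * z 0 * (1 - x) ≤ (z s + z (-s)) * z x :=
        mul_le_mul h1 h2 (by linarith) (by linarith)
      nlinarith
    have h4 : Real.exp (-∫ s in (0 : ℝ)..1, (1 - s) * q s) * (1 - x) ≤ (1 - x) / R 0 := by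
      rw [le_div_iff₀ hR0, Real.exp_neg]
      have := h.R_zero_le hq
      have h5 : (Real.exp (∫ s in (0 : ℝ)..1, (1 - s) * q s))⁻¹ * R 0 ≤ 1 := by
        rw [inv_mul_le_iff₀ (Real.exp_pos _)]; simpa using this
      nlinarith
    rw [e]
    refine le_trans ?_ (h4.trans h3)
    have h6 : (1 - s ^ 2) * (1 - x ^ 2) ≤ 2 * (1 - x) := by
      have a1 : 0 ≤ 1 - x ^ 2 := by nlinarith
      have a2 : (1 - s ^ 2) * (1 - x ^ 2) ≤ 1 * (1 - x ^ 2) :=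
        mul_le_mul_of_nonneg_right (by nlinarith) a1
      nlinarith
    have := Real.exp_pos (-∫ s in (0 : ℝ)..1, (1 - s) * q s)
    nlinarith
  have key2 : ∀ s x, 0 ≤ s → s ≤ 1 → 0 ≤ x → x ≤ 1 →
      Real.exp (-∫ s in (0 : ℝ)..1, (1 - s) * q s) / 2 * ((1 - s ^ 2) * (1 - x ^ 2)) ≤
      greenFn z R s x + greenFn z R s (-x) := by
    intro s x h0 h1 h2 h3
    rcases le_total s x with hsx | hsx
    · exact key s x h0 hsx h3
    · have := key x s h2 hsx h1
      rw [greenFn_comm x s, greenFn_comm x (-s), ← greenFn_neg_neg (-s) x, neg_neg,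
        mul_comm (1 - x ^ 2)] at this
      exact this
  have key3 : ∀ s x, 0 ≤ s → s ≤ 1 → x ∈ Icc (-1 : ℝ) 1 →
      Real.exp (-∫ s in (0 : ℝ)..1, (1 - s) * q s) / 2 * ((1 - s ^ 2) * (1 - x ^ 2)) ≤
      greenFn z R s x + greenFn z R s (-x) := by
    intro s x h0 h1 hx
    rcases le_total 0 x with h2 | h2
    · exact key2 s x h0 h1 h2 hx.2
    · have := key2 s (-x) h0 h1 (by linarith) (by linarith [hx.1])
      rw [neg_neg, neg_sq, add_comm] at this
      exact this
  rcases le_total 0 s with h2 | h2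
  · exact key3 s x h2 hs.2 hx
  · have := key3 (-s) (-x) (by linarith) (by linarith [hs.1])
      ⟨by linarith [hx.2], by linarith [hx.1]⟩
    rwa [neg_sq, neg_sq, greenFn_neg_neg, greenFn_neg_neg] at this

/-- Lagrange's identity: zφ' + Rφ is a primitive of z(φ'' - qφ), because z' = -R and R' = -qz. -/
theorem IsDirichletSol.integral_Icc (hq : IsPotential q) (h : IsDirichletSol q z R) {φ : ℝ → ℝ}
    (hφ : ContDiff ℝ ∞ φ) {a b : ℝ} (hab : a ≤ b) (ha : -1 ≤ a) (hb : b ≤ 1) :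
    ∫ s in a..b, z s * (deriv (deriv φ) s - q s * φ s) =
      (z b * deriv φ b + R b * φ b) - (z a * deriv φ a + R a * φ a) := by
  have h1 : ContDiff ℝ ∞ (deriv φ) := ((contDiff_infty_iff_deriv (𝕜 := ℝ)).1 hφ).2
  have h2 : ContDiff ℝ ∞ (deriv (deriv φ)) := ((contDiff_infty_iff_deriv (𝕜 := ℝ)).1 h1).2
  have hc := h.continuous_z
  have hR := h.continuous_R
  refine intervalIntegral.integral_eq_sub_of_hasDerivAt_of_le hab
    (f := fun s => z s * deriv φ s + R s * φ s)
    ((hc.mul h1.continuous).add (hR.mul hφ.continuous)).continuousOn (fun s hs => ?_) ?_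
  · have d1 := (hφ.differentiable (by simp) s).hasDerivAt
    have d2 := (h1.differentiable (by simp) s).hasDerivAt
    refine (((h.hasDerivAt_z s).mul d2).add
      ((h.hasDerivAt_R s ⟨ha.trans_lt hs.1, hs.2.trans_le hb⟩).mul d1)).congr_deriv ?_
    ring
  · have e : (fun s => z s * (deriv (deriv φ) s - q s * φ s)) =
        fun s => z s * deriv (deriv φ) s - q s * (z s * φ s) := by ext s; ring
    rw [e]
    exact ((hc.mul h2.continuous).intervalIntegrable _ _).sub
      (hq.integrable_mul (hc.mul hφ.continuous)).intervalIntegrable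

/-- G is split at s = x into multiples of z(-s) and of z(s). The φ' boundary terms at x cancel, and
those with φ(x) add up to the Wronskian divided by W. -/
theorem greenFn_weak (hq : IsPotential q) (h : IsDirichletSol q z R) {φ : ℝ → ℝ}
    (hφ : ContDiff ℝ ∞ φ) (hsupp : tsupport φ ⊆ arcI) {x : ℝ} (hx : x ∈ Icc (-1 : ℝ) 1) :
    ∫ s in (-1 : ℝ)..1, greenFn z R s x * (deriv (deriv φ) s - q s * φ s) = -φ x := by
  have hz : ∀ s, s ∉ arcI → φ s = 0 ∧ deriv φ s = 0 := fun s hs =>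
    ⟨image_eq_zero_of_notMem_tsupport fun h' => hs (hsupp h'), image_eq_zero_of_notMem_tsupport
      fun h' => hs (hsupp (tsupport_deriv_subset h'))⟩
  have hφ' : ContDiff ℝ ∞ fun s => φ (-s) := hφ.comp contDiff_neg
  have hd1 : deriv (fun s => φ (-s)) = fun s => -deriv φ (-s) := by
    ext s; rw [deriv_comp_neg]
  have hd2 : deriv (deriv fun s => φ (-s)) = fun s => deriv (deriv φ) (-s) := by
    rw [hd1]; ext s
    rw [deriv.fun_neg, deriv_comp_neg (f := deriv φ), neg_neg]
  have hW := h.wronskian_pos hq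
  have i1 := h.integral_Icc hq hφ hx.2 hx.1 le_rfl
  have i2 := h.integral_Icc hq hφ' (a := -x) (b := 1) (by linarith [hx.1]) (by linarith [hx.2]) le_rfl
  have e2 := intervalIntegral.integral_comp_neg (a := -1) (b := x)
    (fun s => z s * (deriv (deriv fun s => φ (-s)) s - q s * φ (-s)))
  rw [neg_neg] at e2
  rw [← e2] at i2
  simp only [hd2] at i2
  simp only [hd1, neg_neg, hq.even] at i2
  rw [(hz 1 (by simp)).1, (hz 1 (by simp)).2] at i1
  rw [(hz (-1) (by simp)).1, (hz (-1) (by simp)).2] at i2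
  have hc2 : Continuous (deriv (deriv φ)) :=
    ((contDiff_infty_iff_deriv (𝕜 := ℝ)).1 ((contDiff_infty_iff_deriv (𝕜 := ℝ)).1 hφ).2).2.continuous
  have hI : ∀ a b, IntervalIntegrable
      (fun s => greenFn z R s x * (deriv (deriv φ) s - q s * φ s)) volume a b := by
    intro a b
    have hg : Continuous fun s => greenFn z R s x :=
      (continuous_greenFn h).comp (continuous_id.prodMk continuous_const)
    have e : (fun s => greenFn z R s x * (deriv (deriv φ) s - q s * φ s)) =
        fun s => greenFn z R s x * deriv (deriv φ) s - q s * (greenFn z R s x * φ s) := by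
      ext s; ring
    rw [e]
    exact ((hg.mul hc2).intervalIntegrable _ _).sub
      (hq.integrable_mul (hg.mul hφ.continuous)).intervalIntegrable
  rw [← intervalIntegral.integral_add_adjacent_intervals (hI (-1) x) (hI x 1)]
  have e3 : ∫ s in (-1 : ℝ)..x, greenFn z R s x * (deriv (deriv φ) s - q s * φ s) =
      z x / (2 * z 0 * R 0) * ∫ s in (-1 : ℝ)..x, z (-s) * (deriv (deriv φ) s - q s * φ s) := by
    rw [← intervalIntegral.integral_const_mul]
    refine intervalIntegral.integral_congr fun s hs => ?_
    rw [uIcc_of_le hx.1] at hs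
    simp only [greenFn_of_le hs.2]; ring
  have e4 : ∫ s in x..1, greenFn z R s x * (deriv (deriv φ) s - q s * φ s) =
      z (-x) / (2 * z 0 * R 0) * ∫ s in x..1, z s * (deriv (deriv φ) s - q s * φ s) := by
    rw [← intervalIntegral.integral_const_mul]
    refine intervalIntegral.integral_congr fun s hs => ?_
    rw [uIcc_of_le hx.2] at hs
    simp only [greenFn_comm s x, greenFn_of_le hs.1]; ring
  -- The Wronskian identity is available only in the open interval; at x = ±1 both φ and φ' vanish.
  rw [e3, e4, i1, i2]
  by_cases hxI : x ∈ arcI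
  · have hw := h.wronskian hq hxI
    have hφx : φ x = φ x * (R (-x) * z x + z (-x) * R x) / (2 * z 0 * R 0) := by
      rw [hw, mul_div_cancel_right₀ _ hW.ne']
    linear_combination hφx
  · rw [(hz x hxI).1, (hz x hxI).2]; simp

end GreenFunction

/-! ### Test functions and the lemma of du Bois-Reymond -/

section TestFunctions

/-- Test functions on `(-1,1)`. -/
structure IsTest (φ : ℝ → ℝ) : Prop where
  contDiff : ContDiff ℝ ∞ φ
  hasCompactSupport : HasCompactSupport φ
  tsupport_subset : tsupport φ ⊆ arcI

namespace IsTest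

variable {φ ψ : ℝ → ℝ}

theorem deriv (h : IsTest φ) : IsTest (deriv φ) :=
  ⟨((contDiff_infty_iff_deriv (𝕜 := ℝ)).1 h.1).2, h.2.deriv, tsupport_deriv_subset.trans h.3⟩

theorem sub (h : IsTest φ) (h' : IsTest ψ) : IsTest fun s => φ s - ψ s :=
  ⟨h.1.sub h'.1, h.2.sub h'.2, (tsupport_sub φ ψ).trans (union_subset h.3 h'.3)⟩

theorem const_mul (h : IsTest φ) (c : ℝ) : IsTest fun s => c * φ s :=
  ⟨contDiff_const.mul h.1, h.2.mul_left (f := fun _ => c),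
    (tsupport_mul_subset_right (f := fun _ => c) (g := φ)).trans h.3⟩

theorem eq_zero (h : IsTest φ) {s : ℝ} (hs : s ∉ arcI) : φ s = 0 :=
  image_eq_zero_of_notMem_tsupport fun h' => hs (h.3 h')

theorem hasDerivAt (h : IsTest φ) (s : ℝ) : HasDerivAt φ (_root_.deriv φ s) s :=
  (h.1.differentiable (by simp) s).hasDerivAt

theorem integrable_mul (h : IsTest φ) {g : ℝ → ℝ} (hg : Integrable g arcMeas) :
    Integrable (fun s => g s * φ s) arcMeas := by
  obtain ⟨C, hC⟩ := h.2.exists_bound_of_continuous h.1.continuous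
  exact hg.mul_bdd (c := C) h.1.continuous.aestronglyMeasurable (Eventually.of_forall hC)

theorem integral_arcMeas (h : IsTest φ) : ∫ s, φ s ∂arcMeas = ∫ s, φ s :=
  setIntegral_eq_integral_of_forall_compl_eq_zero fun _ hs => h.eq_zero hs

theorem exists_radius (h : IsTest φ) : ∃ r, 0 ≤ r ∧ r < 1 ∧ ∀ s, r < |s| → φ s = 0 := by
  rcases (tsupport φ).eq_empty_or_nonempty with he | hne
  · exact ⟨0, le_rfl, zero_lt_one, fun s _ => image_eq_zero_of_notMem_tsupport (by simp [he])⟩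
  · obtain ⟨x, hx, hmax⟩ := h.2.isCompact.exists_isMaxOn hne continuous_abs.continuousOn
    refine ⟨|x|, abs_nonneg _, abs_lt.2 (h.3 hx), fun s hs => ?_⟩
    exact image_eq_zero_of_notMem_tsupport fun h' => absurd (hmax h') (not_le.2 hs)

/-- A test function with vanishing integral is the derivative of a test function. -/
theorem exists_deriv_eq (h : IsTest φ) (h0 : ∫ s, φ s = 0) : ∃ ψ, IsTest ψ ∧ _root_.deriv ψ = φ := by
  obtain ⟨r, hr0, hr1, hr⟩ := h.exists_radius
  have hi : Integrable φ := h.1.continuous.integrable_of_hasCompactSupport h.2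
  have hd : ∀ s, HasDerivAt (fun s => ∫ x in Iic s, φ x) (φ s) s := by
    intro s
    have e : (fun s => ∫ x in Iic s, φ x) = fun s => (∫ x in Iic 0, φ x) + ∫ x in (0 : ℝ)..s, φ x := by
      ext s
      rw [← intervalIntegral.integral_Iic_sub_Iic hi.integrableOn hi.integrableOn]; ring
    rw [e]
    exact (intervalIntegral.integral_hasDerivAt_right hi.intervalIntegrable
      (h.1.continuous.stronglyMeasurableAtFilter _ _) h.1.continuous.continuousAt).const_add _
  have hd' : _root_.deriv (fun s => ∫ x in Iic s, φ x) = φ := funext fun s => (hd s).deriv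
  have hsub : tsupport (fun s => ∫ x in Iic s, φ x) ⊆ Icc (-r) r := by
    refine closure_minimal (fun s hs => ?_) isClosed_Icc
    by_contra hs'
    apply hs
    simp only
    rcases lt_or_ge s (-r) with h1 | h1
    · refine setIntegral_eq_zero_of_forall_eq_zero fun x hx => hr x ?_
      rw [abs_of_neg (by linarith [mem_Iic.1 hx])]; linarith [mem_Iic.1 hx]
    · have h2 : r < s := by
        by_contra h2; exact hs' ⟨h1, not_lt.1 h2⟩
      rw [setIntegral_eq_integral_of_forall_compl_eq_zero, h0]
      intro x hx
      have : s < x := not_le.1 hx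
      exact hr x (by rw [abs_of_nonneg (by linarith)]; linarith)
  refine ⟨_, ⟨contDiff_infty_iff_deriv.2 ⟨fun s => (hd s).differentiableAt, by
    rw [hd']; exact h.1⟩, isCompact_Icc.of_isClosed_subset (isClosed_tsupport _) hsub,
    hsub.trans fun s hs => ⟨by linarith [hs.1], by linarith [hs.2]⟩⟩, hd'⟩

theorem exists_integral_eq_one : ∃ ρ, IsTest ρ ∧ ∫ s, ρ s = 1 := by
  let b : ContDiffBump (0 : ℝ) := ⟨1 / 4, 1 / 2, by norm_num, by norm_num⟩
  refine ⟨b.normed volume, ⟨b.contDiff_normed, b.hasCompactSupport_normed, ?_⟩, b.integral_normed⟩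
  rw [b.tsupport_normed_eq]
  intro s hs
  rw [Real.closedBall_eq_Icc] at hs
  have h1 : (0 : ℝ) - 1 / 2 ≤ s := hs.1
  have h2 : s ≤ 0 + 1 / 2 := hs.2
  constructor <;> linarith

end IsTest

/-- The lemma of du Bois-Reymond. -/
theorem exists_ae_eq_const_of_integral_deriv {g : ℝ → ℝ} (hg : Integrable g arcMeas)
    (h : ∀ φ, IsTest φ → ∫ s, g s * deriv φ s ∂arcMeas = 0) :
    ∃ c : ℝ, ∀ᵐ s ∂arcMeas, g s = c := by
  obtain ⟨ρ, hρ, hρ1⟩ := IsTest.exists_integral_eq_one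
  refine ⟨∫ s, g s * ρ s ∂arcMeas, ?_⟩
  set c := ∫ s, g s * ρ s ∂arcMeas with hc
  have hgc : Integrable (fun s => g s - c) arcMeas := hg.sub (integrable_const c)
  have key : (fun s => g s - c) =ᵐ[arcMeas] 0 := by
    have := isOpen_Ioo.ae_eq_zero_of_integral_contDiff_smul_eq_zero (μ := volume) (U := arcI)
      (f := fun s => g s - c) (IntegrableOn.locallyIntegrableOn hgc) fun φ h1 h2 h3 => ?_
    · exact (ae_restrict_iff' measurableSet_Ioo).2 this
    · have hφ : IsTest φ := ⟨h1, h2, h3⟩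
      have hint : ∀ {k : ℝ → ℝ}, IsTest k → Integrable k := fun hk =>
        hk.1.continuous.integrable_of_hasCompactSupport hk.2
      set I := ∫ s, φ s with hI
      -- Removing the multiple of ρ with the same integral leaves a test function of mean zero,
      -- hence a derivative of a test function.
      have ht := hφ.sub (hρ.const_mul I)
      have h0 : ∫ s, (φ s - I * ρ s) = 0 := by
        rw [integral_sub (hint hφ) ((hint hρ).const_mul I), integral_const_mul, hρ1, mul_one, sub_self]
      obtain ⟨ψ, hψ, hψd⟩ := ht.exists_deriv_eq h0
      have h4 := h ψ hψ
      rw [hψd] at h4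
      have e1 : ∀ s, g s * (φ s - I * ρ s) = g s * φ s - I * (g s * ρ s) := fun s => by ring
      simp only [e1] at h4
      rw [integral_sub (hφ.integrable_mul hg) ((hρ.integrable_mul hg).const_mul I),
        integral_const_mul] at h4
      have e2 : ∫ s, φ s • (g s - c) = ∫ s, (g s * φ s - c * φ s) ∂arcMeas := by
        rw [setIntegral_eq_integral_of_forall_compl_eq_zero]
        · congr 1; ext s; rw [smul_eq_mul]; ring
        · intro s hs; rw [hφ.eq_zero hs]; ring
      rw [e2, integral_sub (hφ.integrable_mul hg) ((hint hφ).restrict.const_mul c),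
        integral_const_mul, hφ.integral_arcMeas]
      linarith
  filter_upwards [key] with s hs
  exact sub_eq_zero.1 hs

theorem integral_mul_deriv_eq_neg {f f' φ : ℝ → ℝ} (hφ : IsTest φ)
    (hf : ContinuousOn f (Icc (-1) 1)) (hd : ∀ s ∈ arcI, HasDerivAt f (f' s) s)
    (hi : Integrable f' arcMeas) :
    ∫ s, f s * deriv φ s ∂arcMeas = -∫ s, f' s * φ s ∂arcMeas := by
  have hfi : Integrable f arcMeas :=
    (hf.integrableOn_Icc (μ := volume)).mono_set Ioo_subset_Icc_self
  have i1 := hφ.deriv.integrable_mul hfi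
  have i2 := hφ.integrable_mul hi
  have h := intervalIntegral.integral_eq_sub_of_hasDerivAt_of_le (by norm_num : (-1 : ℝ) ≤ 1)
    (f := fun s => f s * φ s) (f' := fun s => f' s * φ s + f s * deriv φ s)
    (hf.mul hφ.1.continuous.continuousOn) (fun s hs => (hd s hs).mul (hφ.hasDerivAt s))
    (by
      rw [intervalIntegrable_iff_integrableOn_Ioo_of_le (by norm_num)]
      exact i2.add i1)
  rw [hφ.eq_zero (s := 1) (by simp), hφ.eq_zero (s := -1) (by simp),
    intervalIntegral.integral_of_le (by norm_num), integral_Ioc_eq_integral_Ioo,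
    integral_add i2 i1] at h
  linarith

/-- With φ - (∫φ)ρ = ψ', the hypothesis on ψ gives ∫ gφ' = b∫φ, while ∫ (bs)φ' = -b∫φ. So g + bs
satisfies the first-order criterion and is constant. -/
theorem exists_ae_eq_affine_of_integral_deriv_deriv {g : ℝ → ℝ} (hg : Integrable g arcMeas)
    (h : ∀ φ, IsTest φ → ∫ s, g s * deriv (deriv φ) s ∂arcMeas = 0) :
    ∃ a b : ℝ, ∀ᵐ s ∂arcMeas, g s = a + b * s := by
  obtain ⟨ρ, hρ, hρ1⟩ := IsTest.exists_integral_eq_one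
  set b := ∫ s, g s * deriv ρ s ∂arcMeas with hb
  have hs : Integrable (fun s : ℝ => b * s) arcMeas :=
    ((by fun_prop : Continuous fun s : ℝ => b * s).integrableOn_Icc (μ := volume)).mono_set
      Ioo_subset_Icc_self
  obtain ⟨a, ha⟩ := exists_ae_eq_const_of_integral_deriv (hg.add hs) fun φ hφ => by
    have hint : ∀ {k : ℝ → ℝ}, IsTest k → Integrable k := fun hk =>
      hk.1.continuous.integrable_of_hasCompactSupport hk.2
    set I := ∫ s, φ s with hI
    have ht := hφ.sub (hρ.const_mul I)
    have h0 : ∫ s, (φ s - I * ρ s) = 0 := by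
      rw [integral_sub (hint hφ) ((hint hρ).const_mul I), integral_const_mul, hρ1, mul_one, sub_self]
    obtain ⟨ψ, hψ, hψd⟩ := ht.exists_deriv_eq h0
    have h4 := h ψ hψ
    have hd : deriv (deriv ψ) = fun s => deriv φ s - I * deriv ρ s := by
      rw [hψd]; ext s
      exact ((hφ.hasDerivAt s).sub ((hρ.hasDerivAt s).const_mul I)).deriv
    rw [hd] at h4
    have e1 : ∀ s, g s * (deriv φ s - I * deriv ρ s) = g s * deriv φ s - I * (g s * deriv ρ s) :=
      fun s => by ring
    simp only [e1] at h4
    rw [integral_sub (hφ.deriv.integrable_mul hg) ((hρ.deriv.integrable_mul hg).const_mul I),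
      integral_const_mul] at h4
    have e2 := integral_mul_deriv_eq_neg hφ (f := fun s => b * s) (f' := fun _ => b)
      (by fun_prop) (fun s _ => by simpa using (hasDerivAt_id s).const_mul b) (integrable_const b)
    rw [integral_const_mul, hφ.integral_arcMeas] at e2
    simp only [Pi.add_apply, add_mul]
    rw [integral_add (hφ.deriv.integrable_mul hg) (hφ.deriv.integrable_mul hs), e2]
    linarith
  refine ⟨a, -b, ?_⟩
  filter_upwards [ha] with s hs
  simp only [Pi.add_apply] at hs
  linarith

end TestFunctions

/-! ### Uniqueness for the weak Dirichlet problem -/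

section Uniqueness

/-- Uniqueness for the Dirichlet problem in the sense of distributions. -/
theorem IsPotential.eq_zero_of_weak {q h : ℝ → ℝ} (hq : IsPotential q)
    (hc : ContinuousOn h (Icc (-1) 1)) (h1 : h (-1) = 0) (h2 : h 1 = 0)
    (hw : ∀ φ, IsTest φ → ∫ s, h s * (deriv (deriv φ) s - q s * φ s) ∂arcMeas = 0) :
    ∀ s ∈ Icc (-1 : ℝ) 1, h s = 0 := by
  have hIcc : arcI ⊆ Icc (-1 : ℝ) 1 := Ioo_subset_Icc_self
  have hi : Integrable h arcMeas := (hc.integrableOn_Icc (μ := volume)).mono_set hIcc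
  have hqh : Integrable (fun s => q s * h s) := by
    obtain ⟨C, hC⟩ := isCompact_Icc.exists_bound_of_continuousOn hc
    have hm : AEStronglyMeasurable (fun s => q s * h s) := by
      have e : (fun s => q s * h s) = arcI.indicator fun s => q s * h s := by
        ext s
        by_cases hs : s ∈ arcI
        · rw [indicator_of_mem hs]
        · rw [indicator_of_notMem hs, hq.eq_zero s hs, zero_mul]
      rw [e, aestronglyMeasurable_indicator_iff measurableSet_Ioo]
      exact (hq.continuousOn.mul (hc.mono hIcc)).aestronglyMeasurable measurableSet_Ioo
    refine (hq.integrable.mul_const C).mono' hm (Eventually.of_forall fun s => ?_)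
    rw [norm_mul, Real.norm_of_nonneg (hq.nonneg s)]
    by_cases hs : s ∈ arcI
    · exact mul_le_mul_of_nonneg_left (hC s (hIcc hs)) (hq.nonneg s)
    · simp [hq.eq_zero s hs]
  set P : ℝ → ℝ := fun s => ∫ x in (0 : ℝ)..s, q x * h x with hP
  have hPc : Continuous P := hqh.continuous_primitive 0
  have hPd : ∀ s ∈ arcI, HasDerivAt P (q s * h s) s := fun s hs => by
    have hcs : ContinuousOn (fun s => q s * h s) arcI := hq.continuousOn.mul (hc.mono hIcc)
    exact intervalIntegral.integral_hasDerivAt_right hqh.intervalIntegrable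
      (hcs.stronglyMeasurableAtFilter isOpen_Ioo s hs) (hcs.continuousAt (arcI_mem_nhds hs))
  set Q : ℝ → ℝ := fun s => ∫ x in (0 : ℝ)..s, P x with hQ
  have hQd : ∀ s, HasDerivAt Q (P s) s := fun s =>
    intervalIntegral.integral_hasDerivAt_right (hPc.intervalIntegrable _ _)
      (hPc.stronglyMeasurableAtFilter _ _) hPc.continuousAt
  have hQc : Continuous Q := continuous_iff_continuousAt.2 fun s => (hQd s).continuousAt
  have hci : ∀ {f : ℝ → ℝ}, Continuous f → Integrable f arcMeas := fun hf =>
    (hf.integrableOn_Icc (μ := volume)).mono_set hIcc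
  -- Q is a second primitive of qh, so h - Q has zero second distributional derivative. Therefore h
  -- is affine plus Q, hence C¹ with h' = b + P.
  obtain ⟨a, b, hab⟩ := exists_ae_eq_affine_of_integral_deriv_deriv (hi.sub (hci hQc))
    fun φ hφ => by
      have e1 := integral_mul_deriv_eq_neg hφ.deriv hQc.continuousOn (fun s _ => hQd s) (hci hPc)
      have e2 := integral_mul_deriv_eq_neg hφ hPc.continuousOn hPd hqh.restrict
      have e3 := hw φ hφ
      have e4 : ∀ s, h s * (deriv (deriv φ) s - q s * φ s) =
          h s * deriv (deriv φ) s - q s * h s * φ s := fun s => by ring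
      simp only [e4] at e3
      rw [integral_sub (hφ.deriv.deriv.integrable_mul hi) (hφ.integrable_mul hqh.restrict)] at e3
      simp only [Pi.sub_apply, sub_mul]
      rw [integral_sub (hφ.deriv.deriv.integrable_mul hi)
        (hφ.deriv.deriv.integrable_mul (hci hQc)), e1, e2]
      linarith
  have heq : ∀ s ∈ arcI, h s = a + b * s + Q s := by
    have hE : EqOn h (fun s => a + b * s + Q s) arcI := by
      refine Measure.eqOn_open_of_ae_eq (μ := volume) ?_ isOpen_Ioo (hc.mono hIcc)
        (by fun_prop : Continuous fun s => a + b * s + Q s).continuousOn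
      filter_upwards [hab] with s hs
      simp only [Pi.sub_apply] at hs
      linarith
    exact hE
  have hd : ∀ s ∈ arcI, HasDerivAt h (b + P s) s := fun s hs => by
    have h3 : HasDerivAt (fun s => a + b * s + Q s) (b + P s) s := by
      have := ((hasDerivAt_id' s).const_mul b).const_add a
      rw [mul_one] at this
      exact this.add (hQd s)
    refine h3.congr_of_eventuallyEq ?_
    filter_upwards [arcI_mem_nhds hs] with t ht using heq t ht
  have hprod : ∀ s ∈ arcI, HasDerivAt (fun s => h s * (b + P s))
      ((b + P s) ^ 2 + q s * h s ^ 2) s := fun s hs =>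
    ((hd s hs).mul ((hPd s hs).const_add b)).congr_deriv (by ring)
  -- The energy argument in pointwise form: (hh')' = h'² + qh² ≥ 0, and hh' is zero at both ends,
  -- hence everywhere. This needs no control of h' beyond its formula b + P.
  have hmono : MonotoneOn (fun s => h s * (b + P s)) (Icc (-1) 1) := by
    refine monotoneOn_of_deriv_nonneg (convex_Icc _ _)
      (hc.mul (continuous_const.add hPc).continuousOn) ?_ ?_
    · rw [interior_Icc]
      exact fun s hs => (hprod s hs).differentiableAt.differentiableWithinAt
    · rw [interior_Icc]
      intro s hs
      rw [(hprod s hs).deriv]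
      exact add_nonneg (sq_nonneg _) (mul_nonneg (hq.nonneg s) (sq_nonneg _))
  have hl : (-1 : ℝ) ∈ Icc (-1 : ℝ) 1 := ⟨le_rfl, by norm_num⟩
  have hr : (1 : ℝ) ∈ Icc (-1 : ℝ) 1 := ⟨by norm_num, le_rfl⟩
  have hzero : ∀ s ∈ Icc (-1 : ℝ) 1, h s * (b + P s) = 0 := by
    intro s hs
    have m1 := hmono hl hs hs.1
    have m2 := hmono hs hr hs.2
    simp only [h1, h2, zero_mul] at m1 m2
    exact le_antisymm m2 m1
  have hsq : MonotoneOn (fun s => h s ^ 2) (Icc (-1) 1) := by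
    have hd2 : ∀ s ∈ Ioo (-1 : ℝ) 1, HasDerivAt (fun s => h s ^ 2) 0 s := fun s hs => by
      refine ((hd s hs).pow 2).congr_deriv ?_
      have := hzero s (hIcc hs)
      simp only [Nat.cast_ofNat, Nat.add_one_sub_one, pow_one]
      linarith
    refine monotoneOn_of_deriv_nonneg (convex_Icc _ _) (hc.pow 2) ?_ ?_
    · rw [interior_Icc]
      exact fun s hs => (hd2 s hs).differentiableAt.differentiableWithinAt
    · rw [interior_Icc]
      intro s hs
      rw [(hd2 s hs).deriv]
  intro s hs
  have m2 := hsq hs hr hs.2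
  simp only [h2] at m2
  have : h s ^ 2 = 0 := le_antisymm (by simpa using m2) (sq_nonneg _)
  simpa using this

end Uniqueness

/-! ### Every Green function is the constructed one -/

section GreenCharacterization

variable {N : ℕ} {γ : ℝ → Amb N}

/-- The potential `|γ''|²` of the Green function, extended by zero. -/
noncomputable def curvPotential (γ : ℝ → Amb N) : ℝ → ℝ :=
  arcI.indicator fun s => ‖deriv (deriv γ) s‖ ^ 2

theorem isGreenFunction_greenFn (hq : IsPotential (curvPotential γ)) {z R : ℝ → ℝ}
    (h : IsDirichletSol (curvPotential γ) z R) : IsGreenFunction γ (greenFn z R) := by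
  intro x hx
  refine ⟨((continuous_greenFn h).comp (continuous_id.prodMk continuous_const)).continuousOn,
    ?_, ?_, fun φ h1 h2 h3 => ?_⟩
  · rw [greenFn, min_eq_left hx.1, neg_neg, h.z_one]; simp
  · rw [greenFn, max_eq_left hx.2, h.z_one]; simp
  · rw [← greenFn_weak hq h h1 h3 hx, intervalIntegral.integral_of_le (by norm_num),
      intervalIntegral.integral_of_le (by norm_num), integral_Ioc_eq_integral_Ioo,
      integral_Ioc_eq_integral_Ioo]
    refine setIntegral_congr_fun measurableSet_Ioo fun s hs => ?_
    simp only [curvPotential, indicator_of_mem (show s ∈ arcI from hs)]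

/-- For fixed x the point sources cancel in the difference, which is then a continuous weak solution
of the homogeneous problem with zero boundary values. -/
theorem IsGreenFunction.eq_greenFn (hq : IsPotential (curvPotential γ)) {z R : ℝ → ℝ}
    (h : IsDirichletSol (curvPotential γ) z R) {G : ℝ → ℝ → ℝ} (hG : IsGreenFunction γ G) :
    ∀ s ∈ arcI, ∀ x ∈ arcI, G s x = greenFn z R s x := by
  intro s hs x hx
  have hIcc : arcI ⊆ Icc (-1 : ℝ) 1 := Ioo_subset_Icc_self
  obtain ⟨a1, a2, a3, a4⟩ := hG x (hIcc hx)
  obtain ⟨b1, b2, b3, b4⟩ := isGreenFunction_greenFn hq h x (hIcc hx)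
  have h0 := hq.eq_zero_of_weak (h := fun s => G s x - greenFn z R s x) (a1.sub b1)
    (by rw [a2, b2, sub_self]) (by rw [a3, b3, sub_self]) (fun φ hφ => ?_) s (hIcc hs)
  · exact sub_eq_zero.1 h0
  · have key : ∀ K : ℝ → ℝ, ContinuousOn K (Icc (-1) 1) →
        (∫ s in (-1 : ℝ)..1, K s * (deriv (deriv φ) s - ‖deriv (deriv γ) s‖ ^ 2 * φ s)) = -φ x →
        Integrable (fun s => K s * (deriv (deriv φ) s - curvPotential γ s * φ s)) arcMeas ∧
        ∫ s, K s * (deriv (deriv φ) s - curvPotential γ s * φ s) ∂arcMeas = -φ x := by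
      intro K hK e
      constructor
      · have hKi : Integrable K arcMeas :=
          (hK.integrableOn_Icc (μ := volume)).mono_set hIcc
        obtain ⟨C, hC⟩ := isCompact_Icc.exists_bound_of_continuousOn hK
        have i2 : Integrable (fun s => K s * (curvPotential γ s * φ s)) arcMeas :=
          (hq.integrable_mul hφ.1.continuous).restrict.bdd_mul (c := C) hKi.1
            (forall_ae_arcMeas fun s hs => hC s (hIcc hs))
        refine ((hφ.deriv.deriv.integrable_mul hKi).sub i2).congr
          (Eventually.of_forall fun s => ?_)
        simp only [Pi.sub_apply]; ring
      · rw [← e, intervalIntegral.integral_of_le (by norm_num), integral_Ioc_eq_integral_Ioo]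
        refine setIntegral_congr_fun measurableSet_Ioo fun s hs => ?_
        simp only [curvPotential, indicator_of_mem (show s ∈ arcI from hs)]
    have k1 := key _ a1 (a4 φ hφ.1 hφ.2 hφ.3)
    have k2 := key _ b1 (b4 φ hφ.1 hφ.2 hφ.3)
    simp only [sub_mul]
    rw [integral_sub k1.1 k2.1, k1.2, k2.2, sub_self]

end GreenCharacterization

/-! ### Green potentials of even integrable densities -/

section GreenPotential

/-- `σ` is the even solution of `σ'' = q σ - f`, `σ(±1) = 0`, and `ρ = σ'`. -/
structure IsGreenPotential (q f σ ρ : ℝ → ℝ) : Prop where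
  even : ∀ s, σ (-s) = σ s
  odd : ∀ s, ρ (-s) = -ρ s
  continuous_deriv : Continuous ρ
  hasDerivAt : ∀ s ∈ arcI, HasDerivAt σ (ρ s) s
  hasDerivAt_deriv : ∀ s ∈ arcI, HasDerivAt ρ (q s * σ s - f s) s
  exists_bound : ∃ C, 0 ≤ C ∧ ∀ s ∈ arcI, |σ s| ≤ C * (1 - s ^ 2)

theorem integrable_mul_continuous {f g : ℝ → ℝ} (hf : Integrable f arcMeas) (hg : Continuous g) :
    Integrable (fun s => g s * f s) arcMeas := by
  obtain ⟨C, hC⟩ := isCompact_Icc.exists_bound_of_continuousOn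
    (s := Icc (-1 : ℝ) 1) hg.continuousOn
  exact hf.bdd_mul (c := C) hg.aestronglyMeasurable
    (forall_ae_arcMeas fun s hs => hC s ⟨hs.1.le, hs.2.le⟩)

/-- Variation of constants with the two solutions z(s) and z(-s), rather than differentiation under
the integral against G. The derivative ρ is then visibly continuous up to ±1, which yields the
vanishing rate of σ at the ends. -/
theorem exists_isGreenPotential {q z R : ℝ → ℝ} (hq : IsPotential q) (h : IsDirichletSol q z R)
    {f : ℝ → ℝ} (hf : ContinuousOn f arcI) (hfi : Integrable f arcMeas)
    (hfe : ∀ s ∈ arcI, f (-s) = f s) :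
    ∃ σ ρ, IsGreenPotential q f σ ρ ∧
      ∀ s ∈ arcI, σ s = ∫ x, greenFn z R s x * f x ∂arcMeas := by
  set F : ℝ → ℝ := arcI.indicator f with hF
  have hFf : ∀ s ∈ arcI, F s = f s := fun s hs => indicator_of_mem hs f
  have hF0 : ∀ s, s ∉ arcI → F s = 0 := fun s hs => indicator_of_notMem hs f
  have hFe : ∀ s, F (-s) = F s := by
    intro s
    by_cases hs : s ∈ arcI
    · rw [hFf s hs, hFf _ (neg_mem_arcI hs), hfe s hs]
    · rw [hF0 s hs, hF0 _ fun h' => hs (by simpa using neg_mem_arcI h')]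
  have hzc := h.continuous_z
  have hzF : Integrable (fun x => z x * F x) := by
    have := (integrable_mul_continuous hfi hzc)
    refine (integrable_indicator_iff measurableSet_Ioo).2 this |>.congr (.of_forall fun s => ?_)
    simp only [hF, indicator]; split_ifs <;> simp
  set B : ℝ → ℝ := fun s => ∫ x in s..1, z x * F x with hB
  have hBc : Continuous B := continuous_integral_to_one hzF
  have hBd : ∀ s ∈ arcI, HasDerivAt B (-(z s * f s)) s := fun s hs => by
    have hc : ContinuousOn (fun x => z x * F x) arcI :=
      hzc.continuousOn.mul (hf.congr hFf)
    have := hasDerivAt_integral_to_one hzF (hc.stronglyMeasurableAtFilter isOpen_Ioo s hs)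
      (hc.continuousAt (arcI_mem_nhds hs))
    rwa [hFf s hs] at this
  have hBd' : ∀ s ∈ arcI, HasDerivAt (fun s => B (-s)) (z (-s) * f s) s := fun s hs => by
    refine ((hBd (-s) (neg_mem_arcI hs)).comp s (hasDerivAt_neg s)).congr_deriv ?_
    rw [hfe s hs]; ring
  have hzd' : ∀ s, HasDerivAt (fun s => z (-s)) (R (-s)) s := fun s => by
    refine ((h.hasDerivAt_z (-s)).comp s (hasDerivAt_neg s)).congr_deriv ?_
    ring
  have hRd' : ∀ s ∈ arcI, HasDerivAt (fun s => R (-s)) (q s * z (-s)) s := fun s hs => by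
    refine ((h.hasDerivAt_R (-s) (neg_mem_arcI hs)).comp s (hasDerivAt_neg s)).congr_deriv ?_
    rw [hq.even]; ring
  set W := 2 * z 0 * R 0 with hW
  have hW0 : 0 < W := h.wronskian_pos hq
  -- Since the extended density is even, B(-s) = ∫_{-1}^s z(-x) f(x) dx, so the two terms are the
  -- parts of ∫ G(s,x) f(x) dx over x ≤ s and x ≥ s. In the derivative the terms z(s) z(-s) f(s)
  -- cancel, leaving ρ.
  set σ : ℝ → ℝ := fun s => (z s * B (-s) + z (-s) * B s) / W with hσ
  set ρ : ℝ → ℝ := fun s => (R (-s) * B s - R s * B (-s)) / W with hρ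
  have hRc := h.continuous_R
  have hρc : Continuous ρ := by simp only [hρ]; fun_prop
  have hσc : Continuous σ := by simp only [hσ]; fun_prop
  have hσd : ∀ s ∈ arcI, HasDerivAt σ (ρ s) s := fun s hs => by
    refine ((((h.hasDerivAt_z s).mul (hBd' s hs)).add ((hzd' s).mul (hBd s hs))).div_const
      W).congr_deriv ?_
    simp only [hρ]; ring
  have hσe : ∀ s, σ (-s) = σ s := fun s => by simp only [hσ, neg_neg]; ring
  refine ⟨σ, ρ, ⟨hσe, fun s => by simp only [hρ, neg_neg]; ring, hρc, hσd, fun s hs => ?_, ?_⟩,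
    fun s hs => ?_⟩
  · refine ((((hRd' s hs).mul (hBd s hs)).sub ((h.hasDerivAt_R s hs).mul (hBd' s hs))).div_const
      W).congr_deriv ?_
    have hw := h.wronskian hq hs
    rw [← hW] at hw
    simp only [hσ]
    field_simp
    rw [← hw]; ring
  · obtain ⟨C, hC⟩ := isCompact_Icc.exists_bound_of_continuousOn
      (s := Icc (-1 : ℝ) 1) hρc.continuousOn
    have hC0 : 0 ≤ C := (norm_nonneg _).trans (hC 0 (by constructor <;> norm_num))
    have h1 : σ 1 = 0 := by simp [hσ, hB, h.z_one]
    have key : ∀ s ∈ arcI, |σ s| ≤ C * (1 - s) := fun s hs => by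
      have hi : IntervalIntegrable ρ volume s 1 := hρc.intervalIntegrable _ _
      have e := intervalIntegral.integral_eq_sub_of_hasDerivAt_of_le hs.2.le hσc.continuousOn
        (fun x hx => hσd x ⟨hs.1.trans hx.1, hx.2⟩) hi
      rw [h1, zero_sub] at e
      have := intervalIntegral.norm_integral_le_of_norm_le_const (a := s) (b := 1) (f := ρ) (C := C)
        fun x hx => by
          rw [uIoc_of_le hs.2.le] at hx
          exact hC x ⟨(hs.1.trans hx.1).le, hx.2⟩
      rwa [e, norm_neg, Real.norm_eq_abs, abs_of_nonneg (by linarith [hs.2] : (0 : ℝ) ≤ 1 - s)]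
        at this
    refine ⟨C, hC0, fun s hs => ?_⟩
    rcases le_total 0 s with h0 | h0
    · refine (key s hs).trans (mul_le_mul_of_nonneg_left ?_ hC0)
      nlinarith [hs.2]
    · rw [← hσe]
      refine (key (-s) (neg_mem_arcI hs)).trans (mul_le_mul_of_nonneg_left ?_ hC0)
      nlinarith [hs.1]
  · have hgc : Continuous fun x => greenFn z R s x :=
      (continuous_greenFn h).comp (continuous_const.prodMk continuous_id)
    have hGF : Integrable (fun x => greenFn z R s x * F x) := by
      have := (integrable_mul_continuous hfi hgc)
      refine (integrable_indicator_iff measurableSet_Ioo).2 this |>.congr (.of_forall fun x => ?_)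
      simp only [hF, indicator]; split_ifs <;> simp
    have e1 : ∫ x, greenFn z R s x * f x ∂arcMeas = ∫ x in (-1 : ℝ)..1, greenFn z R s x * F x := by
      rw [intervalIntegral.integral_of_le (by norm_num), integral_Ioc_eq_integral_Ioo]
      refine setIntegral_congr_fun measurableSet_Ioo fun x hx => ?_
      simp only [hFf x hx]
    have e2 : ∫ x in (-1 : ℝ)..s, greenFn z R s x * F x = z s * B (-s) / W := by
      have e3 : B (-s) = ∫ x in (-1 : ℝ)..s, z (-x) * F x := by
        have := intervalIntegral.integral_comp_neg (a := -1) (b := s) (fun x => z x * F x)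
        simp only [neg_neg, hFe] at this
        rw [this]
      rw [e3, ← intervalIntegral.integral_const_mul, ← intervalIntegral.integral_div]
      refine intervalIntegral.integral_congr fun x hx => ?_
      rw [uIcc_of_le hs.1.le] at hx
      simp only [greenFn_comm (s := s), greenFn_of_le hx.2, ← hW]
      ring
    have e4 : ∫ x in s..1, greenFn z R s x * F x = z (-s) * B s / W := by
      rw [hB, ← intervalIntegral.integral_const_mul, ← intervalIntegral.integral_div]
      refine intervalIntegral.integral_congr fun x hx => ?_
      rw [uIcc_of_le hs.2.le] at hx
      simp only [greenFn_of_le hx.1, ← hW]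
      ring
    rw [e1, ← intervalIntegral.integral_add_adjacent_intervals (b := s) hGF.intervalIntegrable
      hGF.intervalIntegrable, e2, e4, ← add_div]

end GreenPotential

/-! ### The normal curves (σγ')' and the second fundamental form -/

section NormalCurve

variable {N m : ℕ} {γ u v : ℝ → Amb N}

theorem MemArcSpace.contDiffOn_deriv_deriv (hγ : MemArcSpace (m + 2) γ) (hm : 2 ≤ m) :
    ContDiffOn ℝ 1 (deriv (deriv γ)) arcI := by
  have h2 : ContDiffOn ℝ (1 + 1) (deriv γ) arcI := by
    rw [one_add_one_eq_two]; exact hγ.1.contDiffOn_deriv (j := 2) (by omega)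
  exact ((contDiffOn_succ_iff_deriv_of_isOpen (n := 1) isOpen_Ioo).1 h2).2.2

theorem MemArcSpace.hasDerivAt_deriv (hγ : MemArcSpace (m + 2) γ) (hm : 2 ≤ m) {s : ℝ}
    (hs : s ∈ arcI) : HasDerivAt (deriv γ) (deriv (deriv γ) s) s ∧
      HasDerivAt (deriv (deriv γ)) (deriv (deriv (deriv γ)) s) s := by
  have h2 : ContDiffOn ℝ 2 (deriv γ) arcI := hγ.1.contDiffOn_deriv (j := 2) (by omega)
  exact ⟨((h2.contDiffAt (arcI_mem_nhds hs)).differentiableAt (by norm_num)).hasDerivAt,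
    (((hγ.contDiffOn_deriv_deriv hm).contDiffAt (arcI_mem_nhds hs)).differentiableAt
      (by norm_num)).hasDerivAt⟩

theorem MemArcSpace.deriv_deriv_neg (hγ : MemArcSpace (m + 2) γ) {s : ℝ}
    (hs : s ∈ arcI) : deriv (deriv γ) (-s) = -deriv (deriv γ) s := by
  have h1 : (fun t => deriv γ (-t)) =ᶠ[𝓝 s] deriv γ := by
    filter_upwards [arcI_mem_nhds hs] with t ht using
      (hγ.isOddArc (by omega)).deriv_neg ht
  have h2 := h1.deriv_eq
  rw [deriv_comp_neg] at h2
  rw [← h2, neg_neg]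

theorem MemArcSpace.isPotential (hγ : MemArcSpace (m + 2) γ) (hm : 2 ≤ m) :
    IsPotential (curvPotential γ) := by
  have hf : ∀ s ∈ arcI, curvPotential γ s = ‖deriv (deriv γ) s‖ ^ 2 := fun s hs =>
    indicator_of_mem hs _
  refine ⟨?_, fun s => indicator_nonneg (fun _ _ => by positivity) s, fun s => ?_,
    fun s hs => indicator_of_notMem hs _, ?_⟩
  · exact ((hγ.contDiffOn_deriv_deriv hm).continuousOn.norm.pow 2).congr hf
  · by_cases hs : s ∈ arcI
    · rw [hf s hs, hf _ (neg_mem_arcI hs), hγ.deriv_deriv_neg hs, norm_neg]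
    · rw [curvPotential, indicator_of_notMem hs,
        indicator_of_notMem fun h' => hs (by simpa using neg_mem_arcI h')]
  · exact (integrable_indicator_iff measurableSet_Ioo).2
      ((hγ.1.memLp_deriv_deriv (by omega)).1.integrable_norm_pow (by norm_num))

/-- Obtained by differentiating |γ'|² = 1 once and then twice; the second identity is the origin of
the potential |γ''|². -/
theorem MemArcSpace.inner_deriv_deriv (hγ : MemArcSpace (m + 2) γ) (hm : 2 ≤ m) {s : ℝ}
    (hs : s ∈ arcI) : inner ℝ (deriv γ s) (deriv (deriv γ) s) = 0 ∧
      inner ℝ (deriv γ s) (deriv (deriv (deriv γ)) s) = -‖deriv (deriv γ) s‖ ^ 2 := by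
  have h0 : ∀ s ∈ arcI, inner ℝ (deriv γ s) (deriv (deriv γ) s) = 0 := fun s hs => by
    have h1 : HasDerivAt (fun t => (inner ℝ (deriv γ t) (deriv γ t) : ℝ)) 0 s := by
      refine (hasDerivAt_const s (1 : ℝ)).congr_of_eventuallyEq ?_
      filter_upwards [arcI_mem_nhds hs] with t ht
      rw [real_inner_self_eq_norm_sq, hγ.2 t ht, one_pow]
    have hd := (hγ.hasDerivAt_deriv hm hs).1
    have h2 := h1.unique (hd.inner ℝ hd)
    rw [real_inner_comm (deriv γ s)] at h2
    linarith [real_inner_comm (deriv γ s) (deriv (deriv γ) s)]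
  refine ⟨h0 s hs, ?_⟩
  have h1 : HasDerivAt (fun t => (inner ℝ (deriv γ t) (deriv (deriv γ) t) : ℝ)) 0 s := by
    refine (hasDerivAt_const s (0 : ℝ)).congr_of_eventuallyEq ?_
    filter_upwards [arcI_mem_nhds hs] with t ht using h0 t ht
  have hd := hγ.hasDerivAt_deriv hm hs
  have h2 := h1.unique (hd.1.inner ℝ hd.2)
  rw [real_inner_self_eq_norm_sq] at h2
  linarith

/-- The normal curve `(σ γ')'`. -/
noncomputable def normalCurve (γ : ℝ → Amb N) (σ ρ : ℝ → ℝ) (s : ℝ) : Amb N :=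
  ρ s • deriv γ s + σ s • deriv (deriv γ) s

variable {f σ ρ : ℝ → ℝ}

theorem hasDerivAt_normalCurve (hγ : MemArcSpace (m + 2) γ) (hm : 2 ≤ m)
    (hσ : IsGreenPotential (curvPotential γ) f σ ρ) {s : ℝ} (hs : s ∈ arcI) :
    HasDerivAt (normalCurve γ σ ρ) ((curvPotential γ s * σ s - f s) • deriv γ s +
      (2 * ρ s) • deriv (deriv γ) s + σ s • deriv (deriv (deriv γ)) s) s := by
  have hd := hγ.hasDerivAt_deriv hm hs
  refine (((hσ.hasDerivAt_deriv s hs).smul hd.1).add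
    ((hσ.hasDerivAt s hs).smul hd.2)).congr_deriv ?_
  rw [two_mul, add_smul]
  abel

theorem inner_deriv_normalCurve (hγ : MemArcSpace (m + 2) γ) (hm : 2 ≤ m)
    (hσ : IsGreenPotential (curvPotential γ) f σ ρ) {s : ℝ} (hs : s ∈ arcI) :
    inner ℝ (deriv γ s) (deriv (normalCurve γ σ ρ) s) = -f s := by
  rw [(hasDerivAt_normalCurve hγ hm hσ hs).deriv]
  have h0 := hγ.inner_deriv_deriv hm hs
  have hq : curvPotential γ s = ‖deriv (deriv γ) s‖ ^ 2 := indicator_of_mem hs _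
  simp only [inner_add_right, inner_smul_right, h0.1, h0.2, real_inner_self_eq_norm_sq,
    hγ.2 s hs, hq]
  ring

/-- The delicate point is integrability of the derivative near ±1, where three terms arise: an
integrable multiple of γ', a bounded multiple of γ'' ∈ L², and σγ'''. -/
theorem isOddArc_normalCurve (hγ : MemArcSpace (m + 2) γ) (hm : 2 ≤ m)
    (hf : ContinuousOn f arcI) (hfi : Integrable f arcMeas)
    (hσ : IsGreenPotential (curvPotential γ) f σ ρ) : IsOddArc (normalCurve γ σ ρ) := by
  have hq := hγ.isPotential hm
  have hd := fun s hs => hasDerivAt_normalCurve hγ hm hσ (s := s) hs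
  have hσc : ContinuousOn σ arcI := fun s hs => (hσ.hasDerivAt s hs).continuousAt.continuousWithinAt
  have c1 : ContinuousOn (deriv γ) arcI := fun s hs =>
    (hγ.hasDerivAt_deriv hm hs).1.continuousAt.continuousWithinAt
  have c2 : ContinuousOn (deriv (deriv γ)) arcI := (hγ.contDiffOn_deriv_deriv hm).continuousOn
  have c3 : ContinuousOn (deriv (deriv (deriv γ))) arcI :=
    (hγ.contDiffOn_deriv_deriv hm).continuousOn_deriv_of_isOpen isOpen_Ioo le_rfl
  have hqc := hq.continuousOn
  have hρc := hσ.continuous_deriv.continuousOn (s := arcI)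
  obtain ⟨C, hC0, hC⟩ := hσ.exists_bound
  obtain ⟨M, hM⟩ := isCompact_Icc.exists_bound_of_continuousOn
    (s := Icc (-1 : ℝ) 1) hσ.continuous_deriv.continuousOn
  have hL := hγ.1.memLp_deriv_deriv (by omega)
  refine ⟨fun s hs => ?_, ?_, ?_⟩
  · simp only [normalCurve, hσ.odd, hσ.even, (hγ.isOddArc (by omega)).deriv_neg hs,
      hγ.deriv_deriv_neg hs]
    simp only [neg_smul, smul_neg]; abel
  · refine (contDiffOn_succ_iff_deriv_of_isOpen (n := 0) isOpen_Ioo).2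
      ⟨fun s hs => (hd s hs).differentiableAt.differentiableWithinAt, by simp, ?_⟩
    refine contDiffOn_zero.2 (ContinuousOn.congr ?_ fun s hs => (hd s hs).deriv)
    exact ((((hqc.mul hσc).sub hf).smul c1).add ((continuousOn_const.mul hρc).smul c2)).add
      (hσc.smul c3)
  · have hγ1 : Integrable (deriv γ) arcMeas := (hγ.1.memLp_deriv (by omega)).integrable (by norm_num)
    have hσm : AEStronglyMeasurable σ arcMeas := hσc.aestronglyMeasurable measurableSet_Ioo
    have i1 : Integrable (fun s => (curvPotential γ s * σ s - f s) • deriv γ s) arcMeas := by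
      have : Integrable (fun s => curvPotential γ s * σ s - f s) arcMeas := by
        refine Integrable.sub ?_ hfi
        refine hq.integrable.restrict.mul_bdd (c := C) hσm (forall_ae_arcMeas fun s hs => ?_)
        refine (hC s hs).trans (mul_le_of_le_one_right hC0 ?_)
        nlinarith [sq_nonneg s]
      refine this.norm.mono' (this.1.smul hγ1.1) (forall_ae_arcMeas fun s hs => ?_)
      rw [norm_smul, hγ.2 s hs, mul_one]
    have i2 : Integrable (fun s => (2 * ρ s) • deriv (deriv γ) s) arcMeas := by
      refine (hL.1.integrable (by norm_num)).bdd_smul (2 * M)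
        (hσ.continuous_deriv.const_mul 2).aestronglyMeasurable
        (forall_ae_arcMeas fun s hs => ?_)
      rw [norm_mul, Real.norm_two]
      exact mul_le_mul_of_nonneg_left (hM s ⟨hs.1.le, hs.2.le⟩) zero_le_two
    -- γ''' is square integrable only with the weight (1-s²)², and the bound |σ| ≤ C(1-s²) supplies
    -- exactly the missing factor.
    have i3 : Integrable (fun s => σ s • deriv (deriv (deriv γ)) s) arcMeas := by
      have hw := memLp_weightMeas_iff.1 hL.2
      have hwL : MemLp (fun s => (1 - s ^ 2) • deriv (deriv (deriv γ)) s) 2 arcMeas := by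
        rw [← weightMeas_zero, memLp_weightMeas_iff]
        have hm' : AEStronglyMeasurable (fun s => (1 - s ^ 2) • deriv (deriv (deriv γ)) s) arcMeas :=
          (by fun_prop : Continuous fun s : ℝ => 1 - s ^ 2).aestronglyMeasurable.smul hw.1
        refine ⟨hm', lt_of_eq_of_lt (lintegral_congr_ae (forall_ae_arcMeas fun s hs => ?_)) hw.2⟩
        have : 0 ≤ 1 - s ^ 2 := by nlinarith [hs.1, hs.2]
        simp only [pow_zero, ENNReal.ofReal_one, one_mul, enorm_smul, mul_pow]
        rw [Real.enorm_of_nonneg this, ENNReal.ofReal_pow this]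
      refine ((hwL.integrable (by norm_num)).norm.const_mul C).mono' (hσm.smul hw.1)
        (forall_ae_arcMeas fun s hs => ?_)
      have : 0 ≤ 1 - s ^ 2 := by nlinarith [hs.1, hs.2]
      rw [norm_smul, norm_smul, ← mul_assoc, Real.norm_of_nonneg this]
      exact mul_le_mul_of_nonneg_right (hC s hs) (norm_nonneg _)
    exact ((i1.add i2).add i3).congr (forall_ae_arcMeas fun s hs => (hd s hs).deriv.symm)

/-- `∫ ⟨(σ γ')', g⟩ = -∫ σ ⟨γ', g'⟩`. -/
theorem inner_toL2_normalCurve (hγ : MemArcSpace (m + 2) γ) (hm : 2 ≤ m)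
    (hf : ContinuousOn f arcI) (hfi : Integrable f arcMeas)
    (hσ : IsGreenPotential (curvPotential γ) f σ ρ) {g : ℝ → Amb N} (hg : IsOddArc g) :
    inner ℝ (toL2 (normalCurve γ σ ρ)) (toL2 g) =
      -∫ s, σ s * inner ℝ (deriv γ s) (deriv g s) ∂arcMeas := by
  have hn := isOddArc_normalCurve hγ hm hf hfi hσ
  obtain ⟨C, hC0, hC⟩ := hσ.exists_bound
  have hσc : ContinuousOn σ arcI := fun s hs => (hσ.hasDerivAt s hs).continuousAt.continuousWithinAt
  have hγ1 : AEStronglyMeasurable (deriv γ) arcMeas := (hγ.1.memLp_deriv (by omega)).1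
  have hd : ∀ s ∈ arcI, HasDerivAt (fun s => σ s * inner ℝ (deriv γ s) (g s))
      (inner ℝ (normalCurve γ σ ρ s) (g s) + σ s * inner ℝ (deriv γ s) (deriv g s)) s := by
    intro s hs
    refine ((hσ.hasDerivAt s hs).mul
      ((hγ.hasDerivAt_deriv hm hs).1.inner ℝ (hg.hasDerivAt hs))).congr_deriv ?_
    simp only [normalCurve, inner_add_left, real_inner_smul_left]
    ring
  have i1 := integrable_inner_of_memLp hn.memLp hg.memLp
  have i2 : Integrable (fun s => σ s * inner ℝ (deriv γ s) (deriv g s)) arcMeas := by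
    refine (hg.integrable.norm.const_mul C).mono' ((hσc.aestronglyMeasurable measurableSet_Ioo).mul
      (hγ1.inner hg.integrable.1)) (forall_ae_arcMeas fun s hs => ?_)
    rw [norm_mul]
    refine mul_le_mul ((hC s hs).trans (mul_le_of_le_one_right hC0 (by nlinarith [sq_nonneg s])))
      ?_ (norm_nonneg _) hC0
    refine (norm_inner_le_norm _ _).trans ?_
    rw [hγ.2 s hs, one_mul]
  have hb : ∀ s ∈ arcI, ‖σ s * inner ℝ (deriv γ s) (g s)‖ ≤
      C * (1 - s ^ 2) * ∫ x, ‖deriv g x‖ ∂arcMeas := fun s hs => by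
    rw [norm_mul]
    refine mul_le_mul (hC s hs) ?_ (norm_nonneg _) ((abs_nonneg _).trans (hC s hs))
    refine (norm_inner_le_norm _ _).trans ?_
    rw [hγ.2 s hs, one_mul]; exact hg.norm_le hs
  have hlim : Continuous fun s : ℝ => C * (1 - s ^ 2) * ∫ x, ‖deriv g x‖ ∂arcMeas := by fun_prop
  -- The boundary terms are limits at ±1: they vanish because σ does and g is bounded, although g
  -- need not be given a value there.
  have key := intervalIntegral.integral_eq_sub_of_hasDerivAt_of_tendsto (a := -1) (b := 1)
    (by norm_num) (fa := 0) (fb := 0) hd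
    ((intervalIntegrable_iff_integrableOn_Ioo_of_le (by norm_num)).2 (i1.add i2)) ?_ ?_
  · rw [intervalIntegral.integral_of_le (by norm_num), integral_Ioc_eq_integral_Ioo,
      integral_add i1 i2, sub_zero] at key
    rw [inner_toL2_toL2 hn.memLp hg.memLp]
    linarith
  · refine squeeze_zero_norm' (a := fun s : ℝ => C * (1 - s ^ 2) * ∫ x, ‖deriv g x‖ ∂arcMeas) ?_ ?_
    · filter_upwards [Ioo_mem_nhdsGT (by norm_num : (-1 : ℝ) < 1)] with s hs using hb s hs
    · simpa using (hlim.tendsto (-1)).mono_left nhdsWithin_le_nhds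
  · refine squeeze_zero_norm' (a := fun s : ℝ => C * (1 - s ^ 2) * ∫ x, ‖deriv g x‖ ∂arcMeas) ?_ ?_
    · filter_upwards [Ioo_mem_nhdsLT (by norm_num : (-1 : ℝ) < 1)] with s hs using hb s hs
    · simpa using (hlim.tendsto 1).mono_left nhdsWithin_le_nhds

theorem toL2_normalCurve_mem_orthogonal (hγ : MemArcSpace (m + 2) γ) (hm : 2 ≤ m)
    (hf : ContinuousOn f arcI) (hfi : Integrable f arcMeas)
    (hσ : IsGreenPotential (curvPotential γ) f σ ρ) :
    toL2 (normalCurve γ σ ρ) ∈ (tangentL2 m γ)ᗮ := by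
  refine mem_orthogonal_tangentL2.2 fun w hw => ?_
  rw [real_inner_comm, inner_toL2_normalCurve hγ hm hf hfi hσ (hw.isOddArc hm), neg_eq_zero]
  refine integral_eq_zero_of_ae (forall_ae_arcMeas fun s hs => ?_)
  simp only [real_inner_comm (deriv w s), hw.2 s hs, mul_zero, Pi.zero_apply]

/-- Integrating by parts against the second normal curve leaves only the γ'-component of its
derivative, which is minus its density. -/
theorem inner_normalCurve_normalCurve (hγ : MemArcSpace (m + 2) γ) (hm : 2 ≤ m)
    (hf : ContinuousOn f arcI) (hfi : Integrable f arcMeas)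
    (hσ : IsGreenPotential (curvPotential γ) f σ ρ) {f' σ' ρ' : ℝ → ℝ}
    (hf' : ContinuousOn f' arcI) (hfi' : Integrable f' arcMeas)
    (hσ' : IsGreenPotential (curvPotential γ) f' σ' ρ') :
    inner ℝ (toL2 (normalCurve γ σ ρ)) (toL2 (normalCurve γ σ' ρ')) =
      ∫ s, σ s * f' s ∂arcMeas := by
  rw [inner_toL2_normalCurve hγ hm hf hfi hσ (isOddArc_normalCurve hγ hm hf' hfi' hσ'),
    ← integral_neg]
  refine integral_congr_ae (forall_ae_arcMeas fun s hs => ?_)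
  simp only [inner_deriv_normalCurve hγ hm hσ' hs]; ring

/-- The second fundamental form `S(u,v)` in terms of the Green function. -/
theorem exists_hasSecondFundForm (hγ : MemArcSpace (m + 2) γ) (hm : 2 ≤ m) (hu : MemTangent m γ u)
    (hv : MemTangent m γ v) {z R : ℝ → ℝ} (h : IsDirichletSol (curvPotential γ) z R) :
    ∃ σ ρ, IsGreenPotential (curvPotential γ) (fun s => inner ℝ (deriv u s) (deriv v s)) σ ρ ∧
      (∀ s ∈ arcI, σ s = ∫ x, greenFn z R s x * inner ℝ (deriv u x) (deriv v x) ∂arcMeas) ∧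
      HasSecondFundForm m γ u v (toL2 (normalCurve γ σ ρ)) := by
  have huo := hu.isOddArc hm
  have hvo := hv.isOddArc hm
  have hf : ContinuousOn (fun s => (inner ℝ (deriv u s) (deriv v s) : ℝ)) arcI :=
    huo.continuousOn_deriv.inner hvo.continuousOn_deriv
  have hfi := integrable_inner_of_memLp (hu.1.memLp_deriv hm) (hv.1.memLp_deriv hm)
  obtain ⟨σ, ρ, h1, h2⟩ := exists_isGreenPotential (hγ.isPotential hm) h hf hfi
    fun s hs => by simp only [huo.deriv_neg hs, hvo.deriv_neg hs]
  exact ⟨σ, ρ, h1, h2, hasSecondFundForm_of_isOddArc hm hγ hu hv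
    (isOddArc_normalCurve hγ hm hf hfi h1) (fun s hs => inner_deriv_normalCurve hγ hm h1 hs)
    (toL2_normalCurve_mem_orthogonal hγ hm hf hfi h1)⟩

end NormalCurve

/-! ### Commuting the parameter derivative with the arc-length derivative -/

section WeakDerivative

variable {N m : ℕ}

theorem IsTest.memLp_smul {φ : ℝ → ℝ} (hφ : IsTest φ) (e : Amb N) :
    MemLp (fun s => φ s • e) 2 arcMeas := by
  obtain ⟨C, hC⟩ := hφ.2.exists_bound_of_continuous hφ.1.continuous
  refine MemLp.of_bound (hφ.1.continuous.smul continuous_const).aestronglyMeasurable (C * ‖e‖)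
    (Eventually.of_forall fun s => ?_)
  rw [norm_smul]
  exact mul_le_mul_of_nonneg_right (hC s) (norm_nonneg _)

theorem IsOddArc.inner_toL2_deriv {g : ℝ → Amb N} (hg : IsOddArc g)
    (hg2 : MemLp (deriv g) 2 arcMeas) {φ : ℝ → ℝ} (hφ : IsTest φ) (e : Amb N) :
    inner ℝ (toL2 fun s => φ s • e) (toL2 (deriv g)) =
      -inner ℝ (toL2 fun s => deriv φ s • e) (toL2 g) := by
  have hd : ∀ s ∈ arcI, HasDerivAt (fun s => (inner ℝ (φ s • e) (g s) : ℝ))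
      (inner ℝ (φ s • e) (deriv g s) + inner ℝ (deriv φ s • e) (g s)) s := fun s hs =>
    ((hφ.hasDerivAt s).smul_const e).inner ℝ (hg.hasDerivAt hs)
  have i1 := integrable_inner_of_memLp (hφ.memLp_smul e) hg2
  have i2 := integrable_inner_of_memLp (hφ.deriv.memLp_smul e) hg.memLp
  have hb : ∀ s ∈ arcI, ‖(inner ℝ (φ s • e) (g s) : ℝ)‖ ≤
      ‖φ s • e‖ * ∫ x, ‖deriv g x‖ ∂arcMeas := fun s hs =>
    (norm_inner_le_norm _ _).trans (mul_le_mul_of_nonneg_left (hg.norm_le hs) (norm_nonneg _))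
  have hlim : Continuous fun s : ℝ => ‖φ s • e‖ * ∫ x, ‖deriv g x‖ ∂arcMeas := by
    have := hφ.1.continuous
    fun_prop
  have h1 : φ 1 = 0 := hφ.eq_zero (by simp)
  have h2 : φ (-1) = 0 := hφ.eq_zero (by simp)
  have key := intervalIntegral.integral_eq_sub_of_hasDerivAt_of_tendsto (a := -1) (b := 1)
    (by norm_num) (fa := 0) (fb := 0) hd
    ((intervalIntegrable_iff_integrableOn_Ioo_of_le (by norm_num)).2 (i1.add i2)) ?_ ?_
  · rw [intervalIntegral.integral_of_le (by norm_num), integral_Ioc_eq_integral_Ioo,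
      integral_add i1 i2, sub_zero] at key
    rw [inner_toL2_toL2 (hφ.memLp_smul e) hg2, inner_toL2_toL2 (hφ.deriv.memLp_smul e) hg.memLp]
    linarith
  · refine squeeze_zero_norm' (a := fun s : ℝ => ‖φ s • e‖ * ∫ x, ‖deriv g x‖ ∂arcMeas) ?_ ?_
    · filter_upwards [Ioo_mem_nhdsGT (by norm_num : (-1 : ℝ) < 1)] with s hs using hb s hs
    · have := (hlim.tendsto (-1)).mono_left (nhdsWithin_le_nhds (s := Ioi (-1)))
      simpa [h2] using this
  · refine squeeze_zero_norm' (a := fun s : ℝ => ‖φ s • e‖ * ∫ x, ‖deriv g x‖ ∂arcMeas) ?_ ?_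
    · filter_upwards [Ioo_mem_nhdsLT (by norm_num : (-1 : ℝ) < 1)] with s hs using hb s hs
    · have := (hlim.tendsto 1).mono_left (nhdsWithin_le_nhds (s := Iio 1))
      simpa [h1] using this

/-- Parameter derivatives commute with the weak derivative in `s`. -/
theorem hasDerivAt_toL2_deriv_unique {η : ℝ → ℝ → Amb N} {w : ℝ → Amb N} {β : ArcL2 N}
    (hη : ∀ᶠ t in 𝓝 (0 : ℝ), IsOddArc (η t) ∧ MemLp (deriv (η t)) 2 arcMeas)
    (hw : IsOddArc w) (hw2 : MemLp (deriv w) 2 arcMeas)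
    (h1 : HasDerivAt (fun t => toL2 (η t)) (toL2 w) 0)
    (h2 : HasDerivAt (fun t => toL2 (deriv (η t))) β 0) : β = toL2 (deriv w) := by
  -- Integration by parts moves the s-derivative onto the fixed test function, after which the
  -- t-derivative may be taken in L² on both sides.
  have key : ∀ φ, IsTest φ → ∀ e : Amb N,
      inner ℝ (toL2 fun s => φ s • e) (β - toL2 (deriv w)) = 0 := fun φ hφ e => by
    have a1 := (hasDerivAt_const (0 : ℝ) (toL2 fun s => φ s • e)).inner ℝ h2
    have a2 := ((hasDerivAt_const (0 : ℝ) (toL2 fun s => deriv φ s • e)).inner ℝ h1).neg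
    have a3 := a1.unique (a2.congr_of_eventuallyEq (by
      filter_upwards [hη] with t ht
      exact ht.1.inner_toL2_deriv ht.2 hφ e))
    simp only [inner_zero_left, add_zero] at a3
    rw [inner_sub_right, a3, hw.inner_toL2_deriv hw2 hφ e, sub_self]
  have hb := Lp.memLp (β - toL2 (deriv w))
  have hbi : Integrable (β - toL2 (deriv w) : ArcL2 N) arcMeas := hb.integrable (by norm_num)
  have h0 : (β - toL2 (deriv w) : ArcL2 N) =ᵐ[arcMeas] (0 : ℝ → Amb N) := by
    refine ae_eq_zero_of_forall_test (IntegrableOn.locallyIntegrableOn hbi) fun φ p1 p2 p3 => ?_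
    have hφ : IsTest φ := ⟨p1, p2, p3⟩
    refine ext_inner_left ℝ fun e => ?_
    have hi : Integrable (fun s => φ s • (β - toL2 (deriv w) : ArcL2 N) s) arcMeas := by
      obtain ⟨C, hC⟩ := p2.exists_bound_of_continuous p1.continuous
      exact hbi.bdd_smul C p1.continuous.aestronglyMeasurable (Eventually.of_forall hC)
    rw [← integral_inner hi, inner_zero_right, ← key φ hφ e, inner_toL2 (hφ.memLp_smul e)]
    simp only [real_inner_smul_left, real_inner_smul_right]
  exact sub_eq_zero.1 ((Lp.eq_zero_iff_ae_eq_zero).2 h0)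

end WeakDerivative

/-! ### The Gauss equation for two-parameter families -/

section RiemannCurvature

variable {N m : ℕ} {γ u v : ℝ → Amb N} {F : ℝ × ℝ → ℝ → Amb N}

theorem ContDiffAt.fderiv_apply_const {V E : Type*} [NormedAddCommGroup V] [NormedSpace ℝ V]
    [NormedAddCommGroup E] [NormedSpace ℝ E] {f : V → E} {x : V} {n k : WithTop ℕ∞}
    (hf : ContDiffAt ℝ n f x) (h : k + 1 ≤ n) (e : V) :
    ContDiffAt ℝ k (fun p => fderiv ℝ f p e) x :=
  (hf.fderiv_right h).clm_apply contDiffAt_const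

theorem ContDiffAt.fderiv_fderiv_comm {V E : Type*} [NormedAddCommGroup V] [NormedSpace ℝ V]
    [NormedAddCommGroup E] [NormedSpace ℝ E] {f : V → E} {x : V}
    (hf : ContDiffAt ℝ 2 f x) (e e' : V) :
    fderiv ℝ (fun p => fderiv ℝ f p e) x e' = fderiv ℝ (fun p => fderiv ℝ f p e') x e := by
  have hd : DifferentiableAt ℝ (fderiv ℝ f) x :=
    (hf.fderiv_right (m := 1) (by rw [one_add_one_eq_two])).differentiableAt (by norm_num)
  rw [fderiv_clm_apply hd (differentiableAt_const e), fderiv_clm_apply hd (differentiableAt_const e')]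
  simpa using (hf.isSymmSndFDerivAt (by simp)).eq e' e

theorem HasFDerivAt.hasDerivAt_smul {V E : Type*} [NormedAddCommGroup V] [NormedSpace ℝ V]
    [NormedAddCommGroup E] [NormedSpace ℝ E] {f : V → E} {f' : V →L[ℝ] E} {p e : V}
    (hf : HasFDerivAt f f' p) : HasDerivAt (fun t : ℝ => f (p + t • e)) (f' e) 0 := by
  have h1 : HasDerivAt (fun t : ℝ => p + t • e) e 0 := by
    simpa using ((hasDerivAt_id (0 : ℝ)).smul_const e).const_add p
  exact HasFDerivAt.comp_hasDerivAt_of_eq 0 hf h1 (by simp)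

theorem eventually_smul {p : ℝ × ℝ → Prop} (h : ∀ᶠ q in 𝓝 0, p q) (e : ℝ × ℝ) :
    ∀ᶠ t in 𝓝 (0 : ℝ), p (t • e) := by
  have : Tendsto (fun t : ℝ => t • e) (𝓝 0) (𝓝 0) := by
    have h : Continuous fun t : ℝ => t • e := by fun_prop
    simpa using h.tendsto 0
  exact this.eventually h

namespace IsRegularSurface

/-- The coordinate field X is tangent, so the self-adjoint projection in ⟪⟪D_e Y, X⟫⟫ can be moved
onto X, where it disappears. What is left is an ordinary product rule, with no differentiability of
the projection required. -/
theorem hasDerivAt_inner_covDeriv (hF : IsRegularSurface m γ u v F) {Y : ℝ × ℝ → ArcL2 N}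
    (hY : ContDiffAt ℝ 2 Y 0) (e f g : ℝ × ℝ) :
    HasDerivAt (fun t : ℝ => (inner ℝ (covDeriv m F e Y (t • g)) (coordField F f (t • g)) : ℝ))
      (inner ℝ (fderiv ℝ (fun p => fderiv ℝ Y p e) 0 g) (coordField F f 0) +
        inner ℝ (fderiv ℝ Y 0 e) (fderiv ℝ (coordField F f) 0 g)) 0 := by
  have hX : ContDiffAt ℝ 2 (coordField F f) 0 :=
    hF.smooth.fderiv_apply_const (by norm_num) f
  have h1 := ((hY.fderiv_apply_const (k := 1) (by rw [one_add_one_eq_two]) e).differentiableAt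
    (by norm_num)).hasFDerivAt.hasDerivAt_smul (e := g)
  have h2 := (hX.differentiableAt (by norm_num)).hasFDerivAt.hasDerivAt_smul (e := g)
  have h3 := h1.inner ℝ h2
  simp only [zero_add, zero_smul] at h3
  refine (h3.congr_of_eventuallyEq ?_).congr_deriv (add_comm _ _)
  filter_upwards [eventually_smul (hF.tangent f) g] with t ht
  obtain ⟨w, hw, hw'⟩ := ht
  rw [covDeriv, tangentProj_apply, Submodule.inner_starProjection_left_eq_right,
    Submodule.starProjection_eq_self_iff.2 (hw' ▸ toL2_mem_tangentL2 hw)]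

theorem fderiv_toL2_deriv (hm : 2 ≤ m) (hF : IsRegularSurface m γ u v F) (e : ℝ × ℝ) :
    ∀ᶠ p in 𝓝 (0 : ℝ × ℝ), ∀ w, MemTangent m (F p) w → coordField F e p = toL2 w →
      fderiv ℝ (fun q => toL2 (deriv (F q))) p e = toL2 (deriv w) := by
  filter_upwards [hF.arc.eventually_nhds,
    (hF.smooth.of_le (m := 1) (by norm_num)).eventually (by norm_num),
    hF.smooth_deriv.eventually (by norm_num)] with p h1 h2 h3 w hw hwe
  have a2 := (h2.differentiableAt (by norm_num)).hasFDerivAt.hasDerivAt_smul (e := e)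
  have a3 := (h3.differentiableAt (by norm_num)).hasFDerivAt.hasDerivAt_smul (e := e)
  have hwe' : fderiv ℝ (fun q => toL2 (F q)) p e = toL2 w := hwe
  rw [hwe'] at a2
  refine hasDerivAt_toL2_deriv_unique (η := fun t => F (p + t • e)) ?_ (hw.isOddArc hm)
    (hw.1.memLp_deriv hm) a2 a3
  have : Tendsto (fun t : ℝ => p + t • e) (𝓝 0) (𝓝 p) := by
    have h : Continuous fun t : ℝ => p + t • e := by fun_prop
    simpa using h.tendsto 0
  filter_upwards [this.eventually h1] with t ht
  exact ⟨ht.isOddArc hm, ht.1.memLp_deriv hm⟩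

/-- The coordinate fields along the coordinate lines of a regular surface. -/
theorem isFieldAlong (hm : 2 ≤ m) (hF : IsRegularSurface m γ u v F) {e f : ℝ × ℝ}
    {a b : ℝ → Amb N} (ha : MemTangent m γ a) (hb : MemTangent m γ b)
    (he : coordField F e 0 = toL2 a) (hf : coordField F f 0 = toL2 b) :
    ∃ V, IsFieldAlong m γ a b (fun t => F (t • e)) V (fderiv ℝ (coordField F f) 0 e) := by
  classical
  -- A tangent representative of the L² class is chosen for each t. At t = 0 it must be b itself,
  -- because the initial condition is an equality of functions and not of classes.
  have hex : ∀ t : ℝ, ∃ w, (t = 0 → w = b) ∧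
      ((∃ w, MemTangent m (F (t • e)) w ∧ coordField F f (t • e) = toL2 w) →
        MemTangent m (F (t • e)) w ∧ coordField F f (t • e) = toL2 w) := fun t => by
    by_cases ht : t = 0
    · refine ⟨b, fun _ => rfl, fun _ => ?_⟩
      rw [ht, zero_smul, hF.base]
      exact ⟨hb, hf⟩
    · by_cases h : ∃ w, MemTangent m (F (t • e)) w ∧ coordField F f (t • e) = toL2 w
      · obtain ⟨w, hw⟩ := h
        exact ⟨w, fun h0 => absurd h0 ht, fun _ => hw⟩
      · exact ⟨b, fun _ => rfl, fun h' => absurd h' h⟩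
  choose V hV0 hV using hex
  have hVe : ∀ᶠ t in 𝓝 (0 : ℝ), MemTangent m (F (t • e)) (V t) ∧
      coordField F f (t • e) = toL2 (V t) := by
    filter_upwards [eventually_smul (hF.tangent f) e] with t ht using hV t ht
  have hX : ContDiffAt ℝ 2 (coordField F f) 0 :=
    hF.smooth.fderiv_apply_const (by norm_num) f
  have h1 := (hF.smooth.differentiableAt (by norm_num)).hasFDerivAt.hasDerivAt_smul (e := e)
  have h2 := (hF.smooth_deriv.differentiableAt (by norm_num)).hasFDerivAt.hasDerivAt_smul (e := e)
  have h3 := (hX.differentiableAt (by norm_num)).hasFDerivAt.hasDerivAt_smul (e := e)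
  simp only [zero_add] at h1 h2 h3
  have he' : fderiv ℝ (fun q => toL2 (F q)) 0 e = toL2 a := he
  refine ⟨V, eventually_smul hF.arc e, hVe.mono fun t ht => ht.1, by simp [hF.base], hV0 0 rfl,
    he' ▸ h1, ?_, ?_, ?_⟩
  · have := (hF.fderiv_toL2_deriv hm e).self_of_nhds a (by rwa [hF.base]) he
    rwa [this] at h2
  · have hc : ContinuousAt (fun p => fderiv ℝ (fun q => toL2 (deriv (F q))) p f) 0 :=
      (hF.smooth_deriv.fderiv_apply_const (k := 0) (by norm_num) f).continuousAt
    have ht : ContinuousAt (fun t : ℝ => t • e) 0 := by fun_prop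
    have hc' : ContinuousAt (fun t : ℝ => fderiv ℝ (fun q => toL2 (deriv (F q))) (t • e) f) 0 :=
      ContinuousAt.comp_of_eq hc ht (by simp)
    refine hc'.congr ?_
    filter_upwards [hVe, eventually_smul (hF.fderiv_toL2_deriv hm f) e] with t a1 a2
    exact a2 _ a1.1 a1.2
  · refine h3.congr_of_eventuallyEq ?_
    filter_upwards [hVe] with t ht using ht.2.symm

/-- The Gauss equation. -/
theorem hasRiemannCurvature (hm : 2 ≤ m) (hu : MemTangent m γ u) (hv : MemTangent m γ v)
    (hF : IsRegularSurface m γ u v F) {nuu nvv nuv : ArcL2 N}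
    (huu : HasSecondFundForm m γ u u nuu) (hvv : HasSecondFundForm m γ v v nvv)
    (huv : HasSecondFundForm m γ u v nuv) :
    HasRiemannCurvature m F (inner ℝ nuu nvv - inner ℝ nuv nuv) := by
  have hX : ContDiffAt ℝ 2 (coordField F (1, 0)) 0 :=
    hF.smooth.fderiv_apply_const (by norm_num) _
  have hY : ContDiffAt ℝ 2 (coordField F (0, 1)) 0 :=
    hF.smooth.fderiv_apply_const (by norm_num) _
  obtain ⟨V1, f1⟩ := hF.isFieldAlong hm hu hu hF.velocity_fst hF.velocity_fst
  obtain ⟨V2, f2⟩ := hF.isFieldAlong hm hv hv hF.velocity_snd hF.velocity_snd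
  obtain ⟨V3, f3⟩ := hF.isFieldAlong hm hu hv hF.velocity_fst hF.velocity_snd
  have n1 := huu.2 _ _ _ f1
  have n2 := hvv.2 _ _ _ f2
  have n3 := huv.2 _ _ _ f3
  -- Symmetry of second derivatives gives ∂_b X = ∂_a Y, so the mixed ambient derivative yields
  -- S(u,v); the third-order terms ∂_a∂_b Y and ∂_b∂_a Y cancel for the same reason.
  have hcomm : fderiv ℝ (coordField F (1, 0)) 0 (0, 1) = fderiv ℝ (coordField F (0, 1)) 0 (1, 0) :=
    (hF.smooth.of_le (by norm_num)).fderiv_fderiv_comm _ _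
  have hd1 := hF.hasDerivAt_inner_covDeriv hY (0, 1) (1, 0) (1, 0)
  have hd2 := hF.hasDerivAt_inner_covDeriv hY (1, 0) (1, 0) (0, 1)
  simp only [Prod.smul_mk, smul_eq_mul, mul_one, mul_zero] at hd1 hd2
  refine ⟨_, _, hd1, hd2, ?_⟩
  have horth : ∀ a b : ArcL2 N, inner ℝ a b - inner ℝ (tangentProj m γ a) (tangentProj m γ b) =
      (inner ℝ (a - tangentProj m γ a) (b - tangentProj m γ b) : ℝ) := fun a b => by
    have h1 : inner ℝ (tangentProj m γ a) (b - tangentProj m γ b) = (0 : ℝ) :=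
      (sub_tangentProj_mem b) _ (Submodule.starProjection_apply_mem _ a)
    have h2 : inner ℝ (a - tangentProj m γ a) (tangentProj m γ b) = (0 : ℝ) := by
      rw [real_inner_comm]
      exact (sub_tangentProj_mem a) _ (Submodule.starProjection_apply_mem _ b)
    rw [inner_sub_right] at h1
    rw [inner_sub_right, h2, inner_sub_left]
    linarith
  rw [hY.fderiv_fderiv_comm (0, 1) (1, 0), hcomm, n1, n2, n3, real_inner_comm (_ - _), ← horth,
    ← horth]
  simp only [covDeriv, hF.base, hcomm]
  ring

end IsRegularSurface

end RiemannCurvature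

/-! ### Legendre spectral gap on odd curves -/

section Poincare

variable {N : ℕ} {f : ℝ → Amb N}

theorem integrable_weight_mul {g : ℝ → ℝ} (hg : Integrable g arcMeas) :
    Integrable (fun s => (1 - s ^ 2) * g s) arcMeas :=
  integrable_mul_continuous hg (by fun_prop)

/-- The spectral gap of the Legendre operator on odd functions. -/
theorem IsOddArc.two_mul_integral_le (hf : IsOddArc f) (hf2 : MemLp (deriv f) 2 arcMeas) :
    2 * ∫ s, ‖f s‖ ^ 2 ∂arcMeas ≤ ∫ s, (1 - s ^ 2) * ‖deriv f s‖ ^ 2 ∂arcMeas := by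
  -- The first odd Legendre function is s, with eigenvalue 2. Completing the square against it gives
  -- (1-s²)|f'|² - 2|f|² = k' + (1-s²)|f' - f/s|² for s ≠ 0, and k vanishes at ±1. At s = 0 division
  -- by zero gives k(0) = 0, the correct limit since f(0) = 0.
  set k : ℝ → ℝ := fun s => (1 - s ^ 2) * ‖f s‖ ^ 2 / s with hk
  set M := ∫ x, ‖deriv f x‖ ∂arcMeas with hM
  have i1 : Integrable (fun s => (1 - s ^ 2) * ‖deriv f s‖ ^ 2) arcMeas :=
    integrable_weight_mul (hf2.integrable_norm_pow (by norm_num))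
  have i2 : Integrable (fun s => 2 * ‖f s‖ ^ 2) arcMeas :=
    (hf.memLp.integrable_norm_pow (by norm_num)).const_mul 2
  have i3 : Integrable (fun s => (1 - s ^ 2) * ‖deriv f s‖ ^ 2 - 2 * ‖f s‖ ^ 2) arcMeas :=
    i1.sub i2
  have hd : ∀ s ∈ arcI, ∃ d, HasDerivAt k d s ∧
      d ≤ (1 - s ^ 2) * ‖deriv f s‖ ^ 2 - 2 * ‖f s‖ ^ 2 := by
    intro s hs
    have hfs := hf.hasDerivAt hs
    by_cases h0 : s = 0
    · subst h0
      refine ⟨‖deriv f 0‖ ^ 2, ?_, by simp [hf.map_zero]⟩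
      rw [hasDerivAt_iff_tendsto_slope_zero] at hfs ⊢
      have hw : Tendsto (fun t : ℝ => 1 - t ^ 2) (𝓝[≠] 0) (𝓝 1) := by
        have : Continuous fun t : ℝ => 1 - t ^ 2 := by fun_prop
        simpa using (this.tendsto 0).mono_left nhdsWithin_le_nhds
      have := hw.mul (hfs.norm.pow 2)
      rw [one_mul] at this
      refine this.congr' ?_
      filter_upwards [self_mem_nhdsWithin] with t ht
      have ht : t ≠ 0 := ht
      simp only [hk, zero_add, hf.map_zero, sub_zero, norm_smul, smul_eq_mul, norm_zero, mul_pow,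
        norm_inv, Real.norm_eq_abs, inv_pow, sq_abs]
      field_simp
      simp
    · have h1 : HasDerivAt (fun s : ℝ => 1 - s ^ 2) (-(2 * s)) s := by
        simpa using ((hasDerivAt_id s).pow 2).const_sub 1
      have h3 := (h1.mul hfs.norm_sq).div (hasDerivAt_id s) h0
      refine ⟨_, h3, ?_⟩
      have hw : 0 ≤ 1 - s ^ 2 := by nlinarith [hs.1, hs.2]
      have h4 : 0 ≤ (1 - s ^ 2) * ‖deriv f s - s⁻¹ • f s‖ ^ 2 := by positivity
      rw [norm_sub_sq_real, norm_smul, real_inner_smul_right, mul_pow, norm_inv, inv_pow,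
        Real.norm_eq_abs, sq_abs, real_inner_comm] at h4
      rw [← sub_nonneg]
      convert h4 using 1
      simp only [id, mul_one, Pi.mul_apply]
      field_simp
      ring
  have hb : ∀ s ∈ arcI, |k s| ≤ (1 - s ^ 2) * M ^ 2 / |s| := fun s hs => by
    have hw : 0 ≤ 1 - s ^ 2 := by nlinarith [hs.1, hs.2]
    rw [hk, abs_div, abs_of_nonneg (by positivity)]
    gcongr
    exact hf.norm_le hs
  -- Here k(±1) = 0 whatever value f takes there, and boundedness of f inside the interval gives
  -- continuity.
  have hend : ∀ x : ℝ, |x| = 1 → ContinuousWithinAt k (Icc (-1) 1) x := fun x hx => by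
    have hx2 : x ^ 2 = 1 := by rw [← sq_abs, hx, one_pow]
    have hx0 : k x = 0 := by simp [hk, hx2]
    have hmem : ∀ s ∈ Icc (-1 : ℝ) 1, |k s| ≤ (1 - s ^ 2) * M ^ 2 / |s| := fun s hs => by
      rcases hs.1.eq_or_lt with h | h
      · simp [hk, ← h]
      rcases hs.2.eq_or_lt with h' | h'
      · simp [hk, h']
      exact hb s ⟨h, h'⟩
    have hc : ContinuousAt (fun s : ℝ => (1 - s ^ 2) * M ^ 2 / |s|) x :=
      ContinuousAt.div (by fun_prop) (by fun_prop) (by rw [hx]; norm_num)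
    have ht := hc.tendsto.mono_left (nhdsWithin_le_nhds (s := Icc (-1) 1))
    simp only [hx2, sub_self, zero_mul, zero_div] at ht
    rw [ContinuousWithinAt, hx0]
    exact squeeze_zero_norm' (by filter_upwards [self_mem_nhdsWithin] with s hs using hmem s hs) ht
  have hcont : ContinuousOn k (Icc (-1) 1) := fun s hs => by
    rcases hs.1.eq_or_lt with h | h
    · exact hend s (by rw [← h]; simp)
    rcases hs.2.eq_or_lt with h' | h'
    · exact hend s (by rw [h']; simp)
    exact (hd s ⟨h, h'⟩).choose_spec.1.continuousAt.continuousWithinAt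
  have key := intervalIntegral.sub_le_integral_of_hasDeriv_right_of_le (a := -1) (b := 1)
    (φ := fun s => (1 - s ^ 2) * ‖deriv f s‖ ^ 2 - 2 * ‖f s‖ ^ 2) (g' := deriv k)
    (by norm_num) hcont
    (fun x hx => by
      obtain ⟨d, h1, -⟩ := hd x hx
      exact h1.differentiableAt.hasDerivAt.hasDerivWithinAt)
    ((integrableOn_Icc_iff_integrableOn_Ioo (μ := volume)).2 i3)
    (fun x hx => by
      obtain ⟨d, h1, h2⟩ := hd x hx
      rwa [h1.deriv])
  rw [intervalIntegral.integral_of_le (by norm_num), integral_Ioc_eq_integral_Ioo,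
    integral_sub i1 i2, integral_const_mul] at key
  simp only [hk] at key
  norm_num at key
  linarith

end Poincare

/-! ### Lower bound for the Green energy -/

section ProductIntegrals

theorem prod_arcMeas : arcMeas.prod arcMeas = volume.restrict (arcI ×ˢ arcI) := by
  rw [Measure.prod_restrict, Measure.volume_eq_prod]

theorem forall_ae_prod_arcMeas {P : ℝ × ℝ → Prop} (h : ∀ s ∈ arcI, ∀ x ∈ arcI, P (s, x)) :
    ∀ᵐ p ∂arcMeas.prod arcMeas, P p := by
  rw [prod_arcMeas]
  exact (ae_restrict_iff' (measurableSet_Ioo.prod measurableSet_Ioo)).2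
    (Eventually.of_forall fun p hp => h p.1 hp.1 p.2 hp.2)

theorem integral_integral_arcI {f : ℝ × ℝ → ℝ} (hf : Integrable f (arcMeas.prod arcMeas)) :
    ∫ x in (-1 : ℝ)..1, ∫ s in (-1 : ℝ)..1, f (s, x) = ∫ p, f p ∂arcMeas.prod arcMeas := by
  rw [integral_prod_symm _ hf, intervalIntegral.integral_of_le (by norm_num),
    integral_Ioc_eq_integral_Ioo]
  simp only [intervalIntegral.integral_of_le (by norm_num : (-1 : ℝ) ≤ 1),
    integral_Ioc_eq_integral_Ioo]

theorem Integrable.continuous_mul_prod {f k : ℝ × ℝ → ℝ}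
    (hf : Integrable f (arcMeas.prod arcMeas)) (hk : Continuous k) :
    Integrable (fun p => k p * f p) (arcMeas.prod arcMeas) := by
  obtain ⟨C, hC⟩ := (isCompact_Icc.prod isCompact_Icc).exists_bound_of_continuousOn
    (s := Icc (-1 : ℝ) 1 ×ˢ Icc (-1 : ℝ) 1) hk.continuousOn
  exact hf.bdd_mul (c := C) hk.aestronglyMeasurable (forall_ae_prod_arcMeas fun s hs x hx =>
    hC (s, x) ⟨⟨hs.1.le, hs.2.le⟩, ⟨hx.1.le, hx.2.le⟩⟩)

theorem integral_prod_neg_snd (f : ℝ × ℝ → ℝ) :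
    ∫ p, f (p.1, -p.2) ∂arcMeas.prod arcMeas = ∫ p, f p ∂arcMeas.prod arcMeas :=
  ((MeasurePreserving.id arcMeas).prod measurePreserving_neg_arcMeas).integral_comp
    ((MeasurableEquiv.refl ℝ).prodCongr (MeasurableEquiv.neg ℝ)).measurableEmbedding f

variable {q z R a b c : ℝ → ℝ}

theorem continuous_greenFn_prod (h : IsDirichletSol q z R) :
    Continuous fun p : ℝ × ℝ => greenFn z R p.1 p.2 := continuous_greenFn h

/-- The lower bound for the Green energy of even densities. -/
theorem le_integral_greenFn (hq : IsPotential q) (h : IsDirichletSol q z R)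
    (ha : Integrable a arcMeas) (hb : Integrable b arcMeas) (hc : Integrable c arcMeas)
    (hbe : ∀ s ∈ arcI, b (-s) = b s) (hce : ∀ s ∈ arcI, c (-s) = c s)
    (hM : ∀ s ∈ arcI, ∀ x ∈ arcI, 0 ≤ a s * b x - c x * c s + (a x * b s - c s * c x)) :
    Real.exp (-∫ s in (0 : ℝ)..1, (1 - s) * q s) / 4 *
      ((∫ s, (1 - s ^ 2) * a s ∂arcMeas) * (∫ s, (1 - s ^ 2) * b s ∂arcMeas) -
        (∫ s, (1 - s ^ 2) * c s ∂arcMeas) ^ 2) ≤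
    ∫ p, greenFn z R p.1 p.2 * (a p.1 * b p.2 - c p.2 * c p.1) ∂arcMeas.prod arcMeas := by
  set κ := Real.exp (-∫ s in (0 : ℝ)..1, (1 - s) * q s) with hκ
  set n : ℝ × ℝ → ℝ := fun p => a p.1 * b p.2 - c p.2 * c p.1 with hn
  have hni : Integrable n (arcMeas.prod arcMeas) := by
    refine (ha.mul_prod hb).sub ?_
    simpa only [mul_comm] using hc.mul_prod hc
  have hGc := continuous_greenFn_prod h
  have hGc' : Continuous fun p : ℝ × ℝ => greenFn z R p.1 (-p.2) :=
    hGc.comp (continuous_fst.prodMk continuous_snd.neg)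
  set H : ℝ × ℝ → ℝ := fun p => greenFn z R p.1 p.2 + greenFn z R p.1 (-p.2) with hH
  have hHc : Continuous H := hGc.add hGc'
  have iG := Integrable.continuous_mul_prod hni hGc
  have iG' := Integrable.continuous_mul_prod hni hGc'
  have iH := Integrable.continuous_mul_prod hni hHc
  have hns : Integrable (fun p => n p.swap) (arcMeas.prod arcMeas) := hni.swap
  have iHs := Integrable.continuous_mul_prod hns hHc
  -- The densities in x are even, so G may be replaced by its average over x and -x.
  have e1 : ∫ p, greenFn z R p.1 (-p.2) * n p ∂arcMeas.prod arcMeas =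
      ∫ p, greenFn z R p.1 p.2 * n p ∂arcMeas.prod arcMeas := by
    rw [← integral_prod_neg_snd fun p => greenFn z R p.1 p.2 * n p]
    refine integral_congr_ae (forall_ae_prod_arcMeas fun s hs x hx => ?_)
    simp only [hn, hbe x hx, hce x hx]
  have e2 : ∫ p, H p * n p ∂arcMeas.prod arcMeas =
      2 * ∫ p, greenFn z R p.1 p.2 * n p ∂arcMeas.prod arcMeas := by
    have : ∫ p, H p * n p ∂arcMeas.prod arcMeas =
        ∫ p, (greenFn z R p.1 p.2 * n p + greenFn z R p.1 (-p.2) * n p) ∂arcMeas.prod arcMeas := by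
      simp only [hH, add_mul]
    rw [this, integral_add iG iG', e1, two_mul]
  -- The integrand n may change sign; only its symmetrisation under exchange of s and x is
  -- nonnegative. The symmetry of H permits symmetrising before the pointwise bound is used.
  have e3 : ∫ p, H p * n p.swap ∂arcMeas.prod arcMeas = ∫ p, H p * n p ∂arcMeas.prod arcMeas := by
    rw [← integral_prod_swap fun p => H p * n p]
    refine integral_congr_ae (Eventually.of_forall fun p => ?_)
    have : H p.swap = H p := by
      simp only [hH, Prod.fst_swap, Prod.snd_swap]
      rw [greenFn_comm, greenFn_comm p.2, ← greenFn_neg_neg (-p.1), neg_neg]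
    simp only [this]
  set W : ℝ × ℝ → ℝ := fun p => (1 - p.1 ^ 2) * (1 - p.2 ^ 2) with hW
  have hWc : Continuous W := by simp only [hW]; fun_prop
  have iW := Integrable.continuous_mul_prod hni hWc
  have iWs := Integrable.continuous_mul_prod hns hWc
  have f1 : ∫ p, W p * n p ∂arcMeas.prod arcMeas =
      (∫ s, (1 - s ^ 2) * a s ∂arcMeas) * (∫ s, (1 - s ^ 2) * b s ∂arcMeas) -
        (∫ s, (1 - s ^ 2) * c s ∂arcMeas) ^ 2 := by
    have := (integrable_weight_mul ha).mul_prod (integrable_weight_mul hb)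
    have h' := (integrable_weight_mul hc).mul_prod (integrable_weight_mul hc)
    rw [sq, ← integral_prod_mul, ← integral_prod_mul, ← integral_sub this h']
    refine integral_congr_ae (Eventually.of_forall fun p => ?_)
    simp only [hn, hW]
    ring
  have f2 : ∫ p, W p * n p.swap ∂arcMeas.prod arcMeas = ∫ p, W p * n p ∂arcMeas.prod arcMeas := by
    rw [← integral_prod_swap fun p => W p * n p]
    refine integral_congr_ae (Eventually.of_forall fun p => ?_)
    simp only [hW, Prod.fst_swap, Prod.snd_swap]
    ring
  have key : κ / 2 * ∫ p, (W p * n p + W p * n p.swap) ∂arcMeas.prod arcMeas ≤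
      ∫ p, (H p * n p + H p * n p.swap) ∂arcMeas.prod arcMeas := by
    rw [← integral_const_mul]
    refine integral_mono_ae ((iW.add iWs).const_mul _) (iH.add iHs)
      (forall_ae_prod_arcMeas fun s hs x hx => ?_)
    have h1 := greenFn_add_ge hq h (s := s) (x := x) ⟨hs.1.le, hs.2.le⟩ ⟨hx.1.le, hx.2.le⟩
    have h2 := mul_le_mul_of_nonneg_right h1 (hM s hs x hx)
    simp only [hn, hW, hH, Prod.swap_prod_mk]
    rw [← hκ] at h2
    linarith
  rw [integral_add iW iWs, integral_add iH iHs, e3, e2, f2, f1] at key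
  linarith

end ProductIntegrals

/-! ### Gram determinants -/

section Gram

variable {N m : ℕ} {γ u v : ℝ → Amb N}

theorem IsOddArc.eq_zero_of_toL2_eq_zero {f : ℝ → Amb N} (hf : IsOddArc f) (h : toL2 f = 0) :
    ∀ s ∈ arcI, f s = 0 := by
  refine Measure.eqOn_open_of_ae_eq (μ := volume) (g := fun _ => (0 : Amb N)) ?_ isOpen_Ioo
    hf.contDiffOn.continuousOn continuousOn_const
  have h1 := coeFn_toL2 hf.memLp
  rw [h] at h1
  exact h1.symm.trans (Lp.coeFn_zero _ _ _)

theorem SpanPlane.toL2_ne_zero (h : SpanPlane u v) (hu : IsOddArc u) (hv : IsOddArc v) {a b : ℝ}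
    (hab : a ≠ 0 ∨ b ≠ 0) : a • toL2 u + b • toL2 v ≠ 0 := by
  intro h0
  rw [← toL2_const_smul hu.memLp, ← toL2_const_smul hv.memLp,
    ← toL2_add (hu.const_smul a).memLp (hv.const_smul b).memLp] at h0
  have := h a b (((hu.const_smul a).add (hv.const_smul b)).eq_zero_of_toL2_eq_zero h0)
  tauto

theorem SpanPlane.gramL2_pos (h : SpanPlane u v) (hu : IsOddArc u) (hv : IsOddArc v) :
    0 < gramL2 u v ∧ 0 < inner ℝ (toL2 u) (toL2 u) := by
  have h1 : toL2 u ≠ 0 := by simpa using h.toL2_ne_zero hu hv (a := 1) (b := 0) (by simp)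
  have h1' : 0 < inner ℝ (toL2 u) (toL2 u) := real_inner_self_pos.2 h1
  -- Gram-Schmidt: the squared norm of |u|²v - ⟪⟪u,v⟫⟫u is |u|² times the Gram determinant.
  have h2 := h.toL2_ne_zero hu hv (a := -inner ℝ (toL2 u) (toL2 v))
    (b := inner ℝ (toL2 u) (toL2 u)) (Or.inr h1'.ne')
  have h3 := real_inner_self_pos.2 h2
  refine ⟨?_, h1'⟩
  simp only [inner_add_left, inner_add_right, real_inner_smul_left, real_inner_smul_right] at h3
  rw [real_inner_comm (toL2 u) (toL2 v)] at h3
  refine pos_of_mul_pos_right (a := inner ℝ (toL2 u) (toL2 u)) ?_ h1'.le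
  rw [gramL2]
  linarith

/-- Monotonicity of the 2 × 2 determinant on nonnegative forms. For the difference (α, φ, β),
nonnegativity gives φ² ≤ αβ. With F² ≤ AB the cross term satisfies 2Fφ ≤ 2√(ABαβ) ≤ Aβ + Bα, and so
does not lower the determinant. -/
theorem gramL2_le_of_forall {A B F a b f : ℝ} (hA : 0 < A) (hg : 0 ≤ A * B - F ^ 2)
    (h : ∀ x y : ℝ, x ^ 2 * A + 2 * x * y * F + y ^ 2 * B ≤
      x ^ 2 * a + 2 * x * y * f + y ^ 2 * b) : A * B - F ^ 2 ≤ a * b - f ^ 2 := by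
  set α := a - A with hα
  set β := b - B with hβ
  set φ := f - F with hφ
  have h1 : 0 ≤ α := by have := h 1 0; simp only [hα]; linarith
  have h2 : 0 ≤ β := by have := h 0 1; simp only [hβ]; linarith
  have h3 : φ ^ 2 ≤ α * β := by
    have := discrim_le_zero (a := α) (b := 2 * φ) (c := β) fun x => by
      have := h x 1
      simp only [hα, hβ, hφ]
      linarith
    rw [discrim] at this
    linarith
  have hB : 0 ≤ B := by
    by_contra! hB
    nlinarith [sq_nonneg F]
  have h4 : 2 * F * φ ≤ A * β + B * α := by
    refine le_of_abs_le (abs_le_of_sq_le_sq ?_ (by positivity))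
    have : F ^ 2 * φ ^ 2 ≤ A * B * (α * β) :=
      mul_le_mul (by linarith) h3 (sq_nonneg _) (by positivity)
    nlinarith [sq_nonneg (A * β - B * α)]
  have ea : a = A + α := by simp [hα]
  have eb : b = B + β := by simp [hβ]
  have ef : f = F + φ := by simp [hφ]
  rw [ea, eb, ef]
  nlinarith

/-- The spectral gap applied to every combination xu + yv compares the two quadratic forms with
constant 2, hence their determinants with constant 4. -/
theorem SpanPlane.four_mul_gramL2_le (h : SpanPlane u v) (hu : IsOddArc u) (hv : IsOddArc v)
    (hu2 : MemLp (deriv u) 2 arcMeas) (hv2 : MemLp (deriv v) 2 arcMeas) :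
    4 * gramL2 u v ≤
      (∫ s, (1 - s ^ 2) * ‖deriv u s‖ ^ 2 ∂arcMeas) *
        (∫ s, (1 - s ^ 2) * ‖deriv v s‖ ^ 2 ∂arcMeas) -
        (∫ s, (1 - s ^ 2) * inner ℝ (deriv u s) (deriv v s) ∂arcMeas) ^ 2 := by
  obtain ⟨hg, hA⟩ := h.gramL2_pos hu hv
  have i1 : Integrable (fun s => (1 - s ^ 2) * ‖deriv u s‖ ^ 2) arcMeas :=
    integrable_weight_mul (hu2.integrable_norm_pow (by norm_num))
  have i2 : Integrable (fun s => (1 - s ^ 2) * ‖deriv v s‖ ^ 2) arcMeas :=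
    integrable_weight_mul (hv2.integrable_norm_pow (by norm_num))
  have i3 := integrable_weight_mul (integrable_inner_of_memLp hu2 hv2)
  have key := gramL2_le_of_forall (A := 2 * inner ℝ (toL2 u) (toL2 u))
    (B := 2 * inner ℝ (toL2 v) (toL2 v)) (F := 2 * inner ℝ (toL2 u) (toL2 v))
    (a := ∫ s, (1 - s ^ 2) * ‖deriv u s‖ ^ 2 ∂arcMeas)
    (b := ∫ s, (1 - s ^ 2) * ‖deriv v s‖ ^ 2 ∂arcMeas)
    (f := ∫ s, (1 - s ^ 2) * inner ℝ (deriv u s) (deriv v s) ∂arcMeas)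
    (by linarith) (by rw [gramL2] at hg; linarith) fun x y => by
      have ho := (hu.const_smul x).add (hv.const_smul y)
      have hd : ∀ s ∈ arcI, deriv (fun s => x • u s + y • v s) s = x • deriv u s + y • deriv v s :=
        fun s hs => (((hu.hasDerivAt hs).const_smul x).add ((hv.hasDerivAt hs).const_smul y)).deriv
      have hd2 : MemLp (fun s => x • deriv u s + y • deriv v s) 2 arcMeas :=
        (hu2.const_smul x).add (hv2.const_smul y)
      have hp := ho.two_mul_integral_le ((memLp_congr_ae (forall_ae_arcMeas hd)).2 hd2)
      rw [← norm_toL2_sq ho.memLp, toL2_add (hu.const_smul x).memLp (hv.const_smul y).memLp,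
        toL2_const_smul hu.memLp, toL2_const_smul hv.memLp, norm_add_sq_real, norm_smul, norm_smul,
        real_inner_smul_left, real_inner_smul_right, mul_pow, mul_pow, Real.norm_eq_abs,
        Real.norm_eq_abs, sq_abs, sq_abs, ← real_inner_self_eq_norm_sq,
        ← real_inner_self_eq_norm_sq] at hp
      have e : ∫ s, (1 - s ^ 2) * ‖deriv (fun s => x • u s + y • v s) s‖ ^ 2 ∂arcMeas =
          ∫ s, (x ^ 2 * ((1 - s ^ 2) * ‖deriv u s‖ ^ 2) +
            2 * x * y * ((1 - s ^ 2) * inner ℝ (deriv u s) (deriv v s)) +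
            y ^ 2 * ((1 - s ^ 2) * ‖deriv v s‖ ^ 2)) ∂arcMeas := by
        refine integral_congr_ae (forall_ae_arcMeas fun s hs => ?_)
        simp only [hd s hs, norm_add_sq_real, norm_smul, real_inner_smul_left,
          real_inner_smul_right, mul_pow, Real.norm_eq_abs, sq_abs]
        ring
      have i12 : Integrable (fun s => x ^ 2 * ((1 - s ^ 2) * ‖deriv u s‖ ^ 2) +
            2 * x * y * ((1 - s ^ 2) * inner ℝ (deriv u s) (deriv v s))) arcMeas :=
        (i1.const_mul _).add (i3.const_mul _)
      rw [e, integral_add i12 (i2.const_mul _), integral_add (i1.const_mul _) (i3.const_mul _),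
        integral_const_mul, integral_const_mul, integral_const_mul] at hp
      linarith
  rw [gramL2]
  linarith

end Gram

/-! ### The curvature formula and the bound K ≥ e^{-ϱ} -/

section Curvature

variable {N m : ℕ} {γ u v : ℝ → Amb N} {z R : ℝ → ℝ}

theorem integral_greenFn_mul {q : ℝ → ℝ} (h : IsDirichletSol q z R) {f g : ℝ → ℝ}
    (hf : Integrable f arcMeas) (hg : Integrable g arcMeas) :
    ∫ s, (∫ x, greenFn z R s x * g x ∂arcMeas) * f s ∂arcMeas =
      ∫ p, greenFn z R p.1 p.2 * (f p.1 * g p.2) ∂arcMeas.prod arcMeas := by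
  rw [integral_prod _ (Integrable.continuous_mul_prod (hf.mul_prod hg) (continuous_greenFn_prod h))]
  refine integral_congr_ae (Eventually.of_forall fun s => ?_)
  simp only
  rw [← integral_mul_const]
  refine integral_congr_ae (Eventually.of_forall fun x => ?_)
  simp only
  ring

theorem integrable_curvNumer {q : ℝ → ℝ} (h : IsDirichletSol q z R)
    (hu : MemLp (deriv u) 2 arcMeas) (hv : MemLp (deriv v) 2 arcMeas) :
    Integrable (fun p : ℝ × ℝ => curvNumer (greenFn z R) u v p.1 p.2) (arcMeas.prod arcMeas) := by
  have hc := integrable_inner_of_memLp hu hv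
  have h1 : Integrable (fun p : ℝ × ℝ => ‖deriv u p.1‖ ^ 2 * ‖deriv v p.2‖ ^ 2 -
      inner ℝ (deriv u p.2) (deriv v p.2) * inner ℝ (deriv u p.1) (deriv v p.1))
      (arcMeas.prod arcMeas) := by
    refine ((hu.integrable_norm_pow (by norm_num : (2 : ℕ) ≠ 0)).mul_prod
      (hv.integrable_norm_pow (by norm_num : (2 : ℕ) ≠ 0))).sub ?_
    simpa only [mul_comm] using hc.mul_prod hc
  exact Integrable.continuous_mul_prod h1 (continuous_greenFn_prod h)

theorem integrable_curvDenom (hu : MemLp u 2 arcMeas) (hv : MemLp v 2 arcMeas) :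
    Integrable (fun p : ℝ × ℝ => curvDenom u v p.1 p.2) (arcMeas.prod arcMeas) ∧
      ∫ p, curvDenom u v p.1 p.2 ∂arcMeas.prod arcMeas = gramL2 u v := by
  have hc := integrable_inner_of_memLp hu hv
  have i1 : Integrable (fun p : ℝ × ℝ => ‖u p.1‖ ^ 2 * ‖v p.2‖ ^ 2) (arcMeas.prod arcMeas) :=
    (hu.integrable_norm_pow (by norm_num : (2 : ℕ) ≠ 0)).mul_prod
      (hv.integrable_norm_pow (by norm_num : (2 : ℕ) ≠ 0))
  have i2 : Integrable (fun p : ℝ × ℝ => (inner ℝ (u p.2) (v p.2) * inner ℝ (u p.1) (v p.1) : ℝ))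
      (arcMeas.prod arcMeas) := by
    simpa only [mul_comm] using hc.mul_prod hc
  refine ⟨i1.sub i2, ?_⟩
  have e : ∫ p, curvDenom u v p.1 p.2 ∂arcMeas.prod arcMeas =
      ∫ p, (‖u p.1‖ ^ 2 * ‖v p.2‖ ^ 2 -
        inner ℝ (u p.2) (v p.2) * inner ℝ (u p.1) (v p.1)) ∂arcMeas.prod arcMeas := rfl
  have e2 : ∫ p : ℝ × ℝ, (inner ℝ (u p.2) (v p.2) * inner ℝ (u p.1) (v p.1) : ℝ)
      ∂arcMeas.prod arcMeas = (∫ s, inner ℝ (u s) (v s) ∂arcMeas) ^ 2 := by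
    rw [sq, ← integral_prod_mul]
    simp only [mul_comm]
  rw [e, integral_sub i1 i2, e2, 
    integral_prod_mul (μ := arcMeas) (ν := arcMeas) (fun s => ‖u s‖ ^ 2) (fun s => ‖v s‖ ^ 2),
    ← norm_toL2_sq hu, ← norm_toL2_sq hv, ← inner_toL2_toL2 hu hv, gramL2,
    real_inner_self_eq_norm_sq, real_inner_self_eq_norm_sq]

/-- The sectional curvature in terms of the Green function. -/
theorem hasSectionalCurvature_greenFn (hγ : MemArcSpace (m + 2) γ) (hm : 2 ≤ m)
    (hu : MemTangent m γ u) (hv : MemTangent m γ v) (h : IsDirichletSol (curvPotential γ) z R) :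
    HasSectionalCurvature m γ u v
      ((∫ p, curvNumer (greenFn z R) u v p.1 p.2 ∂arcMeas.prod arcMeas) / gramL2 u v) ∧
    ∀ F, IsRegularSurface m γ u v F → HasRiemannCurvature m F
      (∫ p, curvNumer (greenFn z R) u v p.1 p.2 ∂arcMeas.prod arcMeas) := by
  have hu2 := hu.1.memLp_deriv hm
  have hv2 := hv.1.memLp_deriv hm
  have huo := (hu.isOddArc hm).continuousOn_deriv
  have hvo := (hv.isOddArc hm).continuousOn_deriv
  obtain ⟨σ1, ρ1, a1, b1, c1⟩ := exists_hasSecondFundForm hγ hm hu hu h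
  obtain ⟨σ2, ρ2, a2, b2, c2⟩ := exists_hasSecondFundForm hγ hm hv hv h
  obtain ⟨σ3, ρ3, a3, b3, c3⟩ := exists_hasSecondFundForm hγ hm hu hv h
  have i1 := integrable_inner_of_memLp hu2 hu2
  have i2 := integrable_inner_of_memLp hv2 hv2
  have i3 := integrable_inner_of_memLp hu2 hv2
  have key : ∀ {f g σ : ℝ → ℝ}, Integrable f arcMeas → Integrable g arcMeas →
      (∀ s ∈ arcI, σ s = ∫ x, greenFn z R s x * g x ∂arcMeas) →
      ∫ s, σ s * f s ∂arcMeas =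
        ∫ p, greenFn z R p.1 p.2 * (f p.1 * g p.2) ∂arcMeas.prod arcMeas := by
    intro f g σ hf hg hσ
    rw [← integral_greenFn_mul h hf hg]
    exact integral_congr_ae (forall_ae_arcMeas fun s hs => by simp only [hσ s hs])
  have e1 := (inner_normalCurve_normalCurve hγ hm (hvo.inner hvo) i2 a2 (huo.inner huo) i1 a1).trans
    (key i1 i2 b2)
  have e2 := (inner_normalCurve_normalCurve hγ hm (huo.inner hvo) i3 a3 (huo.inner hvo) i3 a3).trans
    (key i3 i3 b3)
  have hG := continuous_greenFn_prod h
  have e : (∫ p, curvNumer (greenFn z R) u v p.1 p.2 ∂arcMeas.prod arcMeas) =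
      inner ℝ (toL2 (normalCurve γ σ1 ρ1)) (toL2 (normalCurve γ σ2 ρ2)) -
        inner ℝ (toL2 (normalCurve γ σ3 ρ3)) (toL2 (normalCurve γ σ3 ρ3)) := by
    rw [real_inner_comm, e1, e2, ← integral_sub
      (Integrable.continuous_mul_prod (i1.mul_prod i2) hG)
      (Integrable.continuous_mul_prod (i3.mul_prod i3) hG)]
    refine integral_congr_ae (Eventually.of_forall fun p => ?_)
    simp only [curvNumer, real_inner_self_eq_norm_sq]
    ring
  rw [e]
  exact ⟨⟨_, _, _, c1, c2, c3, rfl⟩, fun F hF => hF.hasRiemannCurvature hm hu hv c1 c2 c3⟩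

theorem arcRho_eq : arcRho γ = ∫ s in (0 : ℝ)..1, (1 - s) * curvPotential γ s := by
  refine intervalIntegral.integral_congr fun s hs => ?_
  rw [uIcc_of_le zero_le_one] at hs
  rcases hs.2.eq_or_lt with h1 | h1
  · simp [h1]
  · have : s ∈ arcI := ⟨by linarith [hs.1], h1⟩
    simp only [curvPotential, indicator_of_mem this]

theorem arcRho_nonneg : 0 ≤ arcRho γ :=
  intervalIntegral.integral_nonneg zero_le_one fun s hs =>
    mul_nonneg (by linarith [hs.2]) (sq_nonneg _)

theorem exp_neg_arcRho_mul_gramL2_le (hγ : MemArcSpace (m + 2) γ) (hm : 2 ≤ m)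
    (hu : MemTangent m γ u) (hv : MemTangent m γ v) (hs : SpanPlane u v)
    (h : IsDirichletSol (curvPotential γ) z R) :
    Real.exp (-arcRho γ) * gramL2 u v ≤
      ∫ p, curvNumer (greenFn z R) u v p.1 p.2 ∂arcMeas.prod arcMeas := by
  have hu2 := hu.1.memLp_deriv hm
  have hv2 := hv.1.memLp_deriv hm
  have huo := hu.isOddArc hm
  have hvo := hv.isOddArc hm
  have h1 := le_integral_greenFn (hγ.isPotential hm) h
    (hu2.integrable_norm_pow (by norm_num : (2 : ℕ) ≠ 0))
    (hv2.integrable_norm_pow (by norm_num : (2 : ℕ) ≠ 0)) (integrable_inner_of_memLp hu2 hv2)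
    (fun s hs => by simp only [hvo.deriv_neg hs])
    (fun s hs => by simp only [huo.deriv_neg hs, hvo.deriv_neg hs]) fun s _ x _ => by
      -- Nonnegativity after symmetrisation: each product of inner products is at most
      -- |u'(s)||v'(x)||u'(x)||v'(s)|, and the difference from the sum of squares is a perfect
      -- square.
      have a1 := abs_real_inner_le_norm (deriv u s) (deriv v s)
      have a2 := abs_real_inner_le_norm (deriv u x) (deriv v x)
      have a3 := mul_le_mul a1 a2 (abs_nonneg _) (by positivity)
      rw [← abs_mul] at a3
      have a4 := (le_abs_self _).trans a3
      nlinarith [sq_nonneg (‖deriv u s‖ * ‖deriv v x‖ - ‖deriv u x‖ * ‖deriv v s‖)]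
  have h2 := hs.four_mul_gramL2_le huo hvo hu2 hv2
  rw [← arcRho_eq] at h1
  have h3 := mul_le_mul_of_nonneg_left h2
    (by positivity : 0 ≤ Real.exp (-arcRho γ) / 4)
  calc _ = Real.exp (-arcRho γ) / 4 * (4 * gramL2 u v) := by ring
    _ ≤ _ := h3.trans h1

end Curvature

/-! ### Planes of arbitrarily large curvature -/

section Unbounded

variable {N m : ℕ} {γ u v : ℝ → Amb N}

theorem exists_ne_zero_inner_eq_zero (hN : 2 ≤ N) (ν : Amb N) :
    ∃ e : Amb N, e ≠ 0 ∧ inner ℝ e ν = 0 := by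
  have h : 0 < Module.finrank ℝ (ℝ ∙ ν)ᗮ := by
    have h1 := Submodule.finrank_add_finrank_orthogonal (ℝ ∙ ν)
    have h2 : Module.finrank ℝ (ℝ ∙ ν) ≤ 1 := by
      simpa using finrank_span_le_card (R := ℝ) ({ν} : Set (Amb N))
    rw [finrank_euclideanSpace_fin] at h1
    omega
  obtain ⟨e, he⟩ := Module.finrank_pos_iff_exists_ne_zero.1 h
  refine ⟨e, by simpa using he, ?_⟩
  rw [real_inner_comm]
  exact (Submodule.mem_orthogonal_singleton_iff_inner_right).1 e.2

/-- Tangent vectors whose derivative is concentrated near `±c`. -/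
theorem MemArcSpace.exists_concentrated (hγ : MemArcSpace (m + 2) γ) (hN : 2 ≤ N) {c r : ℝ}
    (hr : 0 < r) (h0 : r ≤ c) (h1 : c + r < 1) :
    ∃ u, MemTangent m γ u ∧ (∀ s, r ≤ |(|s| - c)| → deriv u s = 0) ∧ deriv u c ≠ 0 := by
  have hγo := hγ.isOddArc (by omega)
  obtain ⟨e, he, heν⟩ := exists_ne_zero_inner_eq_zero hN (deriv γ c)
  let φ : ContDiffBump c := ⟨r / 2, r, by positivity, by linarith⟩
  set p : ℝ → Amb N := fun s => (φ s + φ (-s)) • e with hp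
  have hsupp : ∀ s, r ≤ |(|s| - c)| → φ s + φ (-s) = 0 := fun s hs => by
    have key : ∀ t, |t| = |s| → φ t = 0 := fun t ht => by
      refine φ.zero_of_le_dist ?_
      rw [Real.dist_eq]
      rw [← ht] at hs
      refine hs.trans ?_
      have : |t| - c = |t| - |c| := by rw [abs_of_nonneg (hr.le.trans h0)]
      rw [this]
      exact abs_abs_sub_abs_le_abs_sub t c
    rw [key s rfl, key (-s) (abs_neg s), add_zero]
  have hφc : HasCompactSupport φ := φ.hasCompactSupport
  have hts : tsupport φ ⊆ arcI := by
    rw [φ.tsupport_eq, Real.closedBall_eq_Icc]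
    intro s hs
    have h2 : c - r ≤ s := hs.1
    have h3 : s ≤ c + r := hs.2
    constructor <;> linarith
  have hpb : IsBumpField ⊤ p := by
    refine ⟨?_, ?_, ?_, fun s => by simp only [hp, neg_neg, add_comm]⟩
    · exact ((φ.contDiff (n := ⊤)).add ((φ.contDiff (n := ⊤)).comp contDiff_neg)).smul
        contDiff_const
    · exact (hφc.add (hφc.comp_homeomorph (Homeomorph.neg ℝ))).smul_right
    · refine (tsupport_smul_subset_left (fun s => φ s + φ (-s)) _).trans
        ((tsupport_add φ fun s => φ (-s)).trans (union_subset hts fun s hs => ?_))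
      have := hts (tsupport_comp_subset_preimage φ continuous_neg hs)
      simpa using neg_mem_arcI this
  have hpm : IsBumpField m p := hpb.of_le le_top
  have hν := hγ.1.contDiffOn_deriv (j := m) le_rfl
  have hb := hpm.orthField hν fun s hs => hγo.deriv_neg hs
  refine ⟨_, hpm.memTangent hν (fun s hs => hγo.deriv_neg hs) hγ.2, ?_⟩
  rw [deriv_primCurve hb.contDiff.continuous]
  refine ⟨fun s hs => by simp [orthField, hp, hsupp s hs], ?_⟩
  have hφ : φ c + φ (-c) ≠ 0 := by
    have h2 : 0 < φ c := φ.pos_of_mem_ball (Metric.mem_ball_self hr)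
    have h3 : 0 ≤ φ (-c) := φ.nonneg
    positivity
  -- At s = c the direction e is already orthogonal to γ'(c), so the projection leaves the nonzero
  -- bump vector unchanged.
  simp only [orthField, hp, real_inner_smul_left, heν, mul_zero, zero_smul, sub_zero]
  exact smul_ne_zero hφ he

/-- The derivative vanishes off two intervals of total length 4r, so (∫|u'|)² ≤ 4r ∫|u'|², and |u| ≤
∫|u'| on an interval of length 2. -/
theorem IsOddArc.integral_sq_le_of_concentrated (hu : IsOddArc u) (hu2 : MemLp (deriv u) 2 arcMeas)
    {c r : ℝ} (hr : 0 < r) (h : ∀ s, r ≤ |(|s| - c)| → deriv u s = 0) :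
    ∫ s, ‖u s‖ ^ 2 ∂arcMeas ≤ 8 * r * ∫ s, ‖deriv u s‖ ^ 2 ∂arcMeas := by
  set A := ∫ s, ‖deriv u s‖ ∂arcMeas with hA
  set Q := ∫ s, ‖deriv u s‖ ^ 2 ∂arcMeas with hQ
  have hA0 : 0 ≤ A := integral_nonneg fun _ => norm_nonneg _
  have hQi : Integrable (fun s => ‖deriv u s‖ ^ 2) arcMeas :=
    hu2.integrable_norm_pow (by norm_num)
  have hQ0 : 0 ≤ Q := integral_nonneg fun _ => sq_nonneg _
  have h1 : ∫ s, ‖u s‖ ^ 2 ∂arcMeas ≤ 2 * A ^ 2 := by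
    rw [← norm_toL2_sq hu.memLp]
    calc ‖toL2 u‖ ^ 2 = ∫ s, ‖u s‖ ^ 2 ∂arcMeas := norm_toL2_sq hu.memLp
      _ ≤ ∫ s, A ^ 2 ∂arcMeas := integral_mono_ae (hu.memLp.integrable_norm_pow (by norm_num))
          (integrable_const _) (forall_ae_arcMeas fun s hs =>
            pow_le_pow_left₀ (norm_nonneg _) (hu.norm_le hs) 2)
      _ = 2 * A ^ 2 := by rw [integral_const, volume_arcMeas_univ, smul_eq_mul]
  have h2 : A ^ 2 ≤ 4 * r * Q := by
    rcases hA0.eq_or_lt with h0 | h0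
    · rw [← h0, zero_pow two_ne_zero]; positivity
    set S : Set ℝ := Metric.ball c r ∪ Metric.ball (-c) r with hS
    have hSm : MeasurableSet S := measurableSet_ball.union measurableSet_ball
    have hSv : arcMeas.real S ≤ 4 * r := by
      have a1 : arcMeas S ≤ ENNReal.ofReal (4 * r) := by
        refine (Measure.restrict_apply_le _ _).trans ((measure_union_le _ _).trans ?_)
        rw [Real.volume_ball, Real.volume_ball, ← ENNReal.ofReal_add (by positivity) (by positivity)]
        exact ENNReal.ofReal_le_ofReal (by linarith)
      exact ENNReal.toReal_le_of_le_ofReal (by positivity) a1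
    -- The optimal parameter in |u'| ≤ l/2 + |u'|²/(2l), which replaces Cauchy-Schwarz on the
    -- support.
    set l := A / (4 * r) with hl
    have hl0 : 0 < l := by positivity
    have hle : ∀ s, ‖deriv u s‖ ≤ S.indicator (fun _ => l / 2) s + (2 * l)⁻¹ * ‖deriv u s‖ ^ 2 := by
      intro s
      by_cases hs : s ∈ S
      · rw [indicator_of_mem hs]
        have : l / 2 + (2 * l)⁻¹ * ‖deriv u s‖ ^ 2 - ‖deriv u s‖ =
          (2 * l)⁻¹ * (‖deriv u s‖ - l) ^ 2 := by field_simp; ring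
        have h3 : 0 ≤ (2 * l)⁻¹ * (‖deriv u s‖ - l) ^ 2 := by positivity
        linarith
      · rw [indicator_of_notMem hs, h s, norm_zero]
        · simp
        · simp only [hS, mem_union, Metric.mem_ball, Real.dist_eq, not_or, not_lt] at hs
          rcases abs_cases s with ⟨h3, -⟩ | ⟨h3, -⟩
          · rw [h3]; exact hs.1
          · rw [h3]
            exact hs.2.trans_eq (by rw [← abs_neg]; ring_nf)
    have hSi : Integrable (S.indicator fun _ => l / 2) arcMeas :=
      (integrable_const _).indicator hSm
    have h3 : A ≤ ∫ s, (S.indicator (fun _ => l / 2) s + (2 * l)⁻¹ * ‖deriv u s‖ ^ 2) ∂arcMeas :=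
      integral_mono hu.integrable.norm (hSi.add (hQi.const_mul _)) hle
    rw [integral_add hSi (hQi.const_mul _), integral_indicator_const _ hSm, integral_const_mul,
      smul_eq_mul] at h3
    have h4 : arcMeas.real S * (l / 2) ≤ A / 2 := by
      calc _ ≤ 4 * r * (l / 2) := mul_le_mul_of_nonneg_right hSv (by positivity)
        _ = A / 2 := by rw [hl]; field_simp
    have h5 : A / 2 ≤ (2 * l)⁻¹ * Q := by linarith
    have h6 : (2 * l)⁻¹ * Q = 2 * r * Q / A := by rw [hl]; field_simp; norm_num
    rw [h6, le_div_iff₀ h0] at h5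
    linarith
  linarith

theorem gramL2_le (hu : MemLp u 2 arcMeas) (hv : MemLp v 2 arcMeas) :
    gramL2 u v ≤ (∫ s, ‖u s‖ ^ 2 ∂arcMeas) * ∫ s, ‖v s‖ ^ 2 ∂arcMeas := by
  rw [gramL2, ← norm_toL2_sq hu, ← norm_toL2_sq hv, real_inner_self_eq_norm_sq,
    real_inner_self_eq_norm_sq]
  linarith [sq_nonneg (inner ℝ (toL2 u) (toL2 v) : ℝ)]

/-- The curvature is unbounded above. -/
theorem exists_lt_sectionalCurvature (hγ : MemArcSpace (m + 2) γ) (hN : 2 ≤ N) (hm : 2 ≤ m)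
    {z R : ℝ → ℝ} (h : IsDirichletSol (curvPotential γ) z R) (C : ℝ) :
    ∃ u v, MemTangent m γ u ∧ MemTangent m γ v ∧ SpanPlane u v ∧
      C < (∫ p, curvNumer (greenFn z R) u v p.1 p.2 ∂arcMeas.prod arcMeas) / gramL2 u v := by
  have hq := hγ.isPotential hm
  have hW := h.wronskian_pos hq
  set W := 2 * z 0 * R 0 with hWdef
  set t := W * (|C| + 1) with ht
  have ht0 : 0 < t := by positivity
  -- Then 64r²t = t/(4(1+t)²) < 1/4, which is what the comparison of numerator and denominator
  -- requires. Also r ≤ 1/16, so the supports about 1/4 and 1/8 are disjoint, as are their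
  -- reflections, and all stay within |s| ≤ 1/2.
  set r := (16 * (1 + t))⁻¹ with hr
  have hr0 : 0 < r := by positivity
  have hr1 : r ≤ 1 / 16 := by
    rw [hr, one_div]
    exact inv_anti₀ (by norm_num) (by linarith)
  obtain ⟨u, hu, hu0, huc⟩ := hγ.exists_concentrated hN (c := 1 / 4) hr0 (by linarith) (by linarith)
  obtain ⟨v, hv, hv0, hvc⟩ := hγ.exists_concentrated hN (c := 1 / 8) hr0 (by linarith) (by linarith)
  have huo := hu.isOddArc hm
  have hvo := hv.isOddArc hm
  have hu2 := hu.1.memLp_deriv hm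
  have hv2 := hv.1.memLp_deriv hm
  have hdisj : ∀ s, deriv u s = 0 ∨ deriv v s = 0 := fun s => by
    by_cases h1 : r ≤ |(|s| - 1 / 4)|
    · exact Or.inl (hu0 s h1)
    · refine Or.inr (hv0 s ?_)
      rw [not_le, abs_lt] at h1
      rw [le_abs]; left; linarith
  have hspan : SpanPlane u v := by
    intro a b hab
    have hd : ∀ s ∈ arcI, a • deriv u s + b • deriv v s = 0 := fun s hs => by
      have h1 := ((huo.hasDerivAt hs).const_smul a).add ((hvo.hasDerivAt hs).const_smul b)
      refine h1.unique ((hasDerivAt_const s (0 : Amb N)).congr_of_eventuallyEq ?_)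
      filter_upwards [arcI_mem_nhds hs] with x hx using hab x hx
    have h1 := hd (1 / 4) ⟨by norm_num, by norm_num⟩
    have h2 := hd (1 / 8) ⟨by norm_num, by norm_num⟩
    rw [(hdisj (1 / 4)).resolve_left huc, smul_zero, add_zero] at h1
    rw [(hdisj (1 / 8)).resolve_right hvc, smul_zero, zero_add] at h2
    exact ⟨(smul_eq_zero.1 h1).resolve_right huc, (smul_eq_zero.1 h2).resolve_right hvc⟩
  refine ⟨u, v, hu, hv, hspan, ?_⟩
  have hg := (hspan.gramL2_pos huo hvo).1
  set Qu := ∫ s, ‖deriv u s‖ ^ 2 ∂arcMeas with hQu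
  set Qv := ∫ s, ‖deriv v s‖ ^ 2 ∂arcMeas with hQv
  have hQu0 : 0 ≤ Qu := integral_nonneg fun _ => sq_nonneg _
  have hQv0 : 0 ≤ Qv := integral_nonneg fun _ => sq_nonneg _
  have hg2 : gramL2 u v ≤ 64 * r ^ 2 * (Qu * Qv) := by
    refine (gramL2_le huo.memLp hvo.memLp).trans ?_
    refine (mul_le_mul (huo.integral_sq_le_of_concentrated hu2 hr0 hu0)
      (hvo.integral_sq_le_of_concentrated hv2 hr0 hv0) (integral_nonneg fun _ => sq_nonneg _)
      (by positivity)).trans_eq ?_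
    ring
  -- Disjoint supports kill ⟨u', v'⟩, and on |s|, |x| ≤ 1/2 the Green function is at least
  -- (1/2)(1/2)/W.
  have hnum : (4 * W)⁻¹ * (Qu * Qv) ≤
      ∫ p, curvNumer (greenFn z R) u v p.1 p.2 ∂arcMeas.prod arcMeas := by
    have hi := (hu2.integrable_norm_pow (by norm_num : (2 : ℕ) ≠ 0)).mul_prod
      (hv2.integrable_norm_pow (by norm_num : (2 : ℕ) ≠ 0))
    rw [hQu, hQv, ← integral_prod_mul, ← integral_const_mul]
    refine integral_mono_ae (hi.const_mul _) (integrable_curvNumer h hu2 hv2)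
      (forall_ae_prod_arcMeas fun s hs x hx => ?_)
    have hc : (inner ℝ (deriv u s) (deriv v s) : ℝ) = 0 := by
      rcases hdisj s with h1 | h1 <;> simp [h1]
    simp only [curvNumer, hc, mul_zero, sub_zero]
    by_cases h1 : deriv u s = 0
    · simp [h1]
    by_cases h2 : deriv v x = 0
    · simp [h2]
    refine mul_le_mul_of_nonneg_right ?_ (by positivity)
    have h1' : |s| ≤ 1 / 2 := by
      have := lt_of_not_ge fun h' => h1 (hu0 s h')
      rw [abs_lt] at this
      linarith
    have h2' : |x| ≤ 1 / 2 := by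
      have := lt_of_not_ge fun h' => h2 (hv0 x h')
      rw [abs_lt] at this
      linarith
    rw [abs_le] at h1' h2'
    refine le_trans ?_ (greenFn_ge hq h ⟨hs.1.le, hs.2.le⟩ ⟨hx.1.le, hx.2.le⟩)
    have h3 : -(1 / 2) ≤ min s x := le_min h1'.1 h2'.1
    have h4 : max s x ≤ 1 / 2 := max_le h1'.2 h2'.2
    rw [← hWdef, le_div_iff₀ hW, mul_inv, mul_assoc, inv_mul_cancel₀ hW.ne']
    nlinarith
  rw [lt_div_iff₀ hg]
  have hQ : 0 < Qu * Qv := pos_of_mul_pos_right (hg.trans_le hg2) (by positivity)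
  have hr2 : 64 * r ^ 2 * t < 1 / 4 := by
    have e : 64 * r ^ 2 * t = t / (4 * (1 + t) ^ 2) := by rw [hr]; field_simp; norm_num
    rw [e, div_lt_iff₀ (by positivity)]
    nlinarith
  calc C * gramL2 u v ≤ (|C| + 1) * gramL2 u v :=
        mul_le_mul_of_nonneg_right (by linarith [le_abs_self C]) hg.le
    _ ≤ (|C| + 1) * (64 * r ^ 2 * (Qu * Qv)) := mul_le_mul_of_nonneg_left hg2 (by positivity)
    _ = W⁻¹ * (64 * r ^ 2 * t) * (Qu * Qv) := by rw [ht]; field_simp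
    _ < W⁻¹ * (1 / 4) * (Qu * Qv) := by gcongr
    _ = (4 * W)⁻¹ * (Qu * Qv) := by rw [mul_inv]; ring
    _ ≤ _ := hnum

end Unbounded

/-! ### The main theorem -/

theorem mainTheorem3 (N m : ℕ) (hN : 2 ≤ N) (hm : 2 ≤ m) (γ : ℝ → Amb N)
    (hγ : MemArcSpace (m + 2) γ) :
    (∃ G, IsGreenFunction γ G) ∧
    IntervalIntegrable (fun s => (1 - s) * ‖deriv (deriv γ) s‖ ^ 2) volume 0 1 ∧
    (∀ G, IsGreenFunction γ G →
      ∀ u v, MemTangent m γ u → MemTangent m γ v → SpanPlane u v →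
        ∃ K : ℝ, HasSectionalCurvature m γ u v K ∧
          (∀ F, IsRegularSurface m γ u v F → HasRiemannCurvature m F (K * gramL2 u v)) ∧
          IntegrableOn (fun p : ℝ × ℝ => curvNumer G u v p.1 p.2) (arcI ×ˢ arcI) ∧
          IntegrableOn (fun p : ℝ × ℝ => curvDenom u v p.1 p.2) (arcI ×ˢ arcI) ∧
          0 < (∫ x in (-1 : ℝ)..1, ∫ s in (-1 : ℝ)..1, curvDenom u v s x) ∧
          K = (∫ x in (-1 : ℝ)..1, ∫ s in (-1 : ℝ)..1, curvNumer G u v s x) /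
              (∫ x in (-1 : ℝ)..1, ∫ s in (-1 : ℝ)..1, curvDenom u v s x) ∧
          Real.exp (-arcRho γ) / (1 + arcRho γ) ≤ K ∧
          0 < K) ∧
    (∀ C : ℝ, ∃ u v, MemTangent m γ u ∧ MemTangent m γ v ∧ SpanPlane u v ∧
      ∃ K : ℝ, HasSectionalCurvature m γ u v K ∧ C < K) := by
  have hq := hγ.isPotential hm
  obtain ⟨z, R, h⟩ := hq.exists_isDirichletSol
  refine ⟨⟨_, isGreenFunction_greenFn hq h⟩, ?_, fun G hG u v hu hv hs => ?_, fun C => ?_⟩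
  · rw [intervalIntegrable_iff_integrableOn_Ioo_of_le zero_le_one]
    have h2 : Integrable (fun s => ‖deriv (deriv γ) s‖ ^ 2) arcMeas :=
      (hγ.1.memLp_deriv_deriv (by omega)).1.integrable_norm_pow (by norm_num)
    exact IntegrableOn.mono_set (integrable_mul_continuous h2 (g := fun s => 1 - s) (by fun_prop))
      (Ioo_subset_Ioo_left (by norm_num))
  · have hu2 := hu.1.memLp_deriv hm
    have hv2 := hv.1.memLp_deriv hm
    obtain ⟨h1, h2⟩ := hasSectionalCurvature_greenFn hγ hm hu hv h
    obtain ⟨d1, d2⟩ := integrable_curvDenom hu.1.memLp hv.1.memLp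
    have hg := (hs.gramL2_pos (hu.isOddArc hm) (hv.isOddArc hm)).1
    have hlow := exp_neg_arcRho_mul_gramL2_le hγ hm hu hv hs h
    -- Uniqueness gives equality only on the open square, which has full measure for the product of
    -- the two arc measures.
    have hGe : (fun p : ℝ × ℝ => curvNumer (greenFn z R) u v p.1 p.2) =ᵐ[arcMeas.prod arcMeas]
        fun p => curvNumer G u v p.1 p.2 :=
      forall_ae_prod_arcMeas fun s hs x hx => by
        simp only [curvNumer, hG.eq_greenFn hq h s hs x hx]
    have n1 := (integrable_curvNumer h hu2 hv2).congr hGe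
    have n2 := integral_congr_ae hGe
    have i1 := integral_integral_arcI d1
    have i2 := integral_integral_arcI n1
    simp only at i1 i2
    -- This is stronger than required: dividing by 1 + ϱ ≥ 1 only weakens the bound.
    have hK : Real.exp (-arcRho γ) ≤
        (∫ p, curvNumer (greenFn z R) u v p.1 p.2 ∂arcMeas.prod arcMeas) / gramL2 u v :=
      (le_div_iff₀ hg).2 hlow
    refine ⟨_, h1, fun F hF => ?_, ?_, ?_, ?_, ?_, ?_, (Real.exp_pos _).trans_le hK⟩
    · rw [div_mul_cancel₀ _ hg.ne']
      exact h2 F hF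
    · rw [IntegrableOn, ← prod_arcMeas]; exact n1
    · rw [IntegrableOn, ← prod_arcMeas]; exact d1
    · rw [i1, d2]; exact hg
    · rw [i1, i2, d2, n2]
    · exact (div_le_self (Real.exp_pos _).le (by linarith [arcRho_nonneg (γ := γ)])).trans hK
  · obtain ⟨u, v, hu, hv, hs, hC⟩ := exists_lt_sectionalCurvature hγ hN hm h C
    exact ⟨u, v, hu, hv, hs, _, (hasSectionalCurvature_greenFn hγ hm hu hv h).1, hC⟩
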